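/- **Proposition 4.5** (invariance of the CR Ahlfors tensor for maps from a hyperquadric into a Winkelmann hypersurface). *Hypersurfaces.* Let $n\ge 1$, $0\le \ell\le n/2$, $n'\ge 1$, $1\le \ell'\le n'$. Let $M=\mathbb H^{2n+1}_\ell\subset\mathbb C^{n+1}$ be the hyperquadric $\operatorname{Im} w=\sum_{k=1}^n\epsilon_k|z_k|^2$, with $\epsilon_k=-1$ for $k\le \ell$ and $\epsilon_k=1$ for $k>\ell$. Let $N=\mathcal W^{2n'+3}_{\ell'}\subset\mathbb C^{n'+2}$ be the Winkelmann hypersurface $$\operatorname{Im}(w+\bar z_{n'}\zeta)=|z_{n'}|^4+\sum_{k=1}^{n'-1}\epsilon'_k|z_k|^2,$$ with $\epsilon'_k=-1$ for $k\le\ell'-1$ and $\epsilon'_k=1$ for $k\ge\ell'$. For a hypersurface $\operatorname{Im}w=\varphi(z)$ (all coordinates other than $w$ being denoted by $z$), the standard pseudo-Hermitian structure is $\tfrac12\big(dt-i\varphi_\alpha dz_\alpha+i\varphi_{\bar\alpha}d\bar z_\alpha\big)$, $t=\operatorname{Re}w$, which is up to orientation the restriction of $i\bar\partial(\operatorname{Im}w-\varphi)$;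 call it $\theta$ on $M$ and $\eta$ on $N$. Let $Z_\alpha=\partial_{z_\alpha}+2i\varphi_\alpha\partial_w$ be the standard $(1,0)$-frame and $L_\theta$ the Levi form, with matrix $h_{\alpha\bar\beta}=\varphi_{\alpha\bar\beta}$. *CR Ahlfors derivative.* Let $F:U\to N$ be a smooth CR transversal CR map on an open set $U\subset M$. Write $F^*\eta=\lambda\theta$ and $v=\log|\lambda|$; if $\lambda<0$, replace $\eta$ by $-\eta$ in what follows. Put $\hat\theta=e^v\theta$, so that $F^*\eta=\hat\theta$. Let $\nabla,\hat\nabla,\tilde\nabla$ be the Tanaka–Webster connections of $\theta,\hat\theta,\eta$. Let $II(X,Y)=\tilde\nabla_XF_*Y-F_*(\hat\nabla_XY)$ be the second fundamental form, let $\mu=\frac1n\hat h^{\alpha\bar\beta}II(Z_{\bar\beta},Z_\alpha)$ with $\hat h=e^vh$ be the mean curvature vector, and let $\langle\cdot,\cdot\rangle$ be the Levi form of $\eta$. The CR Ahlfors derivative $\mathcal A(F)$ is the real symmetric tensor on the contact bundle of $U$ with components $$\mathcal A_{\alpha\beta}=v_{\alpha,\beta}-v_\alpha v_\beta+\langle II(Z_\alpha,Z_\beta),\bar\mu\rangle,$$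 $$\mathcal A_{\alpha\bar\beta}=\tfrac12\big(v_{\alpha,\bar\beta}+v_{\bar\beta,\alpha}\big)+\tfrac12|\bar\partial_bv|^2h_{\alpha\bar\beta}+\langle II(Z_{\bar\beta},Z_\alpha),\bar\mu\rangle-\tfrac12|\mu|^2\hat h_{\alpha\bar\beta},$$ and $\mathcal A_{\bar\alpha\bar\beta}=\overline{\mathcal A_{\alpha\beta}}$. The matrix $(\mathcal A_{\alpha\bar\beta})$ is its Hermitian part. *Statement.* Let $U,\tilde U\subset M$ be open, let $H:U\to N$ be a smooth CR transversal CR map, let $\gamma:U\to\tilde U$ be a CR automorphism of $M$ and $\phi:V\to V'$ a CR automorphism of $N$ (smooth CR diffeomorphisms between open subsets of $M$ and of $N$ respectively), with $H(U)\subset V$, and let $\tilde H=\phi\circ H\circ\gamma^{-1}:\tilde U\to N$. 1. If $\gamma^*\theta=e^u\theta$ on $U$ for a real function $u$, then $\mathcal A(H)=e^u\mathcal A(\tilde H)$ in the following sense. For every $p\in U$ the restriction of $d\gamma_p$ to the contact space is $e^{u(p)/2}L_p$, where $L_p$ is a complex linear isomorphism from the contact space at $p$ onto that at $\gamma(p)$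 which preserves the Levi form $L_\theta$, and for all contact vectors $X,Y$ at $p$ $$\mathcal A(H)_p(X,Y)=e^{u(p)}\,\mathcal A(\tilde H)_{\gamma(p)}(L_pX,L_pY).$$ 2. The rank of the Hermitian part is an invariant of the equivalence class: for every $p\in U$, $$\operatorname{rank}\big(\mathcal A_{\alpha\bar\beta}(H)\big)\big|_p=\operatorname{rank}\big(\mathcal A_{\alpha\bar\beta}(\tilde H)\big)\big|_{\gamma(p)}.$$ -/

import Mathlib

open scoped ContDiff

noncomputable section

namespace CRGeom

/-! ### Rigid real hypersurfaces `Im w = φ(z)` in `ℂ^m × ℂ` and their CR structure -/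

/-- The ambient space with holomorphic coordinates `(z, w)`. -/
abbrev Amb (m : ℕ) : Type := (Fin m → ℂ) × ℂ

/-- The defining function `ρ(z, w) = Im w - φ(z)`. -/
def defFun {m : ℕ} (φ : (Fin m → ℂ) → ℝ) (p : Amb m) : ℝ := p.2.im - φ p.1

/-- The real hypersurface `ρ = 0`. -/
def hypersurface {m : ℕ} (φ : (Fin m → ℂ) → ℝ) : Set (Amb m) := {p | defFun φ p = 0}

/-- The real tangent space `T_p M = ker dρ_p`. -/
def tangent {m : ℕ} (φ : (Fin m → ℂ) → ℝ) (p : Amb m) : Submodule ℝ (Amb m) :=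
  LinearMap.ker (fderiv ℝ (defFun φ) p : Amb m →ₗ[ℝ] ℝ)

/-- The contact (complex tangent) space `H_p M = T_p M ∩ J T_p M`, `J` being multiplication by `i`.
A real vector `v ∈ H_p M` is identified with the `(1,0)`-vector `∑ v^α Z_α`, of which it is twice
the real part; here `v^α = v.1 α` and `Z_α` is the frame defined below. -/
def contact {m : ℕ} (φ : (Fin m → ℂ) → ℝ) (p : Amb m) : Submodule ℂ (Amb m) where
  carrier := {v | v ∈ tangent φ p ∧ Complex.I • v ∈ tangent φ p}
  add_mem' := by
    rintro a b ⟨ha, ha'⟩ ⟨hb, hb'⟩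
    exact ⟨add_mem ha hb, by rw [smul_add]; exact add_mem ha' hb'⟩
  zero_mem' := ⟨zero_mem _, by rw [smul_zero]; exact zero_mem _⟩
  smul_mem' := by
    rintro c v ⟨hv, hv'⟩
    have key : ∀ x : Amb m, c • x = c.re • x + c.im • (Complex.I • x) := by
      intro x
      conv_lhs => rw [← Complex.re_add_im c]
      rw [add_smul, mul_smul, Complex.coe_smul, Complex.coe_smul]
    refine ⟨?_, ?_⟩
    · rw [key]
      exact add_mem (Submodule.smul_mem _ _ hv) (Submodule.smul_mem _ _ hv')
    · rw [smul_comm, key, smul_smul, Complex.I_mul_I, neg_one_smul]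
      exact add_mem (Submodule.smul_mem _ _ hv') (Submodule.smul_mem _ _ (neg_mem hv))

/-- The standard pseudo-Hermitian structure attached to `ρ`: the real contact form
`θ(v) = ½ dρ(J v)`; on `T M` it is, up to orientation, the restriction of `i ∂̄ρ`, and equals
`½ (dt - i φ_α dz_α + i φ_ᾱ dz̄_α)` with `t = Re w`. -/
def theta {m : ℕ} (φ : (Fin m → ℂ) → ℝ) (p v : Amb m) : ℝ :=
  (1 / 2) * fderiv ℝ (defFun φ) p (Complex.I • v)

/-- The projection of the ambient space onto the hypersurface along `Im w`. -/
def retract {m : ℕ} (φ : (Fin m → ℂ) → ℝ) (p : Amb m) : Amb m :=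
  (p.1, (p.2.re : ℂ) + Complex.I * (φ p.1 : ℂ))

/-- The derivative at `p ∈ M` of a map `f` on `M` along the tangent vector `v ∈ T_p M`. It depends
only on the values of `f` on `M` near `p`. -/
def tderiv {m : ℕ} {V : Type*} [NormedAddCommGroup V] [NormedSpace ℝ V]
    (φ : (Fin m → ℂ) → ℝ) (f : Amb m → V) (p v : Amb m) : V :=
  fderiv ℝ (f ∘ retract φ) p v

/-- The Wirtinger derivative `φ_α = ∂φ/∂z_α`. -/
def wirt {m : ℕ} (φ : (Fin m → ℂ) → ℝ) (α : Fin m) (z : Fin m → ℂ) : ℂ :=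
  (1 / 2) * ((fderiv ℝ φ z (Pi.single α 1) : ℂ)
    - Complex.I * (fderiv ℝ φ z (Pi.single α Complex.I) : ℂ))

/-- The contact vector `2 Re Z_α`, where `Z_α = ∂/∂z_α + 2 i φ_α ∂/∂w`. -/
def frame {m : ℕ} (φ : (Fin m → ℂ) → ℝ) (α : Fin m) (p : Amb m) : Amb m :=
  (Pi.single α 1, 2 * Complex.I * wirt φ α p.1)

/-- The action of the `(1,0)`-vector field `Z_α` on functions on `M`. -/
def Z {m : ℕ} (φ : (Fin m → ℂ) → ℝ) (α : Fin m) (f : Amb m → ℂ) (p : Amb m) : ℂ :=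
  (1 / 2) * (tderiv φ f p (frame φ α p)
    - Complex.I * tderiv φ f p (Complex.I • frame φ α p))

/-- The action of the `(0,1)`-vector field `Z_ᾱ` on functions on `M`. -/
def Zbar {m : ℕ} (φ : (Fin m → ℂ) → ℝ) (α : Fin m) (f : Amb m → ℂ) (p : Amb m) : ℂ :=
  (1 / 2) * (tderiv φ f p (frame φ α p)
    + Complex.I * tderiv φ f p (Complex.I • frame φ α p))

/-- The Reeb vector field `T = 2 ∂/∂t` of `θ`, i.e. `θ(T) = 1` and `dθ(T, ·) = 0`. -/
def reeb (m : ℕ) : Amb m := (0, 2)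

/-- The Levi matrix `h_{αβ̄} = -i dθ(Z_α, Z_β̄) = ∂²φ/∂z_α∂z̄_β`. -/
def levi {m : ℕ} (φ : (Fin m → ℂ) → ℝ) (p : Amb m) : Matrix (Fin m) (Fin m) ℂ :=
  Matrix.of fun α β => Zbar φ β (fun q => wirt φ α q.1) p

/-- The Levi form `L_θ(v, w̄) = h_{αβ̄} v^α w̄^β`. -/
def leviForm {m : ℕ} (φ : (Fin m → ℂ) → ℝ) (p v w : Amb m) : ℂ :=
  ∑ α, ∑ β, levi φ p α β * v.1 α * (starRingEnd ℂ) (w.1 β)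

/-- Christoffel symbols of the Tanaka-Webster connection of `(M, θ)`:
`∇_{Z_α} Z_β = Γ^γ_{αβ} Z_γ` with `Γ^γ_{αβ} = h^{γσ̄} Z_α h_{βσ̄}`. Those of mixed type
(`∇_{Z_ᾱ} Z_β`) and `∇_T Z_β` vanish, since `[Z_ᾱ, Z_β]` is a multiple of `T` and
`[T, Z_β] = 0`. The inverse `h^{γσ̄}` is the entry `(σ, γ)` of the inverse matrix. -/
def christoffel {m : ℕ} (φ : (Fin m → ℂ) → ℝ) (γ α β : Fin m) (p : Amb m) : ℂ :=
  ∑ σ, (levi φ p)⁻¹ σ γ * Z φ α (fun q => levi φ q β σ) p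

/-! ### CR maps -/

/-- `F` restricts to a smooth CR map from the open part `M ∩ O` of `M = M_φ` into `M_ψ`:
its differential is complex linear on the contact spaces. -/
structure IsCRMap {m k : ℕ} (φ : (Fin m → ℂ) → ℝ) (ψ : (Fin k → ℂ) → ℝ)
    (O : Set (Amb m)) (F : Amb m → Amb k) : Prop where
  mapsTo : Set.MapsTo F (hypersurface φ ∩ O) (hypersurface ψ)
  smooth : ContDiffOn ℝ ∞ F (hypersurface φ ∩ O)
  cr : ∀ p ∈ hypersurface φ ∩ O, ∀ v ∈ contact φ p,
    tderiv φ F p (Complex.I • v) = Complex.I • tderiv φ F p v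

/-- CR transversality on `M ∩ O`: `F_* (T_p M)` is not contained in the contact space. -/
def IsTransversal {m k : ℕ} (φ : (Fin m → ℂ) → ℝ) (ψ : (Fin k → ℂ) → ℝ)
    (O : Set (Amb m)) (F : Amb m → Amb k) : Prop :=
  ∀ p ∈ hypersurface φ ∩ O, ∃ v ∈ tangent φ p, tderiv φ F p v ∉ contact ψ (F p)

/-- `γ` restricts to a CR diffeomorphism between the open parts `M ∩ O` and `M ∩ O'` of `M`, with
inverse `γ'`. (`O = O' = univ` gives the automorphisms defined on all of `M`; smaller open sets
are needed for the automorphisms with poles, such as `(z, w) ↦ (z / w, -1 / w)`.) -/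
structure IsCRAut {m : ℕ} (φ : (Fin m → ℂ) → ℝ) (O O' : Set (Amb m))
    (γ γ' : Amb m → Amb m) : Prop where
  crMap : IsCRMap φ φ O γ
  crMap_symm : IsCRMap φ φ O' γ'
  mapsTo : Set.MapsTo γ (hypersurface φ ∩ O) (hypersurface φ ∩ O')
  mapsTo_symm : Set.MapsTo γ' (hypersurface φ ∩ O') (hypersurface φ ∩ O)
  left_inv : Set.LeftInvOn γ' γ (hypersurface φ ∩ O)
  right_inv : Set.RightInvOn γ' γ (hypersurface φ ∩ O')

/-! ### The CR Ahlfors derivative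

For a transversal CR map `F : (M, θ) → (N, η)` between Levi-nondegenerate hypersurfaces write
`F^* η = λ θ` and `u = log |λ|`. If `λ < 0` then `η` is replaced by `-η`, so that always
`F^* (± η) = θ̂ := e^u θ`. Let `II` be the second fundamental form of `F : (M, θ̂) → (N, ± η)`, that
is, `II(X, Y) = ∇̃_X F_* Y - F_* (∇̂_X Y)`, where `∇̃` and `∇̂` are the Tanaka-Webster connections of
`± η` and of `θ̂`, and let `μ` be its (1,0) mean curvature vector. The CR Ahlfors derivative is the
symmetric real tensor on the contact bundle
`A(F) = H_θ(u) + ⟨II, μ⟩ - ½ |μ|² L_θ̂`, with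
`H_θ(u) = Sym ∇∇u - ∂_b u ⊗ ∂_b u - ∂̄_b u ⊗ ∂̄_b u + ½ |∂̄_b u|² L_θ`. -/

section Ahlfors

variable {m k : ℕ} (φ : (Fin m → ℂ) → ℝ) (ψ : (Fin k → ℂ) → ℝ) (F : Amb m → Amb k)

/-- The function `λ` with `F^* η = λ θ` (evaluate both sides on the Reeb field of `θ`). -/
def factor (p : Amb m) : ℝ := theta ψ (F p) (tderiv φ F p (reeb m))

/-- `u = log |λ|`. -/
def logFactor (p : Amb m) : ℝ := Real.log |factor φ ψ F p|

/-- `u` as a complex valued function. -/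
def logFactorC (p : Amb m) : ℂ := (logFactor φ ψ F p : ℂ)

/-- `u^γ = h^{γσ̄} u_σ̄`. -/
def gradUp (γ : Fin m) (p : Amb m) : ℂ :=
  ∑ σ, (levi φ p)⁻¹ σ γ * Zbar φ σ (logFactorC φ ψ F) p

/-- `|∂̄_b u|² = h^{γσ̄} u_γ u_σ̄`. -/
def gradSq (p : Amb m) : ℂ :=
  ∑ γ, gradUp φ ψ F γ p * Z φ γ (logFactorC φ ψ F) p

/-- The Hermitian product `⟨X, Ȳ⟩` of (1,0)-vectors `X^i Z̃_i`, `Y^i Z̃_i` of `N` at `F(p)` given by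
the Levi form of `± η`. -/
def pairing (p : Amb m) (X Y : Fin k → ℂ) : ℂ :=
  (Real.sign (factor φ ψ F p) : ℂ) *
    ∑ i, ∑ j, levi ψ (F p) i j * X i * (starRingEnd ℂ) (Y j)

/-- Components of `II(Z_α, Z_β)`, with `F_* Z_β = (Z_β F^i) Z̃_i` and
`∇̂_{Z_α} Z_β = (Γ^γ_{αβ} + u_α δ^γ_β + u_β δ^γ_α) Z_γ`. -/
def secondFormPure (α β : Fin m) (p : Amb m) (i : Fin k) : ℂ :=
  Z φ α (Z φ β (fun q => (F q).1 i)) p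
    + ∑ a, ∑ b, christoffel ψ i a b (F p)
        * Z φ α (fun q => (F q).1 a) p * Z φ β (fun q => (F q).1 b) p
    - ∑ γ, christoffel φ γ α β p * Z φ γ (fun q => (F q).1 i) p
    - Z φ α (logFactorC φ ψ F) p * Z φ β (fun q => (F q).1 i) p
    - Z φ β (logFactorC φ ψ F) p * Z φ α (fun q => (F q).1 i) p

/-- Components of `II(Z_β̄, Z_α)`, with `∇̂_{Z_β̄} Z_α = - h_{αβ̄} u^γ Z_γ`. -/
def secondFormMixed (α β : Fin m) (p : Amb m) (i : Fin k) : ℂ :=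
  Zbar φ β (Z φ α (fun q => (F q).1 i)) p
    + levi φ p α β * ∑ γ, gradUp φ ψ F γ p * Z φ γ (fun q => (F q).1 i) p

/-- The (1,0) mean curvature vector `μ = (1/m) ĥ^{αβ̄} II(Z_β̄, Z_α)`, where `ĥ = e^u h`. -/
def meanCurv (p : Amb m) (i : Fin k) : ℂ :=
  (1 / (m : ℂ)) * (Real.exp (-logFactor φ ψ F p) : ℂ) *
    ∑ α, ∑ β, (levi φ p)⁻¹ β α * secondFormMixed φ ψ F α β p i

/-- The (2,0)-part `A(F)_{αβ} = u_{α,β} - u_α u_β + ⟨II(Z_α, Z_β), μ̄⟩`. -/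
def ahlforsPure (p : Amb m) : Matrix (Fin m) (Fin m) ℂ :=
  Matrix.of fun α β =>
    Z φ α (Z φ β (logFactorC φ ψ F)) p
      - ∑ γ, christoffel φ γ α β p * Z φ γ (logFactorC φ ψ F) p
      - Z φ α (logFactorC φ ψ F) p * Z φ β (logFactorC φ ψ F) p
      + pairing φ ψ F p (secondFormPure φ ψ F α β p) (meanCurv φ ψ F p)

/-- The Hermitian part `A(F)_{αβ̄} = ½ (u_{α,β̄} + u_{β̄,α}) + ½ |∂̄_b u|² h_{αβ̄}
+ ⟨II(Z_β̄, Z_α), μ̄⟩ - ½ |μ|² ĥ_{αβ̄}`. -/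
def ahlforsHerm (p : Amb m) : Matrix (Fin m) (Fin m) ℂ :=
  Matrix.of fun α β =>
    (1 / 2) * (Zbar φ β (Z φ α (logFactorC φ ψ F)) p + Z φ α (Zbar φ β (logFactorC φ ψ F)) p)
      + (1 / 2) * gradSq φ ψ F p * levi φ p α β
      + pairing φ ψ F p (secondFormMixed φ ψ F α β p) (meanCurv φ ψ F p)
      - (1 / 2) * pairing φ ψ F p (meanCurv φ ψ F p) (meanCurv φ ψ F p)
          * ((Real.exp (logFactor φ ψ F p) : ℂ) * levi φ p α β)

/-- The CR Ahlfors derivative as a real tensor on the contact space: for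
`X = X^α Z_α + c.c.` and `Y = Y^α Z_α + c.c.`,
`A(F)(X, Y) = 2 Re (A_{αβ} X^α Y^β + A_{αβ̄} X^α Ȳ^β)`. -/
def ahlfors (p X Y : Amb m) : ℝ :=
  2 * (∑ α, ∑ β, (ahlforsPure φ ψ F p α β * X.1 α * Y.1 β
    + ahlforsHerm φ ψ F p α β * X.1 α * (starRingEnd ℂ) (Y.1 β))).re

end Ahlfors

/-! ### Hyperquadrics and Winkelmann hypersurfaces -/

/-- The hyperquadric of signature `ℓ` in `ℂ^{n+1}` is `Im w = ∑ ε_k |z_k|²`, with `ε_k = -1` for the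
first `ℓ` indices and `ε_k = 1` otherwise. -/
def quadric (n l : ℕ) (z : Fin n → ℂ) : ℝ :=
  ∑ i : Fin n, (if (i : ℕ) < l then (-1 : ℝ) else 1) * ‖z i‖ ^ 2

/-- The Winkelmann hypersurface in `ℂ^{n'+2}`, `n' = k + 1`, with coordinates
`(z_1, …, z_k, z_{n'}, ζ, w)`, is `Im w = φ` for
`φ = |z_{n'}|⁴ + ∑_{j ≤ k} ε'_j |z_j|² - Im (z̄_{n'} ζ)`, with `ε'_j = -1` for the first `l - 1`
indices and `ε'_j = 1` otherwise. -/
def winkelmann (k l : ℕ) (z : Fin (k + 2) → ℂ) : ℝ :=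
  ‖z ((Fin.last k).castSucc)‖ ^ 4
    + ∑ j : Fin k, (if (j : ℕ) < l - 1 then (-1 : ℝ) else 1) * ‖z (j.castSucc.castSucc)‖ ^ 2
    - ((starRingEnd ℂ) (z ((Fin.last k).castSucc)) * z (Fin.last (k + 1))).im

/-- The defining function of the Winkelmann hypersurface in its usual form. -/
theorem defFun_winkelmann (k l : ℕ) (p : Amb (k + 2)) :
    defFun (winkelmann k l) p =
      (p.2 + (starRingEnd ℂ) (p.1 ((Fin.last k).castSucc)) * p.1 (Fin.last (k + 1))).im
        - ‖p.1 ((Fin.last k).castSucc)‖ ^ 4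
        - ∑ j : Fin k, (if (j : ℕ) < l - 1 then (-1 : ℝ) else 1)
            * ‖p.1 (j.castSucc.castSucc)‖ ^ 2 := by
  simp only [defFun, winkelmann, Complex.add_im]
  ring

end CRGeom

end

/-! A rigid hypersurface is invariant under translations of `Re w`, so its Reeb field T commutes
with all Z_α and Z_ᾱ, while [Z_β̄, Z_α] = i h_{αβ̄} T. For a transversal CR map F with F^*η = λθ,
everything is therefore expressible through the components F_α^i = Z_α F^i and T F^i. The functions
T F^i are again CR, λh is the pull-back of the target Levi form, and the derivatives of λ are Levi
pairings of F_*T with F_α. Hence II(Z_β̄, Z_α) = h_{αβ̄} ξ with ξ the normal part of i F_*T.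

Two simplifications of A(F) follow. The (2,0)-part vanishes identically
(`SmoothCR.ahlforsPure_eq_zero`), and in the Hermitian part the gradient terms cancel, leaving the
symmetrised complex Hessian of log |λ| plus ½ λ⁻¹ |F_*T|² h (`SmoothCR.ahlforsHerm_eq`). In this
form the cocycle law A(G ∘ F) = A(F) + F^*A(G) is a direct expansion (`SmoothCR.ahlforsHerm_comp`).

It remains to see that automorphisms have A = 0. In equal dimensions there are no normal directions,
so the (2,0) second fundamental form is zero. Differentiating this equation by Z_σ̄ and contracting
with the inverse Levi matrix leaves only the Ricci tensors of the two sides. If both are zero, one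
obtains a linear system for the complex Hessian of log |λ|; its trace determines the contraction,
and then the system itself says A = 0 (`SmoothCR.ahlforsHerm_eq_zero`). The hyperquadric has a
constant Levi matrix. The Winkelmann hypersurface is not flat, but its only curvature component is
trace-free (`ricciFlat_winkelmann`).

Finally Φ ∘ H = H' ∘ γ on M. Applying the cocycle law to both sides gives A(H) = γ^*A(H')
(`Equivalent.ahlforsHerm_eq`). The Jacobian of γ is invertible, whence the equality of ranks;
writing dγ = e^{u/2} L on contact vectors produces the factor e^u. -/

noncomputable section

namespace CRGeom

/-! ### Smooth functions on a rigid hypersurface and their derivations -/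

section Calculus

variable {m : ℕ} {φ : (Fin m → ℂ) → ℝ} {O : Set (Amb m)} {p : Amb m}
variable {V W : Type*} [NormedAddCommGroup V] [NormedSpace ℝ V]
  [NormedAddCommGroup W] [NormedSpace ℝ W]

/-- `f` restricts to a smooth function on `M ∩ O`. -/
def Sm (φ : (Fin m → ℂ) → ℝ) (O : Set (Amb m)) (f : Amb m → V) : Prop :=
  ContDiffOn ℝ ∞ (f ∘ retract φ) (retract φ ⁻¹' O)

/-- The action of the Reeb field on functions. -/
def reebD (φ : (Fin m → ℂ) → ℝ) (f : Amb m → ℂ) (p : Amb m) : ℂ := tderiv φ f p (reeb m)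

theorem retract_mem (φ : (Fin m → ℂ) → ℝ) (p : Amb m) : retract φ p ∈ hypersurface φ := by
  simp [retract, hypersurface, defFun]

theorem retract_eq (hp : p ∈ hypersurface φ) : retract φ p = p := by
  have h : p.2.im = φ p.1 := by
    simpa [hypersurface, defFun, sub_eq_zero] using hp
  refine Prod.ext rfl ?_
  apply Complex.ext <;> simp [retract, h]

theorem retract_retract (φ : (Fin m → ℂ) → ℝ) (p : Amb m) :
    retract φ (retract φ p) = retract φ p := retract_eq (retract_mem φ p)

theorem contDiff_retract (hφ : ContDiff ℝ ∞ φ) : ContDiff ℝ ∞ (retract φ) := by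
  unfold retract
  refine contDiff_fst.prodMk ?_
  refine ContDiff.add ?_ (contDiff_const.mul ?_)
  · exact Complex.ofRealCLM.contDiff.comp (Complex.reCLM.contDiff.comp contDiff_snd)
  · exact Complex.ofRealCLM.contDiff.comp (hφ.comp contDiff_fst)

theorem isOpen_retract_preimage (hφ : ContDiff ℝ ∞ φ) (hO : IsOpen O) :
    IsOpen (retract φ ⁻¹' O) := hO.preimage (contDiff_retract hφ).continuous

theorem mem_retract_preimage (hp : p ∈ hypersurface φ ∩ O) : p ∈ retract φ ⁻¹' O := by
  simpa [retract_eq hp.1] using hp.2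

theorem retract_mapsTo : Set.MapsTo (retract φ) (retract φ ⁻¹' O) (retract φ ⁻¹' O) := by
  intro q hq
  simpa [retract_retract] using hq

theorem Sm.contDiffAt {f : Amb m → V} (hf : Sm φ O f) (hφ : ContDiff ℝ ∞ φ) (hO : IsOpen O)
    (hp : p ∈ hypersurface φ ∩ O) : ContDiffAt ℝ ∞ (f ∘ retract φ) p :=
  ContDiffOn.contDiffAt hf ((isOpen_retract_preimage hφ hO).mem_nhds (mem_retract_preimage hp))

theorem Sm.differentiableAt {f : Amb m → V} (hf : Sm φ O f) (hφ : ContDiff ℝ ∞ φ)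
    (hO : IsOpen O) (hp : p ∈ hypersurface φ ∩ O) : DifferentiableAt ℝ (f ∘ retract φ) p :=
  (hf.contDiffAt hφ hO hp).differentiableAt (by simp)

theorem eventuallyEq_of_eqOn {V : Type*} (hφ : ContDiff ℝ ∞ φ) (hO : IsOpen O) {f g : Amb m → V}
    (h : Set.EqOn f g (hypersurface φ ∩ O)) (hp : p ∈ hypersurface φ ∩ O) :
    f ∘ retract φ =ᶠ[nhds p] g ∘ retract φ := by
  filter_upwards [(isOpen_retract_preimage hφ hO).mem_nhds (mem_retract_preimage hp)] with q hq
  exact h ⟨retract_mem φ q, hq⟩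

theorem tderiv_congr (hφ : ContDiff ℝ ∞ φ) (hO : IsOpen O) {f g : Amb m → V}
    (h : Set.EqOn f g (hypersurface φ ∩ O)) (hp : p ∈ hypersurface φ ∩ O) (v : Amb m) :
    tderiv φ f p v = tderiv φ g p v := by
  unfold tderiv
  rw [(eventuallyEq_of_eqOn hφ hO h hp).fderiv_eq]

/-- The composite `f ∘ retract φ` does not see `Im w`, and p differs from its projection by a
vertical translation only; so the derivative is the same at both points. -/
theorem tderiv_retract (f : Amb m → V) (p v : Amb m) :
    tderiv φ f (retract φ p) v = tderiv φ f p v := by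
  unfold tderiv
  set c : Amb m := retract φ p - p with hc
  have h1 : f ∘ retract φ = fun q => (f ∘ retract φ) (q + c) := by
    funext q
    simp only [Function.comp]
    congr 1
    refine Prod.ext (by simp [retract, hc]) ?_
    apply Complex.ext <;> simp [retract, hc]
  have h2 : fderiv ℝ (f ∘ retract φ) p = fderiv ℝ (f ∘ retract φ) (p + c) := by
    conv_lhs => rw [h1]
    exact fderiv_comp_add_right c
  rw [h2]
  simp [hc]

theorem Sm.congr {f g : Amb m → V} (hf : Sm φ O f) (h : Set.EqOn g f (hypersurface φ ∩ O)) :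
    Sm φ O g := by
  refine ContDiffOn.congr hf ?_
  intro q hq
  exact h ⟨retract_mem φ q, hq⟩

theorem Sm.comp_contDiff {f : Amb m → V} {g : V → W} (hg : ContDiff ℝ ∞ g) (hf : Sm φ O f) :
    Sm φ O (fun q => g (f q)) := hg.comp_contDiffOn hf

theorem Sm.of_contDiffOn (hφ : ContDiff ℝ ∞ φ) {f : Amb m → V}
    (hf : ContDiffOn ℝ ∞ f (hypersurface φ ∩ O)) : Sm φ O f :=
  hf.comp (contDiff_retract hφ).contDiffOn fun q hq => ⟨retract_mem φ q, hq⟩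

theorem Sm.of_contDiff (hφ : ContDiff ℝ ∞ φ) {f : Amb m → V} (hf : ContDiff ℝ ∞ f) :
    Sm φ O f := Sm.of_contDiffOn hφ hf.contDiffOn

theorem Sm.const (c : V) : Sm φ O (fun _ => c) := contDiffOn_const

theorem Sm.add {f g : Amb m → V} (hf : Sm φ O f) (hg : Sm φ O g) :
    Sm φ O (fun q => f q + g q) := ContDiffOn.add hf hg

theorem Sm.neg {f : Amb m → V} (hf : Sm φ O f) : Sm φ O (fun q => -f q) := ContDiffOn.neg hf

theorem Sm.sub {f g : Amb m → V} (hf : Sm φ O f) (hg : Sm φ O g) :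
    Sm φ O (fun q => f q - g q) := ContDiffOn.sub hf hg

theorem Sm.mul {f g : Amb m → ℂ} (hf : Sm φ O f) (hg : Sm φ O g) :
    Sm φ O (fun q => f q * g q) := ContDiffOn.mul hf hg

theorem Sm.const_mul (c : ℂ) {f : Amb m → ℂ} (hf : Sm φ O f) :
    Sm φ O (fun q => c * f q) := (Sm.const c).mul hf

theorem Sm.sum {ι : Type*} {s : Finset ι} {f : ι → Amb m → V} (hf : ∀ i ∈ s, Sm φ O (f i)) :
    Sm φ O (fun q => ∑ i ∈ s, f i q) := by
  have := ContDiffOn.sum (s := s) (f := fun i => f i ∘ retract φ) (t := retract φ ⁻¹' O)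
    (𝕜 := ℝ) (n := ∞) hf
  exact this

theorem Sm.conj {f : Amb m → ℂ} (hf : Sm φ O f) :
    Sm φ O (fun q => (starRingEnd ℂ) (f q)) :=
  Sm.comp_contDiff (g := fun z => (starRingEnd ℂ) z) Complex.conjCLE.contDiff hf

theorem Sm.ofReal {f : Amb m → ℝ} (hf : Sm φ O f) : Sm φ O (fun q => (f q : ℂ)) :=
  Sm.comp_contDiff (g := fun x : ℝ => (x : ℂ)) Complex.ofRealCLM.contDiff hf

theorem Sm.tderiv (hφ : ContDiff ℝ ∞ φ) (hO : IsOpen O) {f : Amb m → V} (hf : Sm φ O f)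
    {v : Amb m → Amb m} (hv : ContDiff ℝ ∞ v) : Sm φ O (fun q => tderiv φ f q (v q)) := by
  have h1 : ContDiffOn ℝ ∞ (fderiv ℝ (f ∘ retract φ)) (retract φ ⁻¹' O) :=
    ContDiffOn.fderiv_of_isOpen hf (isOpen_retract_preimage hφ hO) (by simp)
  have h2 : ContDiffOn ℝ ∞ (fun q => fderiv ℝ (f ∘ retract φ) (retract φ q))
      (retract φ ⁻¹' O) := h1.comp (contDiff_retract hφ).contDiffOn retract_mapsTo
  exact h2.clm_apply (hv.comp (contDiff_retract hφ)).contDiffOn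

theorem contDiff_wirt (hφ : ContDiff ℝ ∞ φ) (α : Fin m) : ContDiff ℝ ∞ (wirt φ α) := by
  have h : ∀ v : Fin m → ℂ, ContDiff ℝ ∞ fun z => ((fderiv ℝ φ z v : ℝ) : ℂ) := fun v =>
    Complex.ofRealCLM.contDiff.comp
      ((hφ.fderiv_right (m := ∞) (by simp)).clm_apply contDiff_const)
  unfold wirt
  exact contDiff_const.mul ((h _).sub (contDiff_const.mul (h _)))

theorem contDiff_frame (hφ : ContDiff ℝ ∞ φ) (α : Fin m) : ContDiff ℝ ∞ (frame φ α) := by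
  unfold frame
  exact contDiff_const.prodMk (contDiff_const.mul ((contDiff_wirt hφ α).comp contDiff_fst))

theorem Sm.Z (hφ : ContDiff ℝ ∞ φ) (hO : IsOpen O) {f : Amb m → ℂ} (hf : Sm φ O f) (α : Fin m) :
    Sm φ O (Z φ α f) :=
  ((hf.tderiv hφ hO (contDiff_frame hφ α)).sub
    ((hf.tderiv hφ hO ((contDiff_frame hφ α).const_smul Complex.I)).const_mul
      Complex.I)).const_mul (1 / 2)

theorem Sm.Zbar (hφ : ContDiff ℝ ∞ φ) (hO : IsOpen O) {f : Amb m → ℂ} (hf : Sm φ O f)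
    (α : Fin m) : Sm φ O (Zbar φ α f) :=
  ((hf.tderiv hφ hO (contDiff_frame hφ α)).add
    ((hf.tderiv hφ hO ((contDiff_frame hφ α).const_smul Complex.I)).const_mul
      Complex.I)).const_mul (1 / 2)

theorem Sm.reebD (hφ : ContDiff ℝ ∞ φ) (hO : IsOpen O) {f : Amb m → ℂ} (hf : Sm φ O f) :
    Sm φ O (reebD φ f) := hf.tderiv hφ hO contDiff_const

/-- A complex derivation at the point `p` of the smooth functions on `M ∩ O`. -/
structure IsDer (φ : (Fin m → ℂ) → ℝ) (O : Set (Amb m)) (p : Amb m)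
    (D : (Amb m → ℂ) → ℂ) : Prop where
  add : ∀ {f g}, Sm φ O f → Sm φ O g → D (fun q => f q + g q) = D f + D g
  mul : ∀ {f g}, Sm φ O f → Sm φ O g → D (fun q => f q * g q) = D f * g p + f p * D g
  const : ∀ c, D (fun _ => c) = 0
  congr : ∀ {f g}, Set.EqOn f g (hypersurface φ ∩ O) → D f = D g
  -- The Leibniz rule alone does not yield a chain rule. The logarithm is the one non-polynomial
  -- function needed, and this form of its rule passes to complex linear combinations of
  -- derivations.
  log : ∀ {f : Amb m → ℝ}, Sm φ O f → f p ≠ 0 →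
    f p * D (fun q => (Real.log (f q) : ℂ)) = D (fun q => (f q : ℂ))

theorem isDer_tderiv (hφ : ContDiff ℝ ∞ φ) (hO : IsOpen O) (hp : p ∈ hypersurface φ ∩ O)
    (v : Amb m) : IsDer φ O p (fun f => tderiv φ f p v) where
  add {f g} hf hg := by
    have h := fderiv_add (hf.differentiableAt hφ hO hp) (hg.differentiableAt hφ hO hp)
    have h2 := congrArg (fun L => L v) h
    exact h2
  mul {f g} hf hg := by
    have h := fderiv_mul (hf.differentiableAt hφ hO hp) (hg.differentiableAt hφ hO hp)
    have h2 := congrArg (fun L => L v) h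
    have h3 : tderiv φ (fun q => f q * g q) p v = _ := h2
    rw [h3]
    simp [tderiv, retract_eq hp.1]
    ring
  const c := by
    have : ((fun _ : Amb m => c) ∘ retract φ) = fun _ => c := rfl
    simp [tderiv, this]
  congr h := tderiv_congr hφ hO h hp v
  log {f} hf h0 := by
    have hd := (hf.differentiableAt hφ hO hp).hasFDerivAt
    have h0' : (f ∘ retract φ) p ≠ 0 := by simpa [retract_eq hp.1] using h0
    have hl := hd.log h0'
    have h1 := (Complex.ofRealCLM.hasFDerivAt.comp p hl).fderiv
    have h2 := (Complex.ofRealCLM.hasFDerivAt.comp p hd).fderiv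
    have e1 : tderiv φ (fun q => (Real.log (f q) : ℂ)) p v = _ := congrArg (fun L => L v) h1
    have e2 : tderiv φ (fun q => (f q : ℂ)) p v = _ := congrArg (fun L => L v) h2
    rw [e1, e2]
    simp only [Function.comp, retract_eq hp.1, ContinuousLinearMap.comp_apply,
      smul_apply, Complex.ofRealCLM_apply, smul_eq_mul, Complex.ofReal_mul,
      Complex.ofReal_inv]
    have : (f p : ℂ) ≠ 0 := by exact_mod_cast h0
    field_simp

namespace IsDer

variable {D D' : (Amb m → ℂ) → ℂ}

theorem lincomb (hD : IsDer φ O p D) (hD' : IsDer φ O p D') (a b : ℂ) :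
    IsDer φ O p (fun f => a * D f + b * D' f) where
  add hf hg := by rw [hD.add hf hg, hD'.add hf hg]; ring
  mul hf hg := by rw [hD.mul hf hg, hD'.mul hf hg]; ring
  const c := by rw [hD.const, hD'.const]; ring
  congr h := by rw [hD.congr h, hD'.congr h]
  log hf h0 := by rw [← hD.log hf h0, ← hD'.log hf h0]; ring

theorem const_mul (hD : IsDer φ O p D) (c : ℂ) {f : Amb m → ℂ} (hf : Sm φ O f) :
    D (fun q => c * f q) = c * D f := by
  rw [hD.mul (Sm.const c) hf, hD.const]; ring

theorem neg (hD : IsDer φ O p D) {f : Amb m → ℂ} (hf : Sm φ O f) :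
    D (fun q => -f q) = -D f := by
  have := hD.const_mul (-1) hf
  simpa using this

theorem sub (hD : IsDer φ O p D) {f g : Amb m → ℂ} (hf : Sm φ O f) (hg : Sm φ O g) :
    D (fun q => f q - g q) = D f - D g := by
  have := hD.add hf hg.neg
  rw [hD.neg hg] at this
  simpa [sub_eq_add_neg] using this

theorem sum (hD : IsDer φ O p D) {ι : Type*} {s : Finset ι} {f : ι → Amb m → ℂ}
    (hf : ∀ i ∈ s, Sm φ O (f i)) : D (fun q => ∑ i ∈ s, f i q) = ∑ i ∈ s, D (f i) := by
  classical
  induction s using Finset.induction_on with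
  | empty => simpa using hD.const 0
  | insert a s ha ih =>
    have h1 : ∀ i ∈ s, Sm φ O (f i) := fun i hi => hf i (Finset.mem_insert_of_mem hi)
    simp only [Finset.sum_insert ha]
    rw [hD.add (hf a (Finset.mem_insert_self a s)) (Sm.sum h1), ih h1]

theorem zero_of_eqOn (hD : IsDer φ O p D) {f : Amb m → ℂ}
    (h : ∀ q ∈ hypersurface φ ∩ O, f q = 0) : D f = 0 := by
  rw [hD.congr (g := fun _ => 0) h, hD.const]

end IsDer

theorem isDer_Z (hφ : ContDiff ℝ ∞ φ) (hO : IsOpen O) (hp : p ∈ hypersurface φ ∩ O)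
    (α : Fin m) : IsDer φ O p (fun f => Z φ α f p) := by
  have h := (isDer_tderiv hφ hO hp (frame φ α p)).lincomb
    (isDer_tderiv hφ hO hp (Complex.I • frame φ α p)) (1 / 2) (-(1 / 2) * Complex.I)
  convert h using 2 with f
  simp only [Z]; ring

theorem isDer_Zbar (hφ : ContDiff ℝ ∞ φ) (hO : IsOpen O) (hp : p ∈ hypersurface φ ∩ O)
    (α : Fin m) : IsDer φ O p (fun f => Zbar φ α f p) := by
  have h := (isDer_tderiv hφ hO hp (frame φ α p)).lincomb
    (isDer_tderiv hφ hO hp (Complex.I • frame φ α p)) (1 / 2) ((1 / 2) * Complex.I)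
  convert h using 2 with f
  simp only [Zbar]; ring

theorem isDer_reebD (hφ : ContDiff ℝ ∞ φ) (hO : IsOpen O) (hp : p ∈ hypersurface φ ∩ O) :
    IsDer φ O p (fun f => reebD φ f p) := isDer_tderiv hφ hO hp _

theorem tderiv_conj (hφ : ContDiff ℝ ∞ φ) (hO : IsOpen O) (hp : p ∈ hypersurface φ ∩ O)
    {f : Amb m → ℂ} (hf : Sm φ O f) (v : Amb m) :
    tderiv φ (fun q => (starRingEnd ℂ) (f q)) p v = (starRingEnd ℂ) (tderiv φ f p v) := by
  have h := (Complex.conjCLE.hasFDerivAt.comp p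
    (hf.differentiableAt hφ hO hp).hasFDerivAt).fderiv
  exact congrArg (fun L => L v) h

theorem Zbar_conj (hφ : ContDiff ℝ ∞ φ) (hO : IsOpen O) (hp : p ∈ hypersurface φ ∩ O)
    {f : Amb m → ℂ} (hf : Sm φ O f) (α : Fin m) :
    Zbar φ α (fun q => (starRingEnd ℂ) (f q)) p = (starRingEnd ℂ) (Z φ α f p) := by
  simp only [Z, Zbar, tderiv_conj hφ hO hp hf, map_mul, map_sub, Complex.conj_I,
    map_div₀, map_one, map_ofNat]
  ring

theorem Z_conj (hφ : ContDiff ℝ ∞ φ) (hO : IsOpen O) (hp : p ∈ hypersurface φ ∩ O)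
    {f : Amb m → ℂ} (hf : Sm φ O f) (α : Fin m) :
    Z φ α (fun q => (starRingEnd ℂ) (f q)) p = (starRingEnd ℂ) (Zbar φ α f p) := by
  simp only [Z, Zbar, tderiv_conj hφ hO hp hf, map_mul, map_add, Complex.conj_I,
    map_div₀, map_one, map_ofNat]
  ring

theorem reebD_conj (hφ : ContDiff ℝ ∞ φ) (hO : IsOpen O) (hp : p ∈ hypersurface φ ∩ O)
    {f : Amb m → ℂ} (hf : Sm φ O f) :
    reebD φ (fun q => (starRingEnd ℂ) (f q)) p = (starRingEnd ℂ) (reebD φ f p) :=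
  tderiv_conj hφ hO hp hf _

/-- For a real function, `Z_ᾱ f` is the conjugate of `Z_α f`. -/
theorem conj_Z_ofReal (hφ : ContDiff ℝ ∞ φ) (hO : IsOpen O) (hp : p ∈ hypersurface φ ∩ O)
    {f : Amb m → ℝ} (hf : Sm φ O f) (α : Fin m) :
    (starRingEnd ℂ) (Z φ α (fun q => (f q : ℂ)) p) = Zbar φ α (fun q => (f q : ℂ)) p := by
  rw [← Zbar_conj hφ hO hp hf.ofReal]
  simp

theorem conj_Zbar_ofReal (hφ : ContDiff ℝ ∞ φ) (hO : IsOpen O) (hp : p ∈ hypersurface φ ∩ O)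
    {f : Amb m → ℝ} (hf : Sm φ O f) (α : Fin m) :
    (starRingEnd ℂ) (Zbar φ α (fun q => (f q : ℂ)) p) = Z φ α (fun q => (f q : ℂ)) p := by
  rw [← conj_Z_ofReal hφ hO hp hf, Complex.conj_conj]

/-! ### Commutators -/

/-- Derivatives along constant vectors commute. -/
theorem tderiv_comm (hφ : ContDiff ℝ ∞ φ) (hO : IsOpen O) (hp : p ∈ hypersurface φ ∩ O)
    {f : Amb m → V} (hf : Sm φ O f) (v w : Amb m) :
    tderiv φ (fun q => tderiv φ f q v) p w = tderiv φ (fun q => tderiv φ f q w) p v := by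
  -- Removing the inner retraction turns the iterated derivative into a true second Fréchet
  -- derivative, to which symmetry applies.
  have hinv : ∀ x : Amb m, (fun q => tderiv φ f q x) ∘ retract φ
      = fun q => fderiv ℝ (f ∘ retract φ) q x := by
    intro x; funext q; exact tderiv_retract f q x
  have hc := hf.contDiffAt hφ hO hp
  have hd : DifferentiableAt ℝ (fderiv ℝ (f ∘ retract φ)) p :=
    (hc.fderiv_right (m := 1) (by norm_cast)).differentiableAt (by simp)
  have hx : ∀ x y : Amb m, tderiv φ (fun q => tderiv φ f q x) p y
      = fderiv ℝ (fderiv ℝ (f ∘ retract φ)) p y x := by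
    intro x y
    rw [tderiv, hinv, fderiv_clm_apply hd (differentiableAt_const x)]
    simp
  rw [hx, hx]
  exact (hc.isSymmSndFDerivAt (by simp; norm_cast)).eq w v

/-- The vertical direction `(0, I)` contributes nothing since `f ∘ retract φ` is constant along it;
the real part of the last component is a multiple of T = 2 ∂/∂t. -/
theorem tderiv_frame (f : Amb m → ℂ) (hf : Sm φ O f) (hφ : ContDiff ℝ ∞ φ) (hO : IsOpen O)
    (hp : p ∈ hypersurface φ ∩ O) (v : Amb m) :
    tderiv φ f p v = tderiv φ f p (v.1, 0) + (v.2.re / 2 : ℝ) * reebD φ f p := by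
  have hd := hf.differentiableAt hφ hO hp
  have him : tderiv φ f p (0, Complex.I) = 0 := by
    have h1 : HasDerivAt (fun t : ℝ => (f ∘ retract φ) (p + t • ((0, Complex.I) : Amb m)))
        (fderiv ℝ (f ∘ retract φ) p (0, Complex.I)) 0 := by
      have h2 : HasDerivAt (fun t : ℝ => p + t • ((0, Complex.I) : Amb m)) (0, Complex.I) 0 := by
        simpa using ((hasDerivAt_id (0 : ℝ)).smul_const ((0, Complex.I) : Amb m)).const_add p
      have h3 : HasFDerivAt (f ∘ retract φ) (fderiv ℝ (f ∘ retract φ) p)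
          (p + (0 : ℝ) • ((0, Complex.I) : Amb m)) := by simpa using hd.hasFDerivAt
      exact HasFDerivAt.comp_hasDerivAt (l := f ∘ retract φ) 0 h3 h2
    have h4 : (fun t : ℝ => (f ∘ retract φ) (p + t • ((0, Complex.I) : Amb m)))
        = fun _ => f (retract φ p) := by
      funext t
      simp [retract]
    rw [h4] at h1
    exact h1.unique (hasDerivAt_const _ _)
  have hv : v = (v.1, 0) + (v.2.re / 2) • reeb m + v.2.im • ((0, Complex.I) : Amb m) := by
    refine Prod.ext (by simp [reeb]) ?_
    apply Complex.ext <;> simp [reeb]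
  conv_lhs => rw [hv]
  unfold tderiv at him ⊢
  rw [map_add, map_add, map_smul, map_smul, him]
  simp [reebD, tderiv]

/-- The derivative `∂/∂z_α` in the coordinates `(z, t)` of `M`. -/
def dz (φ : (Fin m → ℂ) → ℝ) (α : Fin m) (f : Amb m → ℂ) (p : Amb m) : ℂ :=
  (1 / 2) * (tderiv φ f p (Pi.single α 1, 0)
    - Complex.I * tderiv φ f p (Pi.single α Complex.I, 0))

/-- The derivative `∂/∂z̄_α` in the coordinates `(z, t)` of `M`. -/
def dzbar (φ : (Fin m → ℂ) → ℝ) (α : Fin m) (f : Amb m → ℂ) (p : Amb m) : ℂ :=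
  (1 / 2) * (tderiv φ f p (Pi.single α 1, 0)
    + Complex.I * tderiv φ f p (Pi.single α Complex.I, 0))

theorem isDer_dz (hφ : ContDiff ℝ ∞ φ) (hO : IsOpen O) (hp : p ∈ hypersurface φ ∩ O)
    (α : Fin m) : IsDer φ O p (fun f => dz φ α f p) := by
  have h := (isDer_tderiv hφ hO hp (Pi.single α 1, 0)).lincomb
    (isDer_tderiv hφ hO hp (Pi.single α Complex.I, 0)) (1 / 2) (-(1 / 2) * Complex.I)
  convert h using 2 with f
  simp only [dz]; ring

theorem Sm.dz (hφ : ContDiff ℝ ∞ φ) (hO : IsOpen O) {f : Amb m → ℂ} (hf : Sm φ O f) (α : Fin m) :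
    Sm φ O (dz φ α f) :=
  ((hf.tderiv hφ hO contDiff_const).sub
    ((hf.tderiv hφ hO contDiff_const).const_mul Complex.I)).const_mul (1 / 2)

theorem Sm.dzbar (hφ : ContDiff ℝ ∞ φ) (hO : IsOpen O) {f : Amb m → ℂ} (hf : Sm φ O f)
    (α : Fin m) : Sm φ O (dzbar φ α f) :=
  ((hf.tderiv hφ hO contDiff_const).add
    ((hf.tderiv hφ hO contDiff_const).const_mul Complex.I)).const_mul (1 / 2)

/-- On functions of (z, t) the operator ∂/∂w acts as ½ ∂/∂t = ¼ T, so 2iφ_α ∂/∂w becomes (i/2) φ_α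
T. All commutators reduce to those of constant-coefficient fields. -/
theorem Z_eq_dz (hφ : ContDiff ℝ ∞ φ) (hO : IsOpen O) (hp : p ∈ hypersurface φ ∩ O)
    {f : Amb m → ℂ} (hf : Sm φ O f) (α : Fin m) :
    Z φ α f p = dz φ α f p + Complex.I / 2 * (wirt φ α p.1 * reebD φ f p) := by
  have e : (Complex.I • frame φ α p).1 = Pi.single α Complex.I := by
    funext i; by_cases h : i = α
    · subst h; simp [frame]
    · simp [frame, h]
  simp only [Z, dz]
  rw [tderiv_frame f hf hφ hO hp (frame φ α p),
    tderiv_frame f hf hφ hO hp (Complex.I • frame φ α p), e]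
  have e1 : ((frame φ α p).2.re / 2 : ℝ) = -(wirt φ α p.1).im := by simp [frame]; ring
  have e2 : ((Complex.I • frame φ α p).2.re / 2 : ℝ) = -(wirt φ α p.1).re := by simp [frame]; ring
  have e3 : (frame φ α p).1 = Pi.single α 1 := rfl
  have e4 : wirt φ α p.1 = (wirt φ α p.1).re + (wirt φ α p.1).im * Complex.I :=
    (Complex.re_add_im _).symm
  rw [e1, e2, e3]
  generalize (wirt φ α p.1) = x at *
  rw [e4]
  push_cast
  simp only [Complex.add_re, Complex.ofReal_re, Complex.mul_re, Complex.add_im, Complex.mul_im,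
    Complex.ofReal_im, Complex.I_re, Complex.I_im]
  ring_nf
  simp only [Complex.I_sq]
  ring_nf

theorem dzbar_conj (hφ : ContDiff ℝ ∞ φ) (hO : IsOpen O) (hp : p ∈ hypersurface φ ∩ O)
    {f : Amb m → ℂ} (hf : Sm φ O f) (α : Fin m) :
    dzbar φ α (fun q => (starRingEnd ℂ) (f q)) p = (starRingEnd ℂ) (dz φ α f p) := by
  simp only [dz, dzbar, tderiv_conj hφ hO hp hf, map_mul, map_sub, Complex.conj_I,
    map_div₀, map_one, map_ofNat]
  ring

theorem dz_conj (hφ : ContDiff ℝ ∞ φ) (hO : IsOpen O) (hp : p ∈ hypersurface φ ∩ O)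
    {f : Amb m → ℂ} (hf : Sm φ O f) (α : Fin m) :
    dz φ α (fun q => (starRingEnd ℂ) (f q)) p = (starRingEnd ℂ) (dzbar φ α f p) := by
  have h := dzbar_conj hφ hO hp hf.conj α
  simp only [Complex.conj_conj] at h
  rw [h, Complex.conj_conj]

theorem Zbar_eq_dzbar (hφ : ContDiff ℝ ∞ φ) (hO : IsOpen O) (hp : p ∈ hypersurface φ ∩ O)
    {f : Amb m → ℂ} (hf : Sm φ O f) (α : Fin m) :
    Zbar φ α f p = dzbar φ α f p
      - Complex.I / 2 * ((starRingEnd ℂ) (wirt φ α p.1) * reebD φ f p) := by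
  have h := congrArg (starRingEnd ℂ) (Z_eq_dz hφ hO hp hf.conj α)
  rw [← Zbar_conj hφ hO hp hf.conj, map_add, ← dzbar_conj hφ hO hp hf.conj, map_mul, map_mul,
    reebD_conj hφ hO hp hf] at h
  simp only [Complex.conj_conj, map_div₀, Complex.conj_I, map_ofNat] at h
  rw [h]; ring

theorem dz_comm_reebD (hφ : ContDiff ℝ ∞ φ) (hO : IsOpen O) (hp : p ∈ hypersurface φ ∩ O)
    {f : Amb m → ℂ} (hf : Sm φ O f) (α : Fin m) :
    dz φ α (reebD φ f) p = reebD φ (dz φ α f) p := by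
  have hs : ∀ v, Sm φ O (fun q => tderiv φ f q v) := fun v => hf.tderiv hφ hO contDiff_const
  have hD := isDer_reebD hφ hO hp
  have : reebD φ (dz φ α f) p = _ := hD.const_mul (1 / 2) ((hs _).sub ((hs _).const_mul _))
  rw [this, hD.sub (hs _) ((hs _).const_mul _), hD.const_mul _ (hs _)]
  simp only [dz, reebD]
  unfold reebD
  rw [tderiv_comm hφ hO hp hf, tderiv_comm hφ hO hp hf (reeb m) (Pi.single α Complex.I, 0)]

theorem dzbar_comm_reebD (hφ : ContDiff ℝ ∞ φ) (hO : IsOpen O) (hp : p ∈ hypersurface φ ∩ O)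
    {f : Amb m → ℂ} (hf : Sm φ O f) (α : Fin m) :
    dzbar φ α (reebD φ f) p = reebD φ (dzbar φ α f) p := by
  have hs : ∀ v, Sm φ O (fun q => tderiv φ f q v) := fun v => hf.tderiv hφ hO contDiff_const
  have hD := isDer_reebD hφ hO hp
  have : reebD φ (dzbar φ α f) p = _ := hD.const_mul (1 / 2) ((hs _).add ((hs _).const_mul _))
  rw [this, hD.add (hs _) ((hs _).const_mul _), hD.const_mul _ (hs _)]
  simp only [dzbar, reebD]
  unfold reebD
  rw [tderiv_comm hφ hO hp hf, tderiv_comm hφ hO hp hf (reeb m) (Pi.single α Complex.I, 0)]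

theorem dz_comm_dzbar (hφ : ContDiff ℝ ∞ φ) (hO : IsOpen O) (hp : p ∈ hypersurface φ ∩ O)
    {f : Amb m → ℂ} (hf : Sm φ O f) (α β : Fin m) :
    dz φ α (dzbar φ β f) p = dzbar φ β (dz φ α f) p := by
  have hs : ∀ v, Sm φ O (fun q => tderiv φ f q v) := fun v => hf.tderiv hφ hO contDiff_const
  have hv : ∀ v : Amb m, tderiv φ (dzbar φ β f) p v = (1 / 2) *
      (tderiv φ (fun q => tderiv φ f q (Pi.single β 1, 0)) p v
        + Complex.I * tderiv φ (fun q => tderiv φ f q (Pi.single β Complex.I, 0)) p v) := by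
    intro v
    have hD := isDer_tderiv hφ hO hp v
    have : tderiv φ (dzbar φ β f) p v = _ :=
      hD.const_mul (1 / 2) ((hs _).add ((hs _).const_mul _))
    rw [this, hD.add (hs _) ((hs _).const_mul _), hD.const_mul _ (hs _)]
  have hw : ∀ v : Amb m, tderiv φ (dz φ α f) p v = (1 / 2) *
      (tderiv φ (fun q => tderiv φ f q (Pi.single α 1, 0)) p v
        - Complex.I * tderiv φ (fun q => tderiv φ f q (Pi.single α Complex.I, 0)) p v) := by
    intro v
    have hD := isDer_tderiv hφ hO hp v
    have : tderiv φ (dz φ α f) p v = _ :=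
      hD.const_mul (1 / 2) ((hs _).sub ((hs _).const_mul _))
    rw [this, hD.sub (hs _) ((hs _).const_mul _), hD.const_mul _ (hs _)]
  rw [dz, dzbar, hv, hv, hw, hw]
  rw [tderiv_comm hφ hO hp hf (Pi.single β 1, 0) (Pi.single α 1, 0),
    tderiv_comm hφ hO hp hf (Pi.single β 1, 0) (Pi.single α Complex.I, 0),
    tderiv_comm hφ hO hp hf (Pi.single β Complex.I, 0) (Pi.single α 1, 0),
    tderiv_comm hφ hO hp hf (Pi.single β Complex.I, 0) (Pi.single α Complex.I, 0)]
  ring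

end Calculus

/-! ### Symmetry of the Levi matrix and commutators of the frame with the Reeb field -/

section Commutators

variable {m : ℕ} {φ : (Fin m → ℂ) → ℝ} {O : Set (Amb m)} {p : Amb m}

theorem tderiv_comp_fst {V : Type*} [NormedAddCommGroup V] [NormedSpace ℝ V]
    {f : (Fin m → ℂ) → V} (hf : DifferentiableAt ℝ f p.1) (v : Amb m) :
    tderiv φ (fun q => f q.1) p v = fderiv ℝ f p.1 v.1 := by
  have h := (hf.hasFDerivAt.comp p (hasFDerivAt_fst (𝕜 := ℝ) (p := p))).fderiv
  exact congrArg (fun L => L v) h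

theorem reebD_comp_fst {f : (Fin m → ℂ) → ℂ} (hf : DifferentiableAt ℝ f p.1) :
    reebD φ (fun q => f q.1) p = 0 := by
  rw [reebD, tderiv_comp_fst hf]
  simp [reeb]

theorem Sm.wirt (hφ : ContDiff ℝ ∞ φ) (α : Fin m) : Sm φ O (fun q => wirt φ α q.1) :=
  Sm.of_contDiff hφ ((contDiff_wirt hφ α).comp contDiff_fst)

theorem dz_ofReal_defining (hφ : ContDiff ℝ ∞ φ) (α : Fin m) (q : Amb m) :
    dz φ α (fun q => (φ q.1 : ℂ)) q = wirt φ α q.1 := by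
  have hd : DifferentiableAt ℝ φ q.1 := hφ.differentiable (by simp) q.1
  have h := Complex.ofRealCLM.hasFDerivAt.comp q.1 hd.hasFDerivAt
  have h1 : ∀ v : Amb m, tderiv φ (fun q => (φ q.1 : ℂ)) q v = (fderiv ℝ φ q.1 v.1 : ℂ) := by
    intro v
    have h2 : DifferentiableAt ℝ (fun z => (φ z : ℂ)) q.1 := h.differentiableAt
    rw [tderiv_comp_fst (f := fun z => (φ z : ℂ)) h2]
    exact congrArg (fun L => L v.1) h.fderiv
  simp only [dz, h1, CRGeom.wirt]

/-- h_{αβ̄} is a mixed second derivative of the real function φ, and ∂/∂z and ∂/∂z̄ commute. -/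
theorem conj_levi (hφ : ContDiff ℝ ∞ φ) (hp : p ∈ hypersurface φ) (α β : Fin m) :
    (starRingEnd ℂ) (levi φ p α β) = levi φ p β α := by
  have hp' : p ∈ hypersurface φ ∩ Set.univ := ⟨hp, trivial⟩
  have hw : ∀ γ, DifferentiableAt ℝ (wirt φ γ) p.1 := fun γ =>
    (contDiff_wirt hφ γ).differentiable (by simp) p.1
  have hΦ : Sm φ Set.univ (fun q : Amb m => φ q.1) :=
    Sm.of_contDiff hφ (hφ.comp contDiff_fst)
  have h1 : ∀ γ δ, levi φ p γ δ = dzbar φ δ (dz φ γ (fun q => (φ q.1 : ℂ))) p := by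
    intro γ δ
    simp only [levi, Matrix.of_apply]
    rw [Zbar_eq_dzbar hφ isOpen_univ hp' (Sm.wirt hφ γ), reebD_comp_fst (hw γ)]
    simp only [mul_zero, sub_zero]
    congr 1
    funext q
    rw [dz_ofReal_defining hφ]
  have h2 : Set.EqOn (fun q => (starRingEnd ℂ) (dz φ α (fun q => (φ q.1 : ℂ)) q))
      (dzbar φ α (fun q => (φ q.1 : ℂ))) (hypersurface φ ∩ Set.univ) := by
    intro q hq
    simp only
    rw [← dzbar_conj hφ isOpen_univ hq hΦ.ofReal]
    simp
  rw [h1, h1, ← dz_conj hφ isOpen_univ hp' (hΦ.ofReal.dz hφ isOpen_univ α),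
    (isDer_dz hφ isOpen_univ hp' β).congr h2, dz_comm_dzbar hφ isOpen_univ hp' hΦ.ofReal]

theorem Zbar_wirt (φ : (Fin m → ℂ) → ℝ) (p : Amb m) (α β : Fin m) :
    Zbar φ β (fun q => wirt φ α q.1) p = levi φ p α β := rfl

theorem Z_conj_wirt (hφ : ContDiff ℝ ∞ φ) (hp : p ∈ hypersurface φ) (α β : Fin m) :
    Z φ α (fun q => (starRingEnd ℂ) (wirt φ β q.1)) p = levi φ p α β := by
  rw [Z_conj (O := Set.univ) hφ isOpen_univ ⟨hp, trivial⟩ (Sm.wirt hφ β), Zbar_wirt,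
    conj_levi hφ hp]

theorem reebD_wirt (hφ : ContDiff ℝ ∞ φ) (α : Fin m) (p : Amb m) :
    reebD φ (fun q => wirt φ α q.1) p = 0 :=
  reebD_comp_fst ((contDiff_wirt hφ α).differentiable (by simp) p.1)

theorem reebD_conj_wirt (hφ : ContDiff ℝ ∞ φ) (hp : p ∈ hypersurface φ) (α : Fin m) :
    reebD φ (fun q => (starRingEnd ℂ) (wirt φ α q.1)) p = 0 := by
  rw [reebD_conj (O := Set.univ) hφ isOpen_univ ⟨hp, trivial⟩ (Sm.wirt hφ α), reebD_wirt hφ,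
    map_zero]

theorem Sm.levi (hφ : ContDiff ℝ ∞ φ) (hO : IsOpen O) (α β : Fin m) :
    Sm φ O (fun q => levi φ q α β) := (Sm.wirt hφ α).Zbar hφ hO β

/-- The coefficients φ_α do not depend on t. This is where rigidity enters: T is an infinitesimal CR
symmetry, so no torsion terms appear later. -/
theorem reebD_Z (hφ : ContDiff ℝ ∞ φ) (hO : IsOpen O) (hp : p ∈ hypersurface φ ∩ O)
    {f : Amb m → ℂ} (hf : Sm φ O f) (α : Fin m) :
    reebD φ (Z φ α f) p = Z φ α (reebD φ f) p := by
  have hT := isDer_reebD hφ hO hp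
  have h1 : reebD φ (Z φ α f) p = _ := hT.congr fun q hq => Z_eq_dz hφ hO hq hf α
  have hw := (Sm.wirt (O := O) hφ α).mul (hf.reebD hφ hO)
  rw [h1, Z_eq_dz hφ hO hp (hf.reebD hφ hO), hT.add (hf.dz hφ hO α) (hw.const_mul _),
    hT.const_mul _ hw, hT.mul (Sm.wirt hφ α) (hf.reebD hφ hO), reebD_wirt hφ,
    dz_comm_reebD hφ hO hp hf]
  ring

theorem reebD_Zbar (hφ : ContDiff ℝ ∞ φ) (hO : IsOpen O) (hp : p ∈ hypersurface φ ∩ O)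
    {f : Amb m → ℂ} (hf : Sm φ O f) (α : Fin m) :
    reebD φ (Zbar φ α f) p = Zbar φ α (reebD φ f) p := by
  have hT := isDer_reebD hφ hO hp
  have h1 : reebD φ (Zbar φ α f) p = _ := hT.congr fun q hq => Zbar_eq_dzbar hφ hO hq hf α
  have hw := (Sm.wirt (O := O) hφ α).conj.mul (hf.reebD hφ hO)
  rw [h1, Zbar_eq_dzbar hφ hO hp (hf.reebD hφ hO), hT.sub (hf.dzbar hφ hO α) (hw.const_mul _),
    hT.const_mul _ hw, hT.mul (Sm.wirt hφ α).conj (hf.reebD hφ hO), reebD_conj_wirt hφ hp.1,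
    dzbar_comm_reebD hφ hO hp hf]
  ring

/-- The second-order terms cancel. The coefficients (i/2)φ_α of Z_α and -(i/2)φ̄_β of Z_β̄ are
differentiated once each, and each contributes (i/2) h_{αβ̄} T. -/
theorem Zbar_Z (hφ : ContDiff ℝ ∞ φ) (hO : IsOpen O) (hp : p ∈ hypersurface φ ∩ O)
    {f : Amb m → ℂ} (hf : Sm φ O f) (α β : Fin m) :
    Zbar φ β (Z φ α f) p
      = Z φ α (Zbar φ β f) p + Complex.I * (levi φ p α β * reebD φ f p) := by
  have hB := isDer_Zbar hφ hO hp β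
  have hA := isDer_Z hφ hO hp α
  have hTf := hf.reebD hφ hO
  have hw := Sm.wirt (O := O) hφ α
  have hw' := (Sm.wirt (O := O) hφ β).conj
  have h1 : Zbar φ β (Z φ α f) p = _ := hB.congr fun q hq => Z_eq_dz hφ hO hq hf α
  have h2 : Z φ α (Zbar φ β f) p = _ := hA.congr fun q hq => Zbar_eq_dzbar hφ hO hq hf β
  rw [h1, h2, hB.add (hf.dz hφ hO α) ((hw.mul hTf).const_mul _), hB.const_mul _ (hw.mul hTf),
    hB.mul hw hTf, hA.sub (hf.dzbar hφ hO β) ((hw'.mul hTf).const_mul _),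
    hA.const_mul _ (hw'.mul hTf), hA.mul hw' hTf, Zbar_wirt, Z_conj_wirt hφ hp.1,
    Zbar_eq_dzbar hφ hO hp (hf.dz hφ hO α), Zbar_eq_dzbar hφ hO hp hTf,
    Z_eq_dz hφ hO hp (hf.dzbar hφ hO β), Z_eq_dz hφ hO hp hTf,
    dz_comm_dzbar hφ hO hp hf, dz_comm_reebD hφ hO hp hf, dzbar_comm_reebD hφ hO hp hf]
  ring

end Commutators

/-! ### Tangent and contact vectors in coordinates -/

section Contact

variable {m : ℕ} {φ : (Fin m → ℂ) → ℝ} {p v : Amb m}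

theorem fderiv_eq_wirt (φ : (Fin m → ℂ) → ℝ) (z v : Fin m → ℂ) :
    fderiv ℝ φ z v = 2 * (∑ a, wirt φ a z * v a).re := by
  have hv : v = ∑ a, ((v a).re • (Pi.single a 1 : Fin m → ℂ)
      + (v a).im • (Pi.single a Complex.I : Fin m → ℂ)) := by
    funext i
    rw [Finset.sum_apply, Finset.sum_eq_single i]
    · simp
    · intro b _ hb
      simp [Ne.symm hb]
    · simp
  conv_lhs => rw [hv]
  rw [map_sum, Complex.re_sum, Finset.mul_sum]
  refine Finset.sum_congr rfl fun a _ => ?_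
  rw [map_add, map_smul, map_smul]
  simp only [wirt, smul_eq_mul, Complex.mul_re, Complex.mul_im, Complex.sub_re, Complex.sub_im,
    Complex.ofReal_re, Complex.ofReal_im, Complex.I_re, Complex.I_im]
  norm_num
  ring

theorem fderiv_defFun (hφ : ContDiff ℝ ∞ φ) (p v : Amb m) :
    fderiv ℝ (defFun φ) p v = v.2.im - 2 * (∑ a, wirt φ a p.1 * v.1 a).re := by
  have hd : DifferentiableAt ℝ φ p.1 := hφ.differentiable (by simp) p.1
  have h1 := hd.hasFDerivAt.comp p (hasFDerivAt_fst (𝕜 := ℝ) (p := p))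
  have h2 := (Complex.imCLM.hasFDerivAt (x := p.2)).comp p (hasFDerivAt_snd (𝕜 := ℝ) (p := p))
  have h3 := congrArg (fun L => L v) (h2.sub h1).fderiv
  have h4 : fderiv ℝ (defFun φ) p v = _ := h3
  rw [h4, ← fderiv_eq_wirt]
  rfl

theorem mem_tangent_iff (hφ : ContDiff ℝ ∞ φ) :
    v ∈ tangent φ p ↔ v.2.im = 2 * (∑ a, wirt φ a p.1 * v.1 a).re := by
  rw [tangent, LinearMap.mem_ker]
  change fderiv ℝ (defFun φ) p v = 0 ↔ _
  rw [fderiv_defFun hφ, sub_eq_zero]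

theorem sum_wirt_I_smul (p v : Amb m) :
    ∑ a, wirt φ a p.1 * (Complex.I • v).1 a = Complex.I * ∑ a, wirt φ a p.1 * v.1 a := by
  rw [Finset.mul_sum]
  refine Finset.sum_congr rfl fun a _ => ?_
  simp only [Prod.smul_fst, Pi.smul_apply, smul_eq_mul]
  ring

theorem mem_contact_iff (hφ : ContDiff ℝ ∞ φ) :
    v ∈ contact φ p ↔ v.2 = 2 * Complex.I * ∑ a, wirt φ a p.1 * v.1 a := by
  change v ∈ tangent φ p ∧ Complex.I • v ∈ tangent φ p ↔ _
  rw [mem_tangent_iff hφ, mem_tangent_iff hφ, sum_wirt_I_smul, Complex.ext_iff]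
  simp [and_comm]

theorem theta_eq (hφ : ContDiff ℝ ∞ φ) (p v : Amb m) :
    theta φ p v = (1 / 2) * (v.2 - 2 * Complex.I * ∑ a, wirt φ a p.1 * v.1 a).re := by
  rw [theta, fderiv_defFun hφ, sum_wirt_I_smul]
  simp

theorem ofReal_theta (hφ : ContDiff ℝ ∞ φ) (hv : v ∈ tangent φ p) :
    (theta φ p v : ℂ) = (1 / 2) * (v.2 - 2 * Complex.I * ∑ a, wirt φ a p.1 * v.1 a) := by
  rw [mem_tangent_iff hφ] at hv
  rw [theta_eq hφ]
  apply Complex.ext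
  · simp
  · simp [hv]

theorem fst_frame_apply (a i : Fin m) : (frame φ a p).1 i = if i = a then 1 else 0 := by
  simp [frame, Pi.single_apply]

/-- The splitting of T_pM into the Reeb line and the contact space; complex multiples of the frame
encode the action of J. -/
theorem tangent_eq_sum (hφ : ContDiff ℝ ∞ φ) (hv : v ∈ tangent φ p) :
    v = theta φ p v • reeb m + ∑ a, v.1 a • frame φ a p := by
  refine Prod.ext ?_ ?_
  · funext i
    simp [reeb, Prod.fst_sum, fst_frame_apply]
  · simp only [Prod.snd_add, Prod.snd_sum, Prod.smul_snd, reeb, frame, Complex.real_smul,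
      ofReal_theta hφ hv, smul_eq_mul, Finset.mul_sum]
    rw [mul_sub, Finset.mul_sum]
    have : ∀ a, v.1 a * (2 * Complex.I * wirt φ a p.1)
        = 1 / 2 * (2 * Complex.I * (wirt φ a p.1 * v.1 a)) * 2 := fun a => by ring
    simp only [this, ← Finset.sum_mul]
    ring

theorem theta_contact (hφ : ContDiff ℝ ∞ φ) (hv : v ∈ contact φ p) : theta φ p v = 0 := by
  rw [theta_eq hφ, ← (mem_contact_iff hφ).1 hv]
  simp

theorem mem_contact_of_theta (hφ : ContDiff ℝ ∞ φ) (hv : v ∈ tangent φ p)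
    (h : theta φ p v = 0) : v ∈ contact φ p := by
  have h1 := ofReal_theta hφ hv
  rw [h] at h1
  rw [mem_contact_iff hφ]
  simp only [Complex.ofReal_zero] at h1
  linear_combination -2 * h1

theorem frame_mem_contact (hφ : ContDiff ℝ ∞ φ) (a : Fin m) (p : Amb m) :
    frame φ a p ∈ contact φ p := by
  rw [mem_contact_iff hφ]
  simp only [fst_frame_apply, mul_ite, mul_one, mul_zero, Finset.sum_ite_eq', Finset.mem_univ,
    if_true]
  rfl

theorem reeb_mem_tangent (hφ : ContDiff ℝ ∞ φ) (p : Amb m) : reeb m ∈ tangent φ p := by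
  rw [mem_tangent_iff hφ]
  simp [reeb]

theorem theta_reeb (hφ : ContDiff ℝ ∞ φ) (p : Amb m) : theta φ p (reeb m) = 1 := by
  rw [theta_eq hφ]
  simp [reeb]

variable {V : Type*} [NormedAddCommGroup V] [NormedSpace ℝ V]

theorem tderiv_add (f : Amb m → V) (p v w : Amb m) :
    tderiv φ f p (v + w) = tderiv φ f p v + tderiv φ f p w := map_add _ _ _

theorem tderiv_smul (f : Amb m → V) (p v : Amb m) (c : ℝ) :
    tderiv φ f p (c • v) = c • tderiv φ f p v := map_smul _ _ _

theorem tderiv_sum {ι : Type*} (s : Finset ι) (f : Amb m → V) (p : Amb m) (v : ι → Amb m) :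
    tderiv φ f p (∑ i ∈ s, v i) = ∑ i ∈ s, tderiv φ f p (v i) := map_sum _ _ _

theorem complex_smul_eq (c : ℂ) (v : Amb m) : c • v = c.re • v + c.im • (Complex.I • v) := by
  conv_lhs => rw [← Complex.re_add_im c]
  rw [add_smul, mul_smul, Complex.coe_smul, Complex.coe_smul]

theorem tderiv_smul_frame (f : Amb m → ℂ) (p : Amb m) (a : Fin m) (c : ℂ) :
    tderiv φ f p (c • frame φ a p) = c * Z φ a f p + (starRingEnd ℂ) c * Zbar φ a f p := by
  rw [complex_smul_eq, tderiv_add, tderiv_smul, tderiv_smul, Z, Zbar]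
  conv_rhs => rw [← Complex.re_add_im c]
  simp only [map_add, map_mul, Complex.conj_ofReal, Complex.conj_I, Complex.real_smul]
  ring_nf
  simp only [Complex.I_sq]
  ring

/-- The derivative of a function along a tangent vector in terms of the frame. -/
theorem tderiv_tangent (hφ : ContDiff ℝ ∞ φ) (f : Amb m → ℂ) (hv : v ∈ tangent φ p) :
    tderiv φ f p v = theta φ p v * reebD φ f p
      + ∑ a, (v.1 a * Z φ a f p + (starRingEnd ℂ) (v.1 a) * Zbar φ a f p) := by
  conv_lhs => rw [tangent_eq_sum hφ hv]
  rw [tderiv_add, tderiv_smul, tderiv_sum]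
  simp only [tderiv_smul_frame, reebD, Complex.real_smul]

end Contact

/-! ### Sesquilinear algebra of the Levi form -/

section LeviPair

variable {k : ℕ} {ψ : (Fin k → ℂ) → ℝ} {q : Amb k}

/-- The Levi form on the components of (1,0)-vectors. -/
def leviPair (ψ : (Fin k → ℂ) → ℝ) (q : Amb k) (X Y : Fin k → ℂ) : ℂ :=
  ∑ i, ∑ j, levi ψ q i j * X i * (starRingEnd ℂ) (Y j)

theorem conj_leviPair (hψ : ContDiff ℝ ∞ ψ) (hq : q ∈ hypersurface ψ) (X Y : Fin k → ℂ) :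
    (starRingEnd ℂ) (leviPair ψ q X Y) = leviPair ψ q Y X := by
  simp only [leviPair, map_sum, map_mul, Complex.conj_conj, conj_levi hψ hq]
  rw [Finset.sum_comm]
  exact Finset.sum_congr rfl fun i _ => Finset.sum_congr rfl fun j _ => by ring

theorem leviPair_add_left (X X' Y : Fin k → ℂ) :
    leviPair ψ q (fun i => X i + X' i) Y = leviPair ψ q X Y + leviPair ψ q X' Y := by
  simp only [leviPair, ← Finset.sum_add_distrib]
  exact Finset.sum_congr rfl fun i _ => Finset.sum_congr rfl fun j _ => by ring

theorem leviPair_sub_left (X X' Y : Fin k → ℂ) :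
    leviPair ψ q (fun i => X i - X' i) Y = leviPair ψ q X Y - leviPair ψ q X' Y := by
  simp only [leviPair, ← Finset.sum_sub_distrib]
  exact Finset.sum_congr rfl fun i _ => Finset.sum_congr rfl fun j _ => by ring

theorem leviPair_mul_left (c : ℂ) (X Y : Fin k → ℂ) :
    leviPair ψ q (fun i => c * X i) Y = c * leviPair ψ q X Y := by
  simp only [leviPair, Finset.mul_sum]
  exact Finset.sum_congr rfl fun i _ => Finset.sum_congr rfl fun j _ => by ring

theorem leviPair_sum_left {ι : Type*} [Fintype ι] (c : ι → ℂ) (X : ι → Fin k → ℂ)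
    (Y : Fin k → ℂ) :
    leviPair ψ q (fun i => ∑ a, c a * X a i) Y = ∑ a, c a * leviPair ψ q (X a) Y := by
  simp only [leviPair, Finset.mul_sum, Finset.sum_mul]
  calc _ = ∑ i, ∑ a, ∑ j, levi ψ q i j * (c a * X a i) * (starRingEnd ℂ) (Y j) :=
        Finset.sum_congr rfl fun i _ => Finset.sum_comm
    _ = _ := by
        rw [Finset.sum_comm]
        exact Finset.sum_congr rfl fun a _ => Finset.sum_congr rfl fun i _ =>
          Finset.sum_congr rfl fun j _ => by ring

theorem leviPair_add_right (X Y Y' : Fin k → ℂ) :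
    leviPair ψ q X (fun i => Y i + Y' i) = leviPair ψ q X Y + leviPair ψ q X Y' := by
  simp only [leviPair, ← Finset.sum_add_distrib, map_add]
  exact Finset.sum_congr rfl fun i _ => Finset.sum_congr rfl fun j _ => by ring

theorem leviPair_mul_right (c : ℂ) (X Y : Fin k → ℂ) :
    leviPair ψ q X (fun i => c * Y i) = (starRingEnd ℂ) c * leviPair ψ q X Y := by
  simp only [leviPair, Finset.mul_sum, map_mul]
  exact Finset.sum_congr rfl fun i _ => Finset.sum_congr rfl fun j _ => by ring

theorem leviPair_sum_right {ι : Type*} [Fintype ι] (c : ι → ℂ) (X : Fin k → ℂ)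
    (Y : ι → Fin k → ℂ) :
    leviPair ψ q X (fun i => ∑ a, c a * Y a i)
      = ∑ a, (starRingEnd ℂ) (c a) * leviPair ψ q X (Y a) := by
  simp only [leviPair, Finset.mul_sum, map_sum, map_mul]
  calc _ = ∑ i, ∑ a, ∑ j, levi ψ q i j * X i
            * ((starRingEnd ℂ) (c a) * (starRingEnd ℂ) (Y a j)) :=
        Finset.sum_congr rfl fun i _ => Finset.sum_comm
    _ = _ := by
        rw [Finset.sum_comm]
        exact Finset.sum_congr rfl fun a _ => Finset.sum_congr rfl fun i _ =>
          Finset.sum_congr rfl fun j _ => by ring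

end LeviPair

/-! ### Differentials of CR maps -/

section Maps

variable {m k : ℕ} {φ : (Fin m → ℂ) → ℝ} {ψ : (Fin k → ℂ) → ℝ} {O : Set (Amb m)}
  {O₂ : Set (Amb k)} {F : Amb m → Amb k} {p : Amb m}
  {V : Type*} [NormedAddCommGroup V] [NormedSpace ℝ V]

/-- The components `F_α^i = Z_α F^i` of the differential. -/
def jac (φ : (Fin m → ℂ) → ℝ) (F : Amb m → Amb k) (p : Amb m) (α : Fin m) (i : Fin k) : ℂ :=
  Z φ α (fun q => (F q).1 i) p

/-- The components `T F^i` of the differential. -/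
def reebJac (φ : (Fin m → ℂ) → ℝ) (F : Amb m → Amb k) (p : Amb m) (i : Fin k) : ℂ :=
  reebD φ (fun q => (F q).1 i) p

/-- A smooth CR map between smooth rigid hypersurfaces, on an open set. -/
structure SmoothCR (φ : (Fin m → ℂ) → ℝ) (ψ : (Fin k → ℂ) → ℝ) (O : Set (Amb m))
    (F : Amb m → Amb k) : Prop where
  source : ContDiff ℝ ∞ φ
  target : ContDiff ℝ ∞ ψ
  isOpen : IsOpen O
  map : IsCRMap φ ψ O F

namespace SmoothCR

theorem sm (h : SmoothCR φ ψ O F) : Sm φ O F := Sm.of_contDiffOn h.source h.map.smooth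

theorem sm_fst (h : SmoothCR φ ψ O F) (i : Fin k) : Sm φ O (fun q => (F q).1 i) :=
  Sm.comp_contDiff (g := fun x : Amb k => x.1 i)
    ((contDiff_apply ℝ ℂ i).comp contDiff_fst) h.sm

theorem sm_snd (h : SmoothCR φ ψ O F) : Sm φ O (fun q => (F q).2) :=
  Sm.comp_contDiff (g := fun x : Amb k => x.2) contDiff_snd h.sm

theorem sm_jac (h : SmoothCR φ ψ O F) (α : Fin m) (i : Fin k) :
    Sm φ O (fun q => jac φ F q α i) := (h.sm_fst i).Z h.source h.isOpen α

theorem sm_reebJac (h : SmoothCR φ ψ O F) (i : Fin k) :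
    Sm φ O (fun q => reebJac φ F q i) := (h.sm_fst i).reebD h.source h.isOpen

theorem differentiableAt (h : SmoothCR φ ψ O F) (hp : p ∈ hypersurface φ ∩ O) :
    DifferentiableAt ℝ (F ∘ retract φ) p := h.sm.differentiableAt h.source h.isOpen hp

theorem tderiv_fst (h : SmoothCR φ ψ O F) (hp : p ∈ hypersurface φ ∩ O) (i : Fin k)
    (v : Amb m) : tderiv φ (fun q => (F q).1 i) p v = (tderiv φ F p v).1 i := by
  let L : Amb k →L[ℝ] ℂ :=
    (ContinuousLinearMap.proj i).comp (ContinuousLinearMap.fst ℝ (Fin k → ℂ) ℂ)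
  have h1 := (L.hasFDerivAt.comp p (h.differentiableAt hp).hasFDerivAt).fderiv
  exact congrArg (fun A => A v) h1

theorem tderiv_snd (h : SmoothCR φ ψ O F) (hp : p ∈ hypersurface φ ∩ O)
    (v : Amb m) : tderiv φ (fun q => (F q).2) p v = (tderiv φ F p v).2 := by
  let L : Amb k →L[ℝ] ℂ := ContinuousLinearMap.snd ℝ (Fin k → ℂ) ℂ
  have h1 := (L.hasFDerivAt.comp p (h.differentiableAt hp).hasFDerivAt).fderiv
  exact congrArg (fun A => A v) h1

theorem mem_target (h : SmoothCR φ ψ O F) (hp : p ∈ hypersurface φ ∩ O) :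
    F p ∈ hypersurface ψ := h.map.mapsTo hp

theorem tderiv_mem_tangent (h : SmoothCR φ ψ O F) (hp : p ∈ hypersurface φ ∩ O) (v : Amb m) :
    tderiv φ F p v ∈ tangent ψ (F p) := by
  have hd : DifferentiableAt ℝ (defFun ψ) ((F ∘ retract φ) p) := by
    have : ContDiff ℝ ∞ (defFun ψ) :=
      (Complex.imCLM.contDiff.comp contDiff_snd).sub (h.target.comp contDiff_fst)
    exact this.differentiable (by simp) _
  have h1 := (hd.hasFDerivAt.comp p (h.differentiableAt hp).hasFDerivAt).fderiv
  have h2 : defFun ψ ∘ (F ∘ retract φ) =ᶠ[nhds p] fun _ => (0 : ℝ) := by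
    filter_upwards [(isOpen_retract_preimage h.source h.isOpen).mem_nhds
      (mem_retract_preimage hp)] with q hq
    exact h.map.mapsTo ⟨retract_mem φ q, hq⟩
  rw [h2.fderiv_eq] at h1
  have h3 := congrArg (fun A => A v) h1
  rw [tangent, LinearMap.mem_ker]
  simp only [Function.comp, retract_eq hp.1] at h3
  have h4 : fderiv ℝ (fun _ : Amb m => (0 : ℝ)) p v = 0 := by simp
  exact h3.symm.trans h4

theorem tderiv_mem_contact (h : SmoothCR φ ψ O F) (hp : p ∈ hypersurface φ ∩ O) {v : Amb m}
    (hv : v ∈ contact φ p) : tderiv φ F p v ∈ contact ψ (F p) := by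
  refine ⟨h.tderiv_mem_tangent hp v, ?_⟩
  rw [← h.map.cr p hp v hv]
  exact h.tderiv_mem_tangent hp _

/-- The chain rule. -/
theorem tderiv_comp (h : SmoothCR φ ψ O F) (hO₂ : IsOpen O₂)
    (hmap : Set.MapsTo F (hypersurface φ ∩ O) O₂) {g : Amb k → V} (hg : Sm ψ O₂ g)
    (hp : p ∈ hypersurface φ ∩ O) (v : Amb m) :
    tderiv φ (fun q => g (F q)) p v = tderiv ψ g (F p) (tderiv φ F p v) := by
  have hd : DifferentiableAt ℝ (g ∘ retract ψ) ((F ∘ retract φ) p) := by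
    simp only [Function.comp_apply, retract_eq hp.1]
    exact hg.differentiableAt h.target hO₂ ⟨h.mem_target hp, hmap hp⟩
  have h1 := (hd.hasFDerivAt.comp p (h.differentiableAt hp).hasFDerivAt).fderiv
  have h2 : (fun q => g (F q)) ∘ retract φ =ᶠ[nhds p] (g ∘ retract ψ) ∘ (F ∘ retract φ) := by
    filter_upwards [(isOpen_retract_preimage h.source h.isOpen).mem_nhds
      (mem_retract_preimage hp)] with q hq
    simp only [Function.comp_apply]
    rw [retract_eq (h.map.mapsTo ⟨retract_mem φ q, hq⟩)]
  rw [tderiv, h2.fderiv_eq, h1]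
  simp only [Function.comp_apply, retract_eq hp.1, ContinuousLinearMap.comp_apply]
  rfl

theorem sm_comp (h : SmoothCR φ ψ O F)
    (hmap : Set.MapsTo F (hypersurface φ ∩ O) O₂) {g : Amb k → V} (hg : Sm ψ O₂ g) :
    Sm φ O (fun q => g (F q)) := by
  have h1 : ContDiffOn ℝ ∞ ((g ∘ retract ψ) ∘ (F ∘ retract φ)) (retract φ ⁻¹' O) := by
    refine ContDiffOn.comp hg h.sm fun q hq => ?_
    have hq' : retract φ q ∈ hypersurface φ ∩ O := ⟨retract_mem φ q, hq⟩
    simp only [Set.mem_preimage, Function.comp_apply]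
    rw [retract_eq (h.mem_target hq')]
    exact hmap hq'
  refine h1.congr fun q hq => ?_
  simp only [Function.comp_apply]
  rw [retract_eq (h.mem_target ⟨retract_mem φ q, hq⟩)]

/-- Complex linearity of F_* on contact vectors makes the two halves of Z_α F^i equal; with the
opposite sign they cancel, which is `Zbar_fst`. -/
theorem jac_eq (h : SmoothCR φ ψ O F) (hp : p ∈ hypersurface φ ∩ O) (α : Fin m) (i : Fin k) :
    (tderiv φ F p (frame φ α p)).1 i = jac φ F p α i := by
  have h1 := h.map.cr p hp _ (frame_mem_contact h.source α p)
  rw [jac, Z, h.tderiv_fst hp, h.tderiv_fst hp, h1]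
  simp only [Prod.smul_fst, Pi.smul_apply, smul_eq_mul, ← mul_assoc, Complex.I_mul_I]
  ring

theorem Zbar_fst (h : SmoothCR φ ψ O F) (hp : p ∈ hypersurface φ ∩ O) (α : Fin m) (i : Fin k) :
    Zbar φ α (fun q => (F q).1 i) p = 0 := by
  have h1 := h.map.cr p hp _ (frame_mem_contact h.source α p)
  rw [Zbar, h.tderiv_fst hp, h.tderiv_fst hp, h1]
  simp only [Prod.smul_fst, Pi.smul_apply, smul_eq_mul, ← mul_assoc, Complex.I_mul_I]
  ring

theorem Zbar_snd (h : SmoothCR φ ψ O F) (hp : p ∈ hypersurface φ ∩ O) (α : Fin m) :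
    Zbar φ α (fun q => (F q).2) p = 0 := by
  have h1 := h.map.cr p hp _ (frame_mem_contact h.source α p)
  rw [Zbar, h.tderiv_snd hp, h.tderiv_snd hp, h1]
  simp only [Prod.smul_snd, smul_eq_mul, ← mul_assoc, Complex.I_mul_I]
  ring

/-- F_* Z_α is a contact vector, and its w-component is determined by the others. -/
theorem Z_snd (h : SmoothCR φ ψ O F) (hp : p ∈ hypersurface φ ∩ O) (α : Fin m) :
    Z φ α (fun q => (F q).2) p = 2 * Complex.I * ∑ a, wirt ψ a (F p).1 * jac φ F p α a := by
  have h1 := h.map.cr p hp _ (frame_mem_contact h.source α p)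
  have h2 := (mem_contact_iff h.target).1
    (h.tderiv_mem_contact hp (frame_mem_contact h.source α p))
  simp only [h.jac_eq hp] at h2
  rw [Z, h.tderiv_snd hp, h.tderiv_snd hp, h1, ← h2]
  simp only [Prod.smul_snd, smul_eq_mul, ← mul_assoc, Complex.I_mul_I]
  ring

/-- Contact vectors go to contact vectors, so no Reeb term appears; by complex linearity the Z̄
terms drop out. -/
theorem Z_comp (h : SmoothCR φ ψ O F) (hO₂ : IsOpen O₂)
    (hmap : Set.MapsTo F (hypersurface φ ∩ O) O₂) {g : Amb k → ℂ} (hg : Sm ψ O₂ g)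
    (hp : p ∈ hypersurface φ ∩ O) (α : Fin m) :
    Z φ α (fun q => g (F q)) p = ∑ a, jac φ F p α a * Z ψ a g (F p) := by
  have hc := frame_mem_contact h.source α p
  have h1 := h.map.cr p hp _ hc
  have hw := h.tderiv_mem_contact hp hc
  have hw' : Complex.I • tderiv φ F p (frame φ α p) ∈ contact ψ (F p) :=
    Submodule.smul_mem _ _ hw
  rw [Z, h.tderiv_comp hO₂ hmap hg hp, h.tderiv_comp hO₂ hmap hg hp, h1,
    tderiv_tangent h.target g hw.1, tderiv_tangent h.target g hw'.1, theta_contact h.target hw,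
    theta_contact h.target hw']
  simp only [Prod.smul_fst, Pi.smul_apply, smul_eq_mul, h.jac_eq hp, Complex.ofReal_zero,
    zero_mul, zero_add, map_mul, Complex.conj_I, Finset.mul_sum, ← Finset.sum_sub_distrib]
  refine Finset.sum_congr rfl fun a _ => ?_
  ring_nf
  simp only [Complex.I_sq]
  ring

theorem Zbar_comp (h : SmoothCR φ ψ O F) (hO₂ : IsOpen O₂)
    (hmap : Set.MapsTo F (hypersurface φ ∩ O) O₂) {g : Amb k → ℂ} (hg : Sm ψ O₂ g)
    (hp : p ∈ hypersurface φ ∩ O) (α : Fin m) :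
    Zbar φ α (fun q => g (F q)) p
      = ∑ a, (starRingEnd ℂ) (jac φ F p α a) * Zbar ψ a g (F p) := by
  have h1 := congrArg (starRingEnd ℂ) (h.Z_comp hO₂ hmap hg.conj hp α)
  have hq : F p ∈ hypersurface ψ ∩ O₂ := ⟨h.mem_target hp, hmap hp⟩
  rw [Z_conj h.source h.isOpen hp (h.sm_comp hmap hg), Complex.conj_conj, map_sum] at h1
  rw [h1]
  refine Finset.sum_congr rfl fun a _ => ?_
  rw [map_mul, Z_conj h.target hO₂ hq hg, Complex.conj_conj]

/-- Unlike Z_α, the Reeb field need not go to a multiple of a frame field: F_*T = λT̃ plus a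
(1,0)-vector and its conjugate. These extra terms are the source of the correction terms in the
cocycle formula. -/
theorem reebD_comp (h : SmoothCR φ ψ O F) (hO₂ : IsOpen O₂)
    (hmap : Set.MapsTo F (hypersurface φ ∩ O) O₂) {g : Amb k → ℂ} (hg : Sm ψ O₂ g)
    (hp : p ∈ hypersurface φ ∩ O) :
    reebD φ (fun q => g (F q)) p = factor φ ψ F p * reebD ψ g (F p)
      + ∑ a, (reebJac φ F p a * Z ψ a g (F p)
        + (starRingEnd ℂ) (reebJac φ F p a) * Zbar ψ a g (F p)) := by
  rw [reebD, h.tderiv_comp hO₂ hmap hg hp,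
    tderiv_tangent h.target g (h.tderiv_mem_tangent hp _)]
  simp only [reebJac, reebD, h.tderiv_fst hp]
  rfl

/-- For a tangent vector the complex expression is already real, so no real part has to be taken.
Complex derivations can then be applied to λ term by term. -/
theorem factor_eq (h : SmoothCR φ ψ O F) (hp : p ∈ hypersurface φ ∩ O) :
    (factor φ ψ F p : ℂ) = (1 / 2) * (reebD φ (fun q => (F q).2) p
      - 2 * Complex.I * ∑ a, wirt ψ a (F p).1 * reebJac φ F p a) := by
  rw [factor, ofReal_theta h.target (h.tderiv_mem_tangent hp _)]
  simp only [reebJac, reebD, h.tderiv_fst hp, h.tderiv_snd hp]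

theorem mapsTo_univ : Set.MapsTo F (hypersurface φ ∩ O) Set.univ := fun _ _ => trivial

theorem sm_factor (h : SmoothCR φ ψ O F) : Sm φ O (factor φ ψ F) := by
  have h1 : Sm φ O (fun p => (1 / 2 : ℂ) * (reebD φ (fun q => (F q).2) p
      - 2 * Complex.I * ∑ a, wirt ψ a (F p).1 * reebJac φ F p a)) :=
    ((h.sm_snd.reebD h.source h.isOpen).sub ((Sm.sum fun a _ =>
      (h.sm_comp mapsTo_univ (Sm.wirt (O := Set.univ) h.target a)).mul
        (h.sm_reebJac a)).const_mul _)).const_mul _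
  refine (Sm.comp_contDiff (g := Complex.re) Complex.reCLM.contDiff h1).congr fun q hq => ?_
  simp only [← h.factor_eq hq, Complex.ofReal_re]

/-- Z_β̄ F^i = 0, so only the commutator [Z_β̄, Z_α] survives. -/
theorem Zbar_jac (h : SmoothCR φ ψ O F) (hp : p ∈ hypersurface φ ∩ O) (α β : Fin m)
    (i : Fin k) :
    Zbar φ β (fun q => jac φ F q α i) p = Complex.I * (levi φ p α β * reebJac φ F p i) := by
  have h1 := Zbar_Z h.source h.isOpen hp (h.sm_fst i) α β
  rw [(isDer_Z h.source h.isOpen hp α).zero_of_eqOn fun q hq => h.Zbar_fst hq β i, zero_add] at h1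
  exact h1

/-- T commutes with Z_β̄, so the components T F^i inherit the CR equations from F^i. -/
theorem Zbar_reebJac (h : SmoothCR φ ψ O F) (hp : p ∈ hypersurface φ ∩ O) (β : Fin m)
    (i : Fin k) : Zbar φ β (fun q => reebJac φ F q i) p = 0 := by
  have h1 := reebD_Zbar h.source h.isOpen hp (h.sm_fst i) β
  rw [(isDer_reebD h.source h.isOpen hp).zero_of_eqOn fun q hq => h.Zbar_fst hq β i] at h1
  exact h1.symm

theorem Zbar_wirt_comp (h : SmoothCR φ ψ O F) (hp : p ∈ hypersurface φ ∩ O) (β : Fin m)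
    (i : Fin k) : Zbar φ β (fun q => wirt ψ i (F q).1) p
      = ∑ j, (starRingEnd ℂ) (jac φ F p β j) * levi ψ (F p) i j :=
  h.Zbar_comp isOpen_univ mapsTo_univ (g := fun q => wirt ψ i q.1) (Sm.wirt h.target i) hp β

theorem sm_wirt_comp (h : SmoothCR φ ψ O F) (i : Fin k) :
    Sm φ O (fun q => wirt ψ i (F q).1) :=
  h.sm_comp mapsTo_univ (Sm.wirt (O := Set.univ) h.target i)

/-- `F` multiplies the Levi forms by the factor `λ`. -/
theorem factor_mul_levi (h : SmoothCR φ ψ O F) (hp : p ∈ hypersurface φ ∩ O) (α β : Fin m) :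
    factor φ ψ F p * levi φ p α β
      = leviPair ψ (F p) (jac φ F p α) (jac φ F p β) := by
  have hB := isDer_Zbar h.source h.isOpen hp β
  have hw : ∀ a, Sm φ O (fun q => wirt ψ a (F q).1 * jac φ F q α a) := fun a =>
    (h.sm_wirt_comp a).mul (h.sm_jac α a)
  -- Apply the commutator to the CR function w ∘ F: on the left Z_α of it is 2i φ̃_a F_α^a, on the
  -- right only i h_{αβ̄} T(w ∘ F) remains.
  have h1 := Zbar_Z h.source h.isOpen hp h.sm_snd α β
  rw [(isDer_Z h.source h.isOpen hp α).zero_of_eqOn fun q hq => h.Zbar_snd hq β, zero_add,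
    hB.congr (fun q hq => h.Z_snd hq α), hB.const_mul _ (Sm.sum fun a _ => hw a),
    hB.sum fun a _ => hw a] at h1
  have h2 : ∀ a, Zbar φ β (fun q => wirt ψ a (F q).1 * jac φ F q α a) p
      = (∑ j, levi ψ (F p) a j * jac φ F p α a * (starRingEnd ℂ) (jac φ F p β j))
        + Complex.I * levi φ p α β * (wirt ψ a (F p).1 * reebJac φ F p a) := by
    intro a
    rw [hB.mul (h.sm_wirt_comp a) (h.sm_jac α a), h.Zbar_wirt_comp hp, h.Zbar_jac hp,
      Finset.sum_mul]
    congr 1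
    · exact Finset.sum_congr rfl fun j _ => by ring
    · ring
  simp only [h2, Finset.sum_add_distrib, ← Finset.mul_sum] at h1
  rw [h.factor_eq hp, leviPair]
  have hI : Complex.I * Complex.I = -1 := Complex.I_mul_I
  have hI0 : (2 * Complex.I) ≠ 0 := by simp
  refine mul_left_cancel₀ hI0 ?_
  linear_combination -h1

/-- In the formula for λ the T-derivatives of F are annihilated by Z_β̄; only the coefficients φ̃_a
∘ F are differentiated, and they produce the Levi matrix. -/
theorem Zbar_factor (h : SmoothCR φ ψ O F) (hp : p ∈ hypersurface φ ∩ O) (β : Fin m) :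
    Zbar φ β (fun q => (factor φ ψ F q : ℂ)) p
      = -Complex.I * leviPair ψ (F p) (reebJac φ F p) (jac φ F p β) := by
  have hB := isDer_Zbar h.source h.isOpen hp β
  have hw : ∀ a, Sm φ O (fun q => wirt ψ a (F q).1 * reebJac φ F q a) := fun a =>
    (h.sm_wirt_comp a).mul (h.sm_reebJac a)
  have h0 := reebD_Zbar h.source h.isOpen hp h.sm_snd β
  rw [(isDer_reebD h.source h.isOpen hp).zero_of_eqOn fun q hq => h.Zbar_snd hq β] at h0
  rw [hB.congr (fun q hq => h.factor_eq hq), hB.const_mul _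
    ((h.sm_snd.reebD h.source h.isOpen).sub ((Sm.sum fun a _ => hw a).const_mul _)),
    hB.sub (h.sm_snd.reebD h.source h.isOpen) ((Sm.sum fun a _ => hw a).const_mul _),
    hB.const_mul _ (Sm.sum fun a _ => hw a), hB.sum fun a _ => hw a, ← h0]
  have h2 : ∀ a, Zbar φ β (fun q => wirt ψ a (F q).1 * reebJac φ F q a) p
      = ∑ j, levi ψ (F p) a j * reebJac φ F p a * (starRingEnd ℂ) (jac φ F p β j) := by
    intro a
    rw [hB.mul (h.sm_wirt_comp a) (h.sm_reebJac a), h.Zbar_wirt_comp hp, h.Zbar_reebJac hp,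
      Finset.sum_mul, mul_zero, add_zero]
    exact Finset.sum_congr rfl fun j _ => by ring
  simp only [h2, leviPair]
  ring

theorem Z_factor (h : SmoothCR φ ψ O F) (hp : p ∈ hypersurface φ ∩ O) (β : Fin m) :
    Z φ β (fun q => (factor φ ψ F q : ℂ)) p
      = Complex.I * leviPair ψ (F p) (jac φ F p β) (reebJac φ F p) := by
  rw [← conj_Zbar_ofReal h.source h.isOpen hp h.sm_factor, h.Zbar_factor hp, map_mul,
    conj_leviPair h.target (h.mem_target hp)]
  simp

end SmoothCR
end Maps

/-! ### Christoffel symbols -/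

section Christoffel

variable {m : ℕ} {φ : (Fin m → ℂ) → ℝ} {p : Amb m}

theorem sum_levi_mul_inv (hdet : IsUnit (levi φ p).det) (α γ : Fin m) :
    ∑ σ, levi φ p α σ * (levi φ p)⁻¹ σ γ = if α = γ then 1 else 0 := by
  have := congrFun (congrFun (Matrix.mul_nonsing_inv (levi φ p) hdet) α) γ
  rwa [Matrix.mul_apply, Matrix.one_apply] at this

theorem sum_inv_mul_levi (hdet : IsUnit (levi φ p).det) (σ τ : Fin m) :
    ∑ α, (levi φ p)⁻¹ σ α * levi φ p α τ = if σ = τ then 1 else 0 := by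
  have := congrFun (congrFun (Matrix.nonsing_inv_mul (levi φ p) hdet) σ) τ
  rwa [Matrix.mul_apply, Matrix.one_apply] at this

/-- Raising an index and lowering it again; it serves both the Christoffel symbols and the gradient
of log |λ|. -/
theorem sum_raise_mul_levi (hdet : IsUnit (levi φ p).det) (x : Fin m → ℂ) (τ : Fin m) :
    ∑ γ, (∑ σ, (levi φ p)⁻¹ σ γ * x σ) * levi φ p γ τ = x τ := by
  simp only [Finset.sum_mul]
  rw [Finset.sum_comm]
  calc _ = ∑ σ, x σ * ∑ γ, (levi φ p)⁻¹ σ γ * levi φ p γ τ :=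
        Finset.sum_congr rfl fun σ _ => by
          rw [Finset.mul_sum]
          exact Finset.sum_congr rfl fun γ _ => by ring
    _ = x τ := by simp [sum_inv_mul_levi hdet]

theorem sum_christoffel_mul_levi (hdet : IsUnit (levi φ p).det) (α β τ : Fin m) :
    ∑ γ, christoffel φ γ α β p * levi φ p γ τ = Z φ α (fun q => levi φ q β τ) p :=
  sum_raise_mul_levi hdet (fun σ => Z φ α (fun q => levi φ q β σ) p) τ

end Christoffel

/-! ### Second fundamental form, mean curvature and the two parts of the Ahlfors derivative -/

section Ahlfors

variable {m k : ℕ} {φ : (Fin m → ℂ) → ℝ} {ψ : (Fin k → ℂ) → ℝ} {O : Set (Amb m)}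
  {F : Amb m → Amb k} {p : Amb m}

/-- The covariant derivative `∇̃_{F_* Z_α} X` of a (1,0)-field along `F`. -/
def covD (φ : (Fin m → ℂ) → ℝ) (ψ : (Fin k → ℂ) → ℝ) (F : Amb m → Amb k) (α : Fin m)
    (X : Amb m → Fin k → ℂ) (p : Amb m) (i : Fin k) : ℂ :=
  Z φ α (fun q => X q i) p + ∑ a, ∑ b, christoffel ψ i a b (F p) * jac φ F p α a * X p b

/-- The normal part of `i F_* T`. -/
def normalReeb (φ : (Fin m → ℂ) → ℝ) (ψ : (Fin k → ℂ) → ℝ) (F : Amb m → Amb k) (p : Amb m)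
    (i : Fin k) : ℂ :=
  Complex.I * reebJac φ F p i + ∑ γ, gradUp φ ψ F γ p * jac φ F p γ i

namespace SmoothCR

/-- Metric compatibility of the target connection: lowering the Christoffel symbols gives Z_a
h_{ij̄}. The mixed symbols vanish, so the conjugated argument is differentiated componentwise by
Z_ᾱ. -/
theorem Z_leviPair (h : SmoothCR φ ψ O F) (hp : p ∈ hypersurface φ ∩ O)
    (hdet : IsUnit (levi ψ (F p)).det) {X Y : Amb m → Fin k → ℂ}
    (hX : ∀ i, Sm φ O (fun q => X q i)) (hY : ∀ i, Sm φ O (fun q => Y q i)) (α : Fin m) :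
    Z φ α (fun q => leviPair ψ (F q) (X q) (Y q)) p
      = leviPair ψ (F p) (covD φ ψ F α X p) (Y p)
        + leviPair ψ (F p) (X p) (fun j => Zbar φ α (fun q => Y q j) p) := by
  have hA := isDer_Z h.source h.isOpen hp α
  have hl : ∀ i j, Sm φ O (fun q => levi ψ (F q) i j) := fun i j =>
    h.sm_comp mapsTo_univ (Sm.levi (O := Set.univ) h.target isOpen_univ i j)
  have hs : ∀ i j, Sm φ O (fun q => levi ψ (F q) i j * X q i * (starRingEnd ℂ) (Y q j)) :=
    fun i j => ((hl i j).mul (hX i)).mul (hY j).conj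
  have hZl : ∀ i j, Z φ α (fun q => levi ψ (F q) i j) p
      = ∑ a, ∑ l, jac φ F p α a * (christoffel ψ l a i (F p) * levi ψ (F p) l j) := by
    intro i j
    rw [h.Z_comp isOpen_univ mapsTo_univ (g := fun q => levi ψ q i j)
      (Sm.levi h.target isOpen_univ i j) hp]
    refine Finset.sum_congr rfl fun a _ => ?_
    rw [← sum_christoffel_mul_levi hdet, Finset.mul_sum]
  have e1 : ∀ i j, Z φ α (fun q => levi ψ (F q) i j * X q i * (starRingEnd ℂ) (Y q j)) p
      = (∑ a, ∑ l, levi ψ (F p) l j * (christoffel ψ l a i (F p) * jac φ F p α a * X p i)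
          * (starRingEnd ℂ) (Y p j))
        + levi ψ (F p) i j * Z φ α (fun q => X q i) p * (starRingEnd ℂ) (Y p j)
        + levi ψ (F p) i j * X p i * (starRingEnd ℂ) (Zbar φ α (fun q => Y q j) p) := by
    intro i j
    rw [hA.mul ((hl i j).mul (hX i)) (hY j).conj, hA.mul (hl i j) (hX i),
      Z_conj h.source h.isOpen hp (hY j), hZl, add_mul]
    congr 2
    rw [Finset.sum_mul, Finset.sum_mul]
    refine Finset.sum_congr rfl fun a _ => ?_
    rw [Finset.sum_mul, Finset.sum_mul]
    exact Finset.sum_congr rfl fun l _ => by ring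
  have e2 : Z φ α (fun q => leviPair ψ (F q) (X q) (Y q)) p
      = ∑ i, ∑ j, Z φ α (fun q => levi ψ (F q) i j * X q i * (starRingEnd ℂ) (Y q j)) p := by
    have := hA.sum (s := Finset.univ) (f := fun i q => ∑ j, levi ψ (F q) i j * X q i
      * (starRingEnd ℂ) (Y q j)) fun i _ => Sm.sum fun j _ => hs i j
    refine Eq.trans this (Finset.sum_congr rfl fun i _ => ?_)
    exact hA.sum fun j _ => hs i j
  rw [e2]
  simp only [e1, Finset.sum_add_distrib]
  have e3 : leviPair ψ (F p) (covD φ ψ F α X p) (Y p)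
      = leviPair ψ (F p) (fun i => Z φ α (fun q => X q i) p) (Y p)
        + leviPair ψ (F p) (fun i => ∑ a, ∑ b, christoffel ψ i a b (F p) * jac φ F p α a
            * X p b) (Y p) := leviPair_add_left _ _ _
  have e4 : (∑ i, ∑ j, ∑ a, ∑ l, levi ψ (F p) l j
        * (christoffel ψ l a i (F p) * jac φ F p α a * X p i) * (starRingEnd ℂ) (Y p j))
      = leviPair ψ (F p) (fun i => ∑ a, ∑ b, christoffel ψ i a b (F p) * jac φ F p α a
            * X p b) (Y p) := by
    have hh : ∀ i j, (∑ a, ∑ l, levi ψ (F p) l j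
        * (christoffel ψ l a i (F p) * jac φ F p α a * X p i) * (starRingEnd ℂ) (Y p j))
        = ∑ l, ∑ a, levi ψ (F p) l j
        * (christoffel ψ l a i (F p) * jac φ F p α a * X p i) * (starRingEnd ℂ) (Y p j) :=
      fun i j => Finset.sum_comm
    simp only [hh, leviPair, Finset.mul_sum, Finset.sum_mul]
    calc _ = ∑ i, ∑ l, ∑ j, ∑ a, levi ψ (F p) l j
        * (christoffel ψ l a i (F p) * jac φ F p α a * X p i) * (starRingEnd ℂ) (Y p j) :=
          Finset.sum_congr rfl fun i _ => Finset.sum_comm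
      _ = ∑ l, ∑ i, ∑ j, ∑ a, levi ψ (F p) l j
        * (christoffel ψ l a i (F p) * jac φ F p α a * X p i) * (starRingEnd ℂ) (Y p j) :=
          Finset.sum_comm
      _ = ∑ l, ∑ j, ∑ i, ∑ a, levi ψ (F p) l j
        * (christoffel ψ l a i (F p) * jac φ F p α a * X p i) * (starRingEnd ℂ) (Y p j) :=
          Finset.sum_congr rfl fun l _ => Finset.sum_comm
      _ = _ := Finset.sum_congr rfl fun l _ => Finset.sum_congr rfl fun j _ => Finset.sum_comm
  rw [e4, e3, leviPair, leviPair, leviPair]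
  ring

/-- Differentiate λ h_{βσ̄} = ⟨F_β, F_σ⟩ by Z_α. The derivative of the second argument is i h_{σᾱ}
F_*T, whose pairing with F_β is a derivative of λ. -/
theorem leviPair_covD_jac (h : SmoothCR φ ψ O F) (hp : p ∈ hypersurface φ ∩ O)
    (hdet : IsUnit (levi ψ (F p)).det) (α β σ : Fin m) :
    leviPair ψ (F p) (covD φ ψ F α (fun q => jac φ F q β) p) (jac φ F p σ)
      = Z φ α (fun q => (factor φ ψ F q : ℂ)) p * levi φ p β σ
        + factor φ ψ F p * Z φ α (fun q => levi φ q β σ) p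
        + Z φ β (fun q => (factor φ ψ F q : ℂ)) p * levi φ p α σ := by
  have hA := isDer_Z h.source h.isOpen hp α
  have h1 := h.Z_leviPair hp hdet (h.sm_jac β) (h.sm_jac σ) α
  rw [← hA.congr (fun q hq => h.factor_mul_levi hq β σ),
    hA.mul h.sm_factor.ofReal (Sm.levi h.source h.isOpen β σ)] at h1
  simp only [h.Zbar_jac hp] at h1
  have e : leviPair ψ (F p) (jac φ F p β)
      (fun j => Complex.I * (levi φ p σ α * reebJac φ F p j))
      = -(Z φ β (fun q => (factor φ ψ F q : ℂ)) p * levi φ p α σ) := by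
    simp only [← mul_assoc]
    rw [leviPair_mul_right, h.Z_factor hp, map_mul, conj_levi h.source hp.1, Complex.conj_I]
    ring
  rw [e] at h1
  linear_combination -h1

/-- Differentiate λ_β = i⟨F_β, F_*T⟩; the second argument has CR components and contributes nothing.
-/
theorem Z_Z_factor (h : SmoothCR φ ψ O F) (hp : p ∈ hypersurface φ ∩ O)
    (hdet : IsUnit (levi ψ (F p)).det) (α β : Fin m) :
    Z φ α (Z φ β (fun q => (factor φ ψ F q : ℂ))) p
      = Complex.I * leviPair ψ (F p) (covD φ ψ F α (fun q => jac φ F q β) p)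
          (reebJac φ F p) := by
  have hA := isDer_Z h.source h.isOpen hp α
  have hs : Sm φ O (fun q => leviPair ψ (F q) (jac φ F q β) (reebJac φ F q)) :=
    Sm.sum fun i _ => Sm.sum fun j _ => ((h.sm_comp mapsTo_univ
      (Sm.levi (O := Set.univ) h.target isOpen_univ i j)).mul (h.sm_jac β i)).mul
      (h.sm_reebJac j).conj
  rw [hA.congr (fun q hq => h.Z_factor hq β), hA.const_mul _ hs,
    h.Z_leviPair hp hdet (h.sm_jac β) h.sm_reebJac α]
  simp [h.Zbar_reebJac hp, leviPair]

/-! ### The logarithm of the factor -/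

/-- `Real.log` is even, so the absolute value may be dropped; no case distinction on the sign of λ
is needed when differentiating. -/
theorem logFactor_eq_log (q : Amb m) : logFactor φ ψ F q = Real.log (factor φ ψ F q) :=
  Real.log_abs _

theorem sm_logFactor (h : SmoothCR φ ψ O F)
    (hl : ∀ q ∈ hypersurface φ ∩ O, factor φ ψ F q ≠ 0) : Sm φ O (logFactor φ ψ F) := by
  have h1 : ContDiffOn ℝ ∞ (fun q => Real.log ((factor φ ψ F ∘ retract φ) q))
      (retract φ ⁻¹' O) :=
    ContDiffOn.log h.sm_factor fun q hq => hl _ ⟨retract_mem φ q, hq⟩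
  exact h1.congr fun q _ => logFactor_eq_log _

theorem factor_mul_der_log (h : SmoothCR φ ψ O F) {D : (Amb m → ℂ) → ℂ} (hD : IsDer φ O p D)
    (hl : factor φ ψ F p ≠ 0) :
    factor φ ψ F p * D (logFactorC φ ψ F) = D (fun q => (factor φ ψ F q : ℂ)) := by
  rw [← hD.log h.sm_factor hl]
  congr 2
  funext q
  rw [logFactorC, logFactor_eq_log]

theorem sum_gradUp_mul_levi (hdet : IsUnit (levi φ p).det) (τ : Fin m) :
    ∑ γ, gradUp φ ψ F γ p * levi φ p γ τ = Zbar φ τ (logFactorC φ ψ F) p :=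
  sum_raise_mul_levi hdet (fun σ => Zbar φ σ (logFactorC φ ψ F) p) τ

/-- Both terms of II(Z_β̄, Z_α) carry h_{αβ̄}: the derivative of F_α by the commutator, the
connection term by definition. -/
theorem secondFormMixed_eq (h : SmoothCR φ ψ O F) (hp : p ∈ hypersurface φ ∩ O) (α β : Fin m)
    (i : Fin k) :
    secondFormMixed φ ψ F α β p i = levi φ p α β * normalReeb φ ψ F p i := by
  have h1 := h.Zbar_jac hp α β i
  have h2 : Zbar φ β (Z φ α (fun q => (F q).1 i)) p = _ := h1
  rw [secondFormMixed, h2, normalReeb]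
  simp only [jac]
  ring

/-- The trace of h against its inverse is m, which cancels the 1/m of the definition; this is where
m ≠ 0 matters. -/
theorem meanCurv_eq (h : SmoothCR φ ψ O F) (hp : p ∈ hypersurface φ ∩ O) (hm : m ≠ 0)
    (hdet : IsUnit (levi φ p).det) (i : Fin k) :
    meanCurv φ ψ F p i
      = (Real.exp (-logFactor φ ψ F p) : ℂ) * normalReeb φ ψ F p i := by
  have h1 : ∑ α, ∑ β, (levi φ p)⁻¹ β α * secondFormMixed φ ψ F α β p i
      = (m : ℂ) * normalReeb φ ψ F p i := by
    simp only [h.secondFormMixed_eq hp, ← mul_assoc, ← Finset.sum_mul]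
    congr 1
    rw [Finset.sum_comm]
    simp [sum_inv_mul_levi hdet]
  rw [meanCurv, h1]
  have : (m : ℂ) ≠ 0 := by exact_mod_cast hm
  field_simp

/-- The sign from replacing η by -η and the factor e^{-v} from ĥ combine to λ⁻¹, so both
orientations obey the same formulas. -/
theorem sign_mul_exp (hl : factor φ ψ F p ≠ 0) :
    Real.sign (factor φ ψ F p) * Real.exp (-logFactor φ ψ F p) = (factor φ ψ F p)⁻¹ := by
  rw [logFactor, Real.exp_neg, Real.exp_log (abs_pos.2 hl)]
  rcases lt_or_gt_of_ne hl with h1 | h1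
  · rw [Real.sign_of_neg h1, abs_of_neg h1, inv_neg]; ring
  · rw [Real.sign_of_pos h1, abs_of_pos h1]; ring

theorem pairing_meanCurv (h : SmoothCR φ ψ O F) (hp : p ∈ hypersurface φ ∩ O) (hm : m ≠ 0)
    (hdet : IsUnit (levi φ p).det) (hl : factor φ ψ F p ≠ 0) (X : Fin k → ℂ) :
    pairing φ ψ F p X (meanCurv φ ψ F p)
      = (factor φ ψ F p : ℂ)⁻¹ * leviPair ψ (F p) X (normalReeb φ ψ F p) := by
  have h1 : meanCurv φ ψ F p = fun i =>
      (Real.exp (-logFactor φ ψ F p) : ℂ) * normalReeb φ ψ F p i :=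
    funext fun i => h.meanCurv_eq hp hm hdet i
  have h2 : pairing φ ψ F p X (meanCurv φ ψ F p)
      = (Real.sign (factor φ ψ F p) : ℂ) * leviPair ψ (F p) X (meanCurv φ ψ F p) := rfl
  rw [h2, h1, leviPair_mul_right, Complex.conj_ofReal, ← Complex.ofReal_inv,
    ← sign_mul_exp hl]
  push_cast
  ring

/-- The gradient term cancels the tangential part of i F_*T exactly: ⟨i F_*T, F_τ⟩ = -Z_τ̄ λ, while
the gradient pairs to λ v_τ̄ = Z_τ̄ λ. -/
theorem leviPair_normalReeb_jac (h : SmoothCR φ ψ O F) (hp : p ∈ hypersurface φ ∩ O)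
    (hdet : IsUnit (levi φ p).det) (hl : factor φ ψ F p ≠ 0) (τ : Fin m) :
    leviPair ψ (F p) (normalReeb φ ψ F p) (jac φ F p τ) = 0 := by
  have e : leviPair ψ (F p) (normalReeb φ ψ F p) (jac φ F p τ)
      = leviPair ψ (F p) (fun i => Complex.I * reebJac φ F p i) (jac φ F p τ)
        + leviPair ψ (F p) (fun i => ∑ γ, gradUp φ ψ F γ p * jac φ F p γ i) (jac φ F p τ) :=
    leviPair_add_left _ _ _
  rw [e, leviPair_mul_left, leviPair_sum_left]
  simp only [← h.factor_mul_levi hp]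
  have e2 : ∑ γ, gradUp φ ψ F γ p * ((factor φ ψ F p : ℂ) * levi φ p γ τ)
      = factor φ ψ F p * ∑ γ, gradUp φ ψ F γ p * levi φ p γ τ := by
    rw [Finset.mul_sum]
    exact Finset.sum_congr rfl fun γ _ => by ring
  rw [e2, sum_gradUp_mul_levi hdet,
    h.factor_mul_der_log (isDer_Zbar h.source h.isOpen hp τ) hl, h.Zbar_factor hp]
  ring

/-- Pythagoras for the decomposition of i F_*T into its normal part and a tangential part of square
λ|∂̄_b v|². -/
theorem leviPair_normalReeb_self (h : SmoothCR φ ψ O F) (hp : p ∈ hypersurface φ ∩ O)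
    (hdet : IsUnit (levi φ p).det) (hl : factor φ ψ F p ≠ 0) :
    leviPair ψ (F p) (normalReeb φ ψ F p) (normalReeb φ ψ F p)
      = leviPair ψ (F p) (reebJac φ F p) (reebJac φ F p)
        - factor φ ψ F p * gradSq φ ψ F p := by
  have e : leviPair ψ (F p) (normalReeb φ ψ F p) (normalReeb φ ψ F p)
      = leviPair ψ (F p) (normalReeb φ ψ F p) (fun i => Complex.I * reebJac φ F p i)
        + leviPair ψ (F p) (normalReeb φ ψ F p)
            (fun i => ∑ γ, gradUp φ ψ F γ p * jac φ F p γ i) :=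
    leviPair_add_right _ _ _
  have e' : leviPair ψ (F p) (normalReeb φ ψ F p) (reebJac φ F p)
      = leviPair ψ (F p) (fun i => Complex.I * reebJac φ F p i) (reebJac φ F p)
        + leviPair ψ (F p) (fun i => ∑ γ, gradUp φ ψ F γ p * jac φ F p γ i)
            (reebJac φ F p) :=
    leviPair_add_left _ _ _
  rw [e, leviPair_sum_right, leviPair_mul_right, e', leviPair_mul_left, leviPair_sum_left]
  simp only [h.leviPair_normalReeb_jac hp hdet hl, mul_zero, Finset.sum_const_zero, add_zero,
    Complex.conj_I]
  have e2 : factor φ ψ F p * gradSq φ ψ F p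
      = Complex.I * ∑ γ, gradUp φ ψ F γ p * leviPair ψ (F p) (jac φ F p γ) (reebJac φ F p) := by
    rw [gradSq, Finset.mul_sum, Finset.mul_sum]
    refine Finset.sum_congr rfl fun γ _ => ?_
    have := h.factor_mul_der_log (isDer_Z h.source h.isOpen hp γ) hl
    rw [h.Z_factor hp] at this
    linear_combination gradUp φ ψ F γ p * this
  rw [e2]
  linear_combination -(leviPair ψ (F p) (reebJac φ F p) (reebJac φ F p)) * Complex.I_sq

/-- The Hermitian part of the CR Ahlfors derivative without the gradient terms. -/
theorem ahlforsHerm_eq (h : SmoothCR φ ψ O F) (hp : p ∈ hypersurface φ ∩ O) (hm : m ≠ 0)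
    (hdet : IsUnit (levi φ p).det) (hl : factor φ ψ F p ≠ 0) (α β : Fin m) :
    ahlforsHerm φ ψ F p α β
      = (1 / 2) * (Zbar φ β (Z φ α (logFactorC φ ψ F)) p
          + Z φ α (Zbar φ β (logFactorC φ ψ F)) p)
        + (1 / 2) * ((factor φ ψ F p : ℂ)⁻¹
            * leviPair ψ (F p) (reebJac φ F p) (reebJac φ F p)) * levi φ p α β := by
  have hl' : (factor φ ψ F p : ℂ) ≠ 0 := by exact_mod_cast hl
  have h1 : meanCurv φ ψ F p = fun i =>
      (Real.exp (-logFactor φ ψ F p) : ℂ) * normalReeb φ ψ F p i :=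
    funext fun i => h.meanCurv_eq hp hm hdet i
  have h2 : secondFormMixed φ ψ F α β p = fun i => levi φ p α β * normalReeb φ ψ F p i :=
    funext fun i => h.secondFormMixed_eq hp α β i
  -- With ξ the normal part of i F_*T, the mean curvature terms add up to (1 - ½) λ⁻¹|ξ|² h.
  -- Inserting |ξ|² = |F_*T|² - λ|∂̄_b v|² cancels the term ½|∂̄_b v|² h.
  simp only [ahlforsHerm, Matrix.of_apply]
  rw [h.pairing_meanCurv hp hm hdet hl, h.pairing_meanCurv hp hm hdet hl, h2, h1,
    leviPair_mul_left, leviPair_mul_left, h.leviPair_normalReeb_self hp hdet hl]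
  have h3 : (Real.exp (-logFactor φ ψ F p) : ℂ) * (Real.exp (logFactor φ ψ F p) : ℂ) = 1 := by
    rw [← Complex.ofReal_mul, ← Real.exp_add]
    simp
  generalize (Real.exp (-logFactor φ ψ F p) : ℂ) = x at *
  generalize (Real.exp (logFactor φ ψ F p) : ℂ) = y at *
  generalize leviPair ψ (F p) (reebJac φ F p) (reebJac φ F p) = B at *
  generalize (factor φ ψ F p : ℂ) = l at *
  have h4 : l⁻¹ * l = 1 := inv_mul_cancel₀ hl'
  linear_combination (-(1 / 2) * gradSq φ ψ F p * levi φ p α β) * h4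
    - (1 / 2) * l⁻¹ * (B - l * gradSq φ ψ F p) * levi φ p α β * h3

theorem leviPair_secondFormPure (_h : SmoothCR φ ψ O F) (α β : Fin m) (Y : Fin k → ℂ) :
    leviPair ψ (F p) (secondFormPure φ ψ F α β p) Y
      = leviPair ψ (F p) (covD φ ψ F α (fun q => jac φ F q β) p) Y
        - ∑ γ, christoffel φ γ α β p * leviPair ψ (F p) (jac φ F p γ) Y
        - Z φ α (logFactorC φ ψ F) p * leviPair ψ (F p) (jac φ F p β) Y
        - Z φ β (logFactorC φ ψ F) p * leviPair ψ (F p) (jac φ F p α) Y := by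
  rw [← leviPair_sum_left, ← leviPair_mul_left, ← leviPair_mul_left, ← leviPair_sub_left,
    ← leviPair_sub_left, ← leviPair_sub_left]
  rfl

/-- The second fundamental form is normal to the image. -/
theorem leviPair_secondFormPure_jac (h : SmoothCR φ ψ O F) (hp : p ∈ hypersurface φ ∩ O)
    (hdet : IsUnit (levi φ p).det) (hdet' : IsUnit (levi ψ (F p)).det)
    (hl : factor φ ψ F p ≠ 0) (α β σ : Fin m) :
    leviPair ψ (F p) (secondFormPure φ ψ F α β p) (jac φ F p σ) = 0 := by
  have hZ : ∀ γ, factor φ ψ F p * Z φ γ (logFactorC φ ψ F) p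
        = Z φ γ (fun q => (factor φ ψ F q : ℂ)) p := fun γ =>
    h.factor_mul_der_log (isDer_Z h.source h.isOpen hp γ) hl
  rw [h.leviPair_secondFormPure, h.leviPair_covD_jac hp hdet', ← hZ α, ← hZ β,
    ← sum_christoffel_mul_levi hdet]
  simp only [← h.factor_mul_levi hp]
  have : ∑ γ, christoffel φ γ α β p * ((factor φ ψ F p : ℂ) * levi φ p γ σ)
      = factor φ ψ F p * ∑ γ, christoffel φ γ α β p * levi φ p γ σ := by
    rw [Finset.mul_sum]
    exact Finset.sum_congr rfl fun γ _ => by ring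
  rw [this]
  ring

/-- The (2,0)-part of the CR Ahlfors derivative of a map between rigid hypersurfaces vanishes. -/
theorem ahlforsPure_eq_zero (h : SmoothCR φ ψ O F) (hp : p ∈ hypersurface φ ∩ O) (hm : m ≠ 0)
    (hdet : IsUnit (levi φ p).det) (hdet' : IsUnit (levi ψ (F p)).det)
    (hl : ∀ q ∈ hypersurface φ ∩ O, factor φ ψ F q ≠ 0) (α β : Fin m) :
    ahlforsPure φ ψ F p α β = 0 := by
  have hl' : (factor φ ψ F p : ℂ) ≠ 0 := by exact_mod_cast hl p hp
  have hu : Sm φ O (logFactorC φ ψ F) := (h.sm_logFactor hl).ofReal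
  have hZ : ∀ γ, ∀ q ∈ hypersurface φ ∩ O,
      factor φ ψ F q * Z φ γ (logFactorC φ ψ F) q
        = Z φ γ (fun q => (factor φ ψ F q : ℂ)) q := fun γ q hq =>
    h.factor_mul_der_log (isDer_Z h.source h.isOpen hq γ) (hl q hq)
  have hA := isDer_Z h.source h.isOpen hp α
  -- Z_α Z_β λ is computed in two ways: by Leibniz from λ_β = λ v_β, and as a pairing of the
  -- covariant derivative of F_β with F_*T.
  have hZZ := h.Z_Z_factor hp hdet' α β
  rw [← hA.congr (hZ β), hA.mul h.sm_factor.ofReal (hu.Z h.source h.isOpen β),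
    ← hZ α p hp] at hZZ
  have hII := h.leviPair_secondFormPure (p := p) α β
  have hperp := h.leviPair_secondFormPure_jac hp hdet hdet' (hl p hp) α β
  -- II is normal to the image, so the tangential gradient part of ξ drops out and only i F_*T
  -- remains.
  have hxi : leviPair ψ (F p) (secondFormPure φ ψ F α β p) (normalReeb φ ψ F p)
      = -Complex.I * leviPair ψ (F p) (secondFormPure φ ψ F α β p) (reebJac φ F p) := by
    have e : leviPair ψ (F p) (secondFormPure φ ψ F α β p) (normalReeb φ ψ F p)
        = leviPair ψ (F p) (secondFormPure φ ψ F α β p) (fun i => Complex.I * reebJac φ F p i)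
          + leviPair ψ (F p) (secondFormPure φ ψ F α β p)
            (fun i => ∑ γ, gradUp φ ψ F γ p * jac φ F p γ i) := leviPair_add_right _ _ _
    rw [e, leviPair_mul_right, leviPair_sum_right]
    simp [hperp]
  have hJ : ∀ γ, Complex.I * leviPair ψ (F p) (jac φ F p γ) (reebJac φ F p)
      = factor φ ψ F p * Z φ γ (logFactorC φ ψ F) p := fun γ => by
    rw [hZ γ p hp, h.Z_factor hp]
  have hsum : Complex.I * ∑ γ, christoffel φ γ α β p
        * leviPair ψ (F p) (jac φ F p γ) (reebJac φ F p)
      = factor φ ψ F p * ∑ γ, christoffel φ γ α β p * Z φ γ (logFactorC φ ψ F) p := by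
    rw [Finset.mul_sum, Finset.mul_sum]
    exact Finset.sum_congr rfl fun γ _ => by
      linear_combination christoffel φ γ α β p * hJ γ
  simp only [ahlforsPure, Matrix.of_apply]
  rw [h.pairing_meanCurv hp hm hdet (hl p hp), hxi, hII]
  have h4 : (factor φ ψ F p : ℂ)⁻¹ * factor φ ψ F p = 1 := inv_mul_cancel₀ hl'
  generalize (∑ γ, christoffel φ γ α β p
        * leviPair ψ (F p) (jac φ F p γ) (reebJac φ F p)) = S1 at *
  generalize (∑ γ, christoffel φ γ α β p * Z φ γ (logFactorC φ ψ F) p) = S2 at *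
  have hJα := hJ α
  have hJβ := hJ β
  generalize leviPair ψ (F p) (covD φ ψ F α (fun q => jac φ F q β) p) (reebJac φ F p) = C at *
  refine mul_left_cancel₀ hl' ?_
  have h5 : (factor φ ψ F p : ℂ) * (factor φ ψ F p : ℂ)⁻¹ = 1 := mul_inv_cancel₀ hl'
  rw [mul_add, ← mul_assoc (factor φ ψ F p : ℂ) (factor φ ψ F p : ℂ)⁻¹, h5]
  linear_combination hZZ + hsum + Z φ α (logFactorC φ ψ F) p * hJβ
    + Z φ β (logFactorC φ ψ F) p * hJα

end SmoothCR
end Ahlfors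

/-! ### Compositions -/

section Comp

variable {m k d : ℕ} {φ : (Fin m → ℂ) → ℝ} {ψ : (Fin k → ℂ) → ℝ} {χ : (Fin d → ℂ) → ℝ}
  {O : Set (Amb m)} {O₂ : Set (Amb k)} {F F' : Amb m → Amb k} {G : Amb k → Amb d} {p : Amb m}

theorem theta_add (p v w : Amb m) : theta φ p (v + w) = theta φ p v + theta φ p w := by
  simp [theta, mul_add]

theorem theta_smul (p v : Amb m) (c : ℝ) : theta φ p (c • v) = c * theta φ p v := by
  rw [theta, smul_comm, map_smul, theta, smul_eq_mul]
  ring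

theorem factor_congr (hφ : ContDiff ℝ ∞ φ) (hO : IsOpen O)
    (he : Set.EqOn F F' (hypersurface φ ∩ O)) (hp : p ∈ hypersurface φ ∩ O) :
    factor φ ψ F p = factor φ ψ F' p := by
  rw [factor, factor, tderiv_congr hφ hO he hp, he hp]

namespace SmoothCR

theorem congr (h : SmoothCR φ ψ O F) (he : Set.EqOn F' F (hypersurface φ ∩ O)) :
    SmoothCR φ ψ O F' where
  source := h.source
  target := h.target
  isOpen := h.isOpen
  map :=
    { mapsTo := h.map.mapsTo.congr he.symm
      smooth := h.map.smooth.congr he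
      cr := fun p hp v hv => by
        rw [tderiv_congr h.source h.isOpen he hp, tderiv_congr h.source h.isOpen he hp,
          h.map.cr p hp v hv] }

theorem comp (g : SmoothCR ψ χ O₂ G) (h : SmoothCR φ ψ O F)
    (hmap : Set.MapsTo F (hypersurface φ ∩ O) O₂) :
    SmoothCR φ χ O (fun q => G (F q)) where
  source := h.source
  target := g.target
  isOpen := h.isOpen
  map :=
    { mapsTo := fun q hq => g.map.mapsTo ⟨h.map.mapsTo hq, hmap hq⟩
      smooth := g.map.smooth.comp h.map.smooth fun q hq => ⟨h.map.mapsTo hq, hmap hq⟩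
      cr := fun p hp v hv => by
        rw [h.tderiv_comp g.isOpen hmap g.sm hp, h.tderiv_comp g.isOpen hmap g.sm hp,
          h.map.cr p hp v hv, g.map.cr _ ⟨h.map.mapsTo hp, hmap hp⟩ _
            (h.tderiv_mem_contact hp hv)] }

theorem reebJac_comp (g : SmoothCR ψ χ O₂ G) (h : SmoothCR φ ψ O F)
    (hmap : Set.MapsTo F (hypersurface φ ∩ O) O₂) (hp : p ∈ hypersurface φ ∩ O) (i : Fin d) :
    reebJac φ (fun q => G (F q)) p i
      = factor φ ψ F p * reebJac ψ G (F p) i + ∑ a, reebJac φ F p a * jac ψ G (F p) a i := by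
  have h1 := h.reebD_comp g.isOpen hmap (g.sm_fst i) hp
  simp only [g.Zbar_fst ⟨h.mem_target hp, hmap hp⟩, mul_zero, add_zero] at h1
  exact h1

/-- The contact part of F_*T stays in the contact space under G, so θ sees only the component λ_F T.
-/
theorem factor_comp (g : SmoothCR ψ χ O₂ G) (h : SmoothCR φ ψ O F)
    (hmap : Set.MapsTo F (hypersurface φ ∩ O) O₂) (hp : p ∈ hypersurface φ ∩ O) :
    factor φ χ (fun q => G (F q)) p = factor φ ψ F p * factor ψ χ G (F p) := by
  have hq : F p ∈ hypersurface ψ ∩ O₂ := ⟨h.mem_target hp, hmap hp⟩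
  have hc : ∑ a, (tderiv φ F p (reeb m)).1 a • frame ψ a (F p) ∈ contact ψ (F p) :=
    Submodule.sum_mem _ fun a _ => Submodule.smul_mem _ _ (frame_mem_contact h.target a _)
  rw [factor, h.tderiv_comp g.isOpen hmap g.sm hp,
    tangent_eq_sum h.target (h.tderiv_mem_tangent hp (reeb m)), tderiv_add, tderiv_smul,
    theta_add, theta_smul, theta_contact g.target (g.tderiv_mem_contact hq hc), add_zero]
  rfl

theorem logFactorC_comp (g : SmoothCR ψ χ O₂ G) (h : SmoothCR φ ψ O F)
    (hmap : Set.MapsTo F (hypersurface φ ∩ O) O₂) (hp : p ∈ hypersurface φ ∩ O)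
    (hl : factor φ ψ F p ≠ 0) (hl' : factor ψ χ G (F p) ≠ 0) :
    logFactorC φ χ (fun q => G (F q)) p = logFactorC φ ψ F p + logFactorC ψ χ G (F p) := by
  simp only [logFactorC, logFactor_eq_log, g.factor_comp h hmap hp, Real.log_mul hl hl',
    Complex.ofReal_add]

/-- The cocycle formula for the Hermitian part of the CR Ahlfors derivative. -/
theorem ahlforsHerm_comp (g : SmoothCR ψ χ O₂ G) (h : SmoothCR φ ψ O F)
    (hmap : Set.MapsTo F (hypersurface φ ∩ O) O₂) (hp : p ∈ hypersurface φ ∩ O)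
    (hm : m ≠ 0) (hk : k ≠ 0) (hdet : IsUnit (levi φ p).det)
    (hdet' : IsUnit (levi ψ (F p)).det)
    (hl : ∀ q ∈ hypersurface φ ∩ O, factor φ ψ F q ≠ 0)
    (hl' : ∀ q ∈ hypersurface ψ ∩ O₂, factor ψ χ G q ≠ 0) (α β : Fin m) :
    ahlforsHerm φ χ (fun q => G (F q)) p α β
      = ahlforsHerm φ ψ F p α β
        + ∑ a, ∑ b, jac φ F p α a * (starRingEnd ℂ) (jac φ F p β b)
            * ahlforsHerm ψ χ G (F p) a b := by
  have hq : ∀ q ∈ hypersurface φ ∩ O, F q ∈ hypersurface ψ ∩ O₂ := fun q hq =>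
    ⟨h.mem_target hq, hmap hq⟩
  have hgh := g.comp h hmap
  have hlK : ∀ q ∈ hypersurface φ ∩ O, factor φ χ (fun q => G (F q)) q ≠ 0 := fun q hqq => by
    rw [g.factor_comp h hmap hqq]
    exact mul_ne_zero (hl q hqq) (hl' _ (hq q hqq))
  have hA := fun q hq => isDer_Z (p := q) h.source h.isOpen hq α
  have hB := fun q hq => isDer_Zbar (p := q) h.source h.isOpen hq β
  have hu : Sm φ O (logFactorC φ ψ F) := (h.sm_logFactor hl).ofReal
  have hv : Sm ψ O₂ (logFactorC ψ χ G) := (g.sm_logFactor hl').ofReal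
  have hvF := h.sm_comp hmap hv
  have hZv := fun a => hv.Z h.target g.isOpen a
  have hZv' := fun a => hv.Zbar h.target g.isOpen a
  have hZvF := fun a => h.sm_comp hmap (hZv a)
  have hZvF' := fun a => h.sm_comp hmap (hZv' a)
  have hlog : Set.EqOn (logFactorC φ χ (fun q => G (F q)))
      (fun q => logFactorC φ ψ F q + logFactorC ψ χ G (F q)) (hypersurface φ ∩ O) :=
    fun q hqq => g.logFactorC_comp h hmap hqq (hl q hqq) (hl' _ (hq q hqq))
  have hZ1 : Set.EqOn (Z φ α (logFactorC φ χ (fun q => G (F q))))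
      (fun q => Z φ α (logFactorC φ ψ F) q
        + ∑ a, jac φ F q α a * Z ψ a (logFactorC ψ χ G) (F q)) (hypersurface φ ∩ O) := by
    intro q hqq
    rw [(hA q hqq).congr hlog, (hA q hqq).add hu hvF, h.Z_comp g.isOpen hmap hv hqq]
  have hZ2 : Set.EqOn (Zbar φ β (logFactorC φ χ (fun q => G (F q))))
      (fun q => Zbar φ β (logFactorC φ ψ F) q
        + ∑ a, (starRingEnd ℂ) (jac φ F q β a) * Zbar ψ a (logFactorC ψ χ G) (F q))
      (hypersurface φ ∩ O) := by
    intro q hqq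
    rw [(hB q hqq).congr hlog, (hB q hqq).add hu hvF, h.Zbar_comp g.isOpen hmap hv hqq]
  have hs1 := fun a => (h.sm_jac α a).mul (hZvF a)
  have hs2 := fun a => (h.sm_jac β a).conj.mul (hZvF' a)
  -- Z_β̄ differentiates the coefficients F_α^a as well, which leaves i h_{αβ̄} times the T F^a;
  -- `e2` is the counterpart with the opposite sign.
  have e1 : Zbar φ β (Z φ α (logFactorC φ χ (fun q => G (F q)))) p
      = Zbar φ β (Z φ α (logFactorC φ ψ F)) p
        + (Complex.I * levi φ p α β) * ∑ a, reebJac φ F p a * Z ψ a (logFactorC ψ χ G) (F p)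
        + ∑ a, ∑ b, jac φ F p α a * (starRingEnd ℂ) (jac φ F p β b)
            * Zbar ψ b (Z ψ a (logFactorC ψ χ G)) (F p) := by
    rw [(hB p hp).congr hZ1, (hB p hp).add (hu.Z h.source h.isOpen α) (Sm.sum fun a _ => hs1 a),
      (hB p hp).sum fun a _ => hs1 a, Finset.mul_sum, add_assoc, ← Finset.sum_add_distrib]
    congr 1
    refine Finset.sum_congr rfl fun a _ => ?_
    rw [(hB p hp).mul (h.sm_jac α a) (hZvF a), h.Zbar_jac hp,
      h.Zbar_comp g.isOpen hmap (hZv a) hp, Finset.mul_sum]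
    congr 1
    · ring
    · exact Finset.sum_congr rfl fun b _ => by ring
  have e2 : Z φ α (Zbar φ β (logFactorC φ χ (fun q => G (F q)))) p
      = Z φ α (Zbar φ β (logFactorC φ ψ F)) p
        - (Complex.I * levi φ p α β)
          * ∑ a, (starRingEnd ℂ) (reebJac φ F p a) * Zbar ψ a (logFactorC ψ χ G) (F p)
        + ∑ a, ∑ b, jac φ F p α a * (starRingEnd ℂ) (jac φ F p β b)
            * Z ψ a (Zbar ψ b (logFactorC ψ χ G)) (F p) := by
    rw [(hA p hp).congr hZ2, (hA p hp).add (hu.Zbar h.source h.isOpen β)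
      (Sm.sum fun a _ => hs2 a), (hA p hp).sum fun a _ => hs2 a, Finset.mul_sum,
      Finset.sum_comm, sub_add, ← Finset.sum_sub_distrib, sub_eq_add_neg,
      ← Finset.sum_neg_distrib]
    congr 1
    refine Finset.sum_congr rfl fun b _ => ?_
    rw [(hA p hp).mul (h.sm_jac β b).conj (hZvF' b),
      Z_conj h.source h.isOpen hp (h.sm_jac β b), h.Zbar_jac hp,
      h.Z_comp g.isOpen hmap (hZv' b) hp, Finset.mul_sum, map_mul, map_mul,
      conj_levi h.source hp.1, Complex.conj_I, neg_sub, sub_eq_add_neg, add_comm]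
    congr 1
    · exact Finset.sum_congr rfl fun a _ => by ring
    · ring
  have hlF : (factor φ ψ F p : ℂ) ≠ 0 := by exact_mod_cast hl p hp
  have hlG : (factor ψ χ G (F p) : ℂ) ≠ 0 := by exact_mod_cast hl' _ (hq p hp)
  have hτ : reebJac φ (fun q => G (F q)) p
      = fun i => factor φ ψ F p * reebJac ψ G (F p) i
        + ∑ a, reebJac φ F p a * jac ψ G (F p) a i :=
    funext fun i => g.reebJac_comp h hmap hp i
  have hGZ : ∀ a, leviPair χ (G (F p)) (jac ψ G (F p) a) (reebJac ψ G (F p))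
      = -Complex.I * (factor ψ χ G (F p) * Z ψ a (logFactorC ψ χ G) (F p)) := fun a => by
    rw [g.factor_mul_der_log (isDer_Z h.target g.isOpen (hq p hp) a) (hl' _ (hq p hp)),
      g.Z_factor (hq p hp), ← mul_assoc, neg_mul, Complex.I_mul_I]
    ring
  have hGZ' : ∀ a, leviPair χ (G (F p)) (reebJac ψ G (F p)) (jac ψ G (F p) a)
      = Complex.I * (factor ψ χ G (F p) * Zbar ψ a (logFactorC ψ χ G) (F p)) := fun a => by
    rw [g.factor_mul_der_log (isDer_Zbar h.target g.isOpen (hq p hp) a) (hl' _ (hq p hp)),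
      g.Zbar_factor (hq p hp), ← mul_assoc, mul_neg, Complex.I_mul_I]
    ring
  -- Expansion of |(G ∘ F)_*T|². The mixed terms are derivatives of log |λ_G|; after division by λ_F
  -- λ_G they cancel the Reeb terms of `e1` and `e2`.
  have e3 : leviPair χ (G (F p)) (reebJac φ (fun q => G (F q)) p)
        (reebJac φ (fun q => G (F q)) p)
      = factor φ ψ F p * factor φ ψ F p
          * leviPair χ (G (F p)) (reebJac ψ G (F p)) (reebJac ψ G (F p))
        + Complex.I * factor φ ψ F p * factor ψ χ G (F p)
          * (∑ a, (starRingEnd ℂ) (reebJac φ F p a) * Zbar ψ a (logFactorC ψ χ G) (F p)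
            - ∑ a, reebJac φ F p a * Z ψ a (logFactorC ψ χ G) (F p))
        + factor ψ χ G (F p) * leviPair ψ (F p) (reebJac φ F p) (reebJac φ F p) := by
    rw [hτ, leviPair_add_left, leviPair_mul_left, leviPair_sum_left]
    simp only [leviPair_add_right, leviPair_mul_right, leviPair_sum_right, hGZ, hGZ',
      ← g.factor_mul_levi (hq p hp), Complex.conj_ofReal]
    have s1 : ∑ a, (starRingEnd ℂ) (reebJac φ F p a) * (Complex.I * (factor ψ χ G (F p)
          * Zbar ψ a (logFactorC ψ χ G) (F p)))
        = Complex.I * factor ψ χ G (F p) * ∑ a, (starRingEnd ℂ) (reebJac φ F p a)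
          * Zbar ψ a (logFactorC ψ χ G) (F p) := by
      rw [Finset.mul_sum]
      exact Finset.sum_congr rfl fun a _ => by ring
    have s2 : ∑ a, reebJac φ F p a * ((factor φ ψ F p : ℂ) * (-Complex.I
            * (factor ψ χ G (F p) * Z ψ a (logFactorC ψ χ G) (F p)))
          + ∑ b, (starRingEnd ℂ) (reebJac φ F p b) * (factor ψ χ G (F p) * levi ψ (F p) a b))
        = -(Complex.I * factor φ ψ F p * factor ψ χ G (F p)
            * ∑ a, reebJac φ F p a * Z ψ a (logFactorC ψ χ G) (F p))
          + factor ψ χ G (F p) * leviPair ψ (F p) (reebJac φ F p) (reebJac φ F p) := by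
      rw [leviPair, Finset.mul_sum, Finset.mul_sum, ← Finset.sum_neg_distrib,
        ← Finset.sum_add_distrib]
      refine Finset.sum_congr rfl fun a _ => ?_
      rw [mul_add, Finset.mul_sum, Finset.mul_sum]
      congr 1
      · ring
      · exact Finset.sum_congr rfl fun b _ => by ring
    rw [s1, s2]
    ring
  have e4 : ∑ a, ∑ b, jac φ F p α a * (starRingEnd ℂ) (jac φ F p β b)
        * ahlforsHerm ψ χ G (F p) a b
      = (1 / 2) * (∑ a, ∑ b, jac φ F p α a * (starRingEnd ℂ) (jac φ F p β b)
            * Zbar ψ b (Z ψ a (logFactorC ψ χ G)) (F p)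
          + ∑ a, ∑ b, jac φ F p α a * (starRingEnd ℂ) (jac φ F p β b)
            * Z ψ a (Zbar ψ b (logFactorC ψ χ G)) (F p))
        + (1 / 2) * ((factor ψ χ G (F p) : ℂ)⁻¹
            * leviPair χ (G (F p)) (reebJac ψ G (F p)) (reebJac ψ G (F p)))
          * (factor φ ψ F p * levi φ p α β) := by
    rw [h.factor_mul_levi hp]
    simp only [g.ahlforsHerm_eq (hq p hp) hk hdet' (hl' _ (hq p hp)), leviPair, mul_add,
      Finset.mul_sum, Finset.sum_add_distrib, Finset.sum_mul]
    congr 1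
    · congr 1
      · exact Finset.sum_congr rfl fun a _ => Finset.sum_congr rfl fun b _ => by ring
      · exact Finset.sum_congr rfl fun a _ => Finset.sum_congr rfl fun b _ => by ring
    · refine Finset.sum_congr rfl fun a _ => Finset.sum_congr rfl fun b _ => ?_
      refine Finset.sum_congr rfl fun a' _ => Finset.sum_congr rfl fun b' _ => by ring
  rw [hgh.ahlforsHerm_eq hp hm hdet (hlK p hp), h.ahlforsHerm_eq hp hm hdet (hl p hp), e4, e1,
    e2, e3, g.factor_comp h hmap hp, Complex.ofReal_mul, mul_inv]
  generalize leviPair χ (G (F p)) (reebJac ψ G (F p)) (reebJac ψ G (F p)) = LG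
  generalize leviPair ψ (F p) (reebJac φ F p) (reebJac φ F p) = LF
  field_simp
  ring

end SmoothCR

end Comp

/-! ### Equidimensional maps between Ricci-flat hypersurfaces -/

/-- A smooth Levi-nondegenerate rigid hypersurface with vanishing pseudo-Hermitian Ricci
curvature. -/
structure RicciFlat {m : ℕ} (φ : (Fin m → ℂ) → ℝ) : Prop where
  smooth : ContDiff ℝ ∞ φ
  det : ∀ p ∈ hypersurface φ, IsUnit (levi φ p).det
  sm_christoffel : ∀ γ α β, Sm φ Set.univ (christoffel φ γ α β)
  symm : ∀ γ α β, ∀ p ∈ hypersurface φ,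
    christoffel φ γ α β p = christoffel φ γ β α p
  ricci : ∀ β γ, ∀ p ∈ hypersurface φ,
    ∑ α, ∑ σ, (levi φ p)⁻¹ σ α * Zbar φ σ (christoffel φ γ α β) p = 0

section Equidim

variable {m : ℕ} {φ ψ : (Fin m → ℂ) → ℝ} {O : Set (Amb m)} {F : Amb m → Amb m} {p : Amb m}

theorem Sm.mono {k : ℕ} {χ : (Fin k → ℂ) → ℝ} {f : Amb k → ℂ} (hf : Sm χ Set.univ f)
    (U : Set (Amb k)) : Sm χ U f :=
  ContDiffOn.mono hf fun _ _ => trivial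

/-- The matrix `(F_α^i)`. -/
def jacMat (φ : (Fin m → ℂ) → ℝ) (F : Amb m → Amb m) (p : Amb m) : Matrix (Fin m) (Fin m) ℂ :=
  Matrix.of (jac φ F p)

namespace SmoothCR

theorem jacMat_mul (h : SmoothCR φ ψ O F) (hp : p ∈ hypersurface φ ∩ O) :
    jacMat φ F p * levi ψ (F p) * (jacMat φ F p).conjTranspose
      = (factor φ ψ F p : ℂ) • levi φ p := by
  ext α β
  rw [Matrix.smul_apply, smul_eq_mul, h.factor_mul_levi hp, leviPair, Matrix.mul_apply,
    Finset.sum_comm]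
  refine Finset.sum_congr rfl fun j _ => ?_
  rw [Matrix.mul_apply, Finset.sum_mul]
  refine Finset.sum_congr rfl fun i _ => ?_
  simp only [jacMat, Matrix.of_apply, Matrix.conjTranspose_apply, RCLike.star_def]
  ring

/-- Take determinants in J h̃ J* = λh: the right side is non-zero. -/
theorem isUnit_jacMat (h : SmoothCR φ ψ O F) (hp : p ∈ hypersurface φ ∩ O)
    (hdet : IsUnit (levi φ p).det) (hl : factor φ ψ F p ≠ 0) :
    IsUnit (jacMat φ F p).det := by
  have h1 := congrArg Matrix.det (h.jacMat_mul hp)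
  rw [Matrix.det_mul, Matrix.det_mul, Matrix.det_smul] at h1
  rw [isUnit_iff_ne_zero] at hdet ⊢
  have hl' : (factor φ ψ F p : ℂ) ≠ 0 := by exact_mod_cast hl
  intro h0
  rw [h0, zero_mul, zero_mul] at h1
  exact mul_ne_zero (pow_ne_zero _ hl') hdet h1.symm

/-- In equal dimensions the F_σ span all (1,0)-vectors, and the target Levi form is nondegenerate.
-/
theorem eq_zero_of_leviPair_jac (h : SmoothCR φ ψ O F) (hp : p ∈ hypersurface φ ∩ O)
    (hdet : IsUnit (levi φ p).det) (hdet' : IsUnit (levi ψ (F p)).det)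
    (hl : factor φ ψ F p ≠ 0) {X : Fin m → ℂ}
    (hX : ∀ σ, leviPair ψ (F p) X (jac φ F p σ) = 0) : X = 0 := by
  have hJ := h.isUnit_jacMat hp hdet hl
  have h1 : (levi ψ (F p) * (jacMat φ F p).conjTranspose).det ≠ 0 := by
    rw [Matrix.det_mul, Matrix.det_conjTranspose]
    exact mul_ne_zero hdet'.ne_zero (star_ne_zero.2 hJ.ne_zero)
  refine Matrix.eq_zero_of_vecMul_eq_zero h1 ?_
  funext σ
  rw [Pi.zero_apply, ← hX σ, leviPair]
  simp only [Matrix.vecMul, dotProduct, Matrix.mul_apply, Finset.mul_sum, jacMat,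
    Matrix.of_apply, Matrix.conjTranspose_apply, RCLike.star_def]
  exact Finset.sum_congr rfl fun i _ => Finset.sum_congr rfl fun j _ => by ring

/-- The inverse form of J h̃ J* = λh. It converts contractions over the source into contractions
over the target. -/
theorem sum_jac_inv (h : SmoothCR φ ψ O F) (hp : p ∈ hypersurface φ ∩ O)
    (hdet : IsUnit (levi φ p).det) (hdet' : IsUnit (levi ψ (F p)).det)
    (hl : factor φ ψ F p ≠ 0) (c a : Fin m) :
    ∑ α, ∑ σ, (starRingEnd ℂ) (jac φ F p σ c) * (levi φ p)⁻¹ σ α * jac φ F p α a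
      = factor φ ψ F p * (levi ψ (F p))⁻¹ c a := by
  have hJ := h.isUnit_jacMat hp hdet hl
  have h1 : jacMat φ F p * (levi ψ (F p)
        * ((jacMat φ F p).conjTranspose * (levi φ p)⁻¹ * jacMat φ F p))
      = jacMat φ F p * ((factor φ ψ F p : ℂ) • 1) := by
    calc _ = (jacMat φ F p * levi ψ (F p) * (jacMat φ F p).conjTranspose) * (levi φ p)⁻¹
          * jacMat φ F p := by simp only [Matrix.mul_assoc]
      _ = _ := by
        rw [h.jacMat_mul hp, Matrix.smul_mul, Matrix.mul_nonsing_inv _ hdet]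
        simp
  have h2 : levi ψ (F p) * ((jacMat φ F p).conjTranspose * (levi φ p)⁻¹ * jacMat φ F p)
      = (factor φ ψ F p : ℂ) • 1 := by
    have := congrArg (fun A => (jacMat φ F p)⁻¹ * A) h1
    simpa only [← Matrix.mul_assoc, Matrix.nonsing_inv_mul _ hJ, Matrix.one_mul] using this
  have h3 : (jacMat φ F p).conjTranspose * (levi φ p)⁻¹ * jacMat φ F p
      = (factor φ ψ F p : ℂ) • (levi ψ (F p))⁻¹ := by
    have := congrArg (fun A => (levi ψ (F p))⁻¹ * A) h2
    simp only [← Matrix.mul_assoc, Matrix.nonsing_inv_mul _ hdet', Matrix.one_mul] at this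
    rw [this]
    simp
  have h4 := congrFun (congrFun h3 c) a
  rw [Matrix.smul_apply, smul_eq_mul] at h4
  rw [← h4, Matrix.mul_apply]
  refine Finset.sum_congr rfl fun α _ => ?_
  rw [Matrix.mul_apply, Finset.sum_mul]
  rfl

/-- The second fundamental form is normal, and there are no normal directions. -/
theorem secondFormPure_eq_zero (h : SmoothCR φ ψ O F) (hp : p ∈ hypersurface φ ∩ O)
    (hdet : IsUnit (levi φ p).det) (hdet' : IsUnit (levi ψ (F p)).det)
    (hl : factor φ ψ F p ≠ 0) (α β : Fin m) : secondFormPure φ ψ F α β p = 0 :=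
  h.eq_zero_of_leviPair_jac hp hdet hdet' hl
    fun σ => h.leviPair_secondFormPure_jac hp hdet hdet' hl α β σ

theorem covD_jac (h : SmoothCR φ ψ O F) (hp : p ∈ hypersurface φ ∩ O)
    (hdet : IsUnit (levi φ p).det) (hdet' : IsUnit (levi ψ (F p)).det)
    (hl : factor φ ψ F p ≠ 0) (α β i : Fin m) :
    covD φ ψ F α (fun q => jac φ F q β) p i
      = Z φ α (logFactorC φ ψ F) p * jac φ F p β i
        + Z φ β (logFactorC φ ψ F) p * jac φ F p α i
        + ∑ γ, christoffel φ γ α β p * jac φ F p γ i := by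
  have h1 := congrFun (h.secondFormPure_eq_zero hp hdet hdet' hl α β) i
  have h2 : covD φ ψ F α (fun q => jac φ F q β) p i
      - ∑ γ, christoffel φ γ α β p * jac φ F p γ i
      - Z φ α (logFactorC φ ψ F) p * jac φ F p β i
      - Z φ β (logFactorC φ ψ F) p * jac φ F p α i = 0 := h1
  linear_combination h2

/-- The `Z_σ̄`-derivative of `∇̃_α F_β`. -/
theorem Zbar_covD_jac (h : SmoothCR φ ψ O F) (hψ : RicciFlat ψ)
    (hp : p ∈ hypersurface φ ∩ O) (α β σ i : Fin m) :
    Zbar φ σ (fun q => covD φ ψ F α (fun q => jac φ F q β) q i) p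
      = Complex.I * (Z φ α (fun q => levi φ q β σ) p * reebJac φ F p i)
        + Complex.I * levi φ p β σ * covD φ ψ F α (reebJac φ F) p i
        + Complex.I * levi φ p α σ * covD φ ψ F β (reebJac φ F) p i
        + ∑ a, ∑ b, (∑ c, (starRingEnd ℂ) (jac φ F p σ c)
            * Zbar ψ c (christoffel ψ i a b) (F p)) * jac φ F p α a * jac φ F p β b := by
  have hA := isDer_Z h.source h.isOpen hp α
  have hB := isDer_Zbar h.source h.isOpen hp σ
  have hC : ∀ a b, Sm φ O (fun q => christoffel ψ i a b (F q)) := fun a b =>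
    h.sm_comp mapsTo_univ (hψ.sm_christoffel i a b)
  have hs : ∀ a b, Sm φ O (fun q => christoffel ψ i a b (F q) * jac φ F q α a
      * jac φ F q β b) := fun a b => ((hC a b).mul (h.sm_jac α a)).mul (h.sm_jac β b)
  have hlev := Sm.levi (O := O) h.source h.isOpen β σ
  have e1 : Zbar φ σ (Z φ α (fun q => jac φ F q β i)) p
      = Complex.I * (Z φ α (fun q => levi φ q β σ) p * reebJac φ F p i
          + levi φ p β σ * Z φ α (fun q => reebJac φ F q i) p)
        + Complex.I * (levi φ p α σ * Z φ β (fun q => reebJac φ F q i) p) := by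
    have h3 : reebD φ (fun q => jac φ F q β i) p = Z φ β (fun q => reebJac φ F q i) p :=
      reebD_Z h.source h.isOpen hp (h.sm_fst i) β
    rw [Zbar_Z h.source h.isOpen hp (h.sm_jac β i), hA.congr fun q hq => h.Zbar_jac hq β σ i,
      hA.const_mul _ (hlev.mul (h.sm_reebJac i)), hA.mul hlev (h.sm_reebJac i), h3]
  -- Symmetry of the Christoffel symbols lets the term that differentiates F_α^a be read as the
  -- connection part of the covariant derivative of F_*T along F_β.
  have e2 : ∀ a b, Zbar φ σ (fun q => christoffel ψ i a b (F q) * jac φ F q α a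
        * jac φ F q β b) p
      = (∑ c, (starRingEnd ℂ) (jac φ F p σ c)
            * Zbar ψ c (christoffel ψ i a b) (F p)) * jac φ F p α a * jac φ F p β b
        + Complex.I * levi φ p α σ
          * (christoffel ψ i b a (F p) * jac φ F p β b * reebJac φ F p a)
        + Complex.I * levi φ p β σ
          * (christoffel ψ i a b (F p) * jac φ F p α a * reebJac φ F p b) := by
    intro a b
    rw [hB.mul ((hC a b).mul (h.sm_jac α a)) (h.sm_jac β b), hB.mul (hC a b) (h.sm_jac α a),
      h.Zbar_comp isOpen_univ mapsTo_univ (hψ.sm_christoffel i a b) hp, h.Zbar_jac hp,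
      h.Zbar_jac hp, hψ.symm i b a _ (h.mem_target hp)]
    ring
  have e3 : Zbar φ σ (fun q => covD φ ψ F α (fun q => jac φ F q β) q i) p
      = Zbar φ σ (Z φ α (fun q => jac φ F q β i)) p
        + ∑ a, ∑ b, Zbar φ σ (fun q => christoffel ψ i a b (F q) * jac φ F q α a
          * jac φ F q β b) p := by
    refine Eq.trans (hB.add ((h.sm_jac β i).Z h.source h.isOpen α)
      (Sm.sum fun a _ => Sm.sum fun b _ => hs a b)) ?_
    congr 1
    refine Eq.trans (hB.sum (s := Finset.univ) (f := fun a q => ∑ b, christoffel ψ i a b (F q)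
      * jac φ F q α a * jac φ F q β b) fun a _ => Sm.sum fun b _ => hs a b) ?_
    exact Finset.sum_congr rfl fun a _ => hB.sum fun b _ => hs a b
  have e4 : ∑ a, ∑ b, christoffel ψ i b a (F p) * jac φ F p β b * reebJac φ F p a
      = ∑ a, ∑ b, christoffel ψ i a b (F p) * jac φ F p β a * reebJac φ F p b :=
    Finset.sum_comm
  rw [e3, e1]
  simp only [e2, Finset.sum_add_distrib, ← Finset.mul_sum, e4]
  rw [covD, covD]
  ring

end SmoothCR
end Equidim

/-! ### Contraction of the integrability condition and vanishing of the Hermitian part -/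

section Equidim

variable {m : ℕ} {φ ψ : (Fin m → ℂ) → ℝ} {O : Set (Amb m)} {F : Amb m → Amb m} {p : Amb m}

/-- Contraction of a pair of indices with the inverse Levi matrix. -/
def contract (φ : (Fin m → ℂ) → ℝ) (p : Amb m) (x : Fin m → Fin m → ℂ) : ℂ :=
  ∑ α, ∑ σ, (levi φ p)⁻¹ σ α * x α σ

theorem contract_add (x y : Fin m → Fin m → ℂ) :
    contract φ p (fun α σ => x α σ + y α σ) = contract φ p x + contract φ p y := by
  simp only [contract, mul_add, Finset.sum_add_distrib]

theorem contract_mul (c : ℂ) (x : Fin m → Fin m → ℂ) :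
    contract φ p (fun α σ => c * x α σ) = c * contract φ p x := by
  simp only [contract, Finset.mul_sum]
  exact Finset.sum_congr rfl fun i _ => Finset.sum_congr rfl fun j _ => by ring

theorem contract_sum {ι : Type*} [Fintype ι] (x : ι → Fin m → Fin m → ℂ) :
    contract φ p (fun α σ => ∑ a, x a α σ) = ∑ a, contract φ p (x a) := by
  simp only [contract, Finset.mul_sum]
  calc _ = ∑ α, ∑ a, ∑ σ, (levi φ p)⁻¹ σ α * x a α σ :=
        Finset.sum_congr rfl fun σ _ => Finset.sum_comm
    _ = _ := Finset.sum_comm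

theorem contract_levi (hdet : IsUnit (levi φ p).det) (c : ℂ) :
    contract φ p (fun α σ => c * levi φ p α σ) = c * m := by
  rw [contract_mul (x := fun α σ => levi φ p α σ), contract, Finset.sum_comm]
  simp [sum_inv_mul_levi hdet]

theorem contract_levi_mul (hdet : IsUnit (levi φ p).det) (β : Fin m) (x : Fin m → ℂ) :
    contract φ p (fun α σ => levi φ p β σ * x α) = x β := by
  calc _ = ∑ α, x α * ∑ σ, levi φ p β σ * (levi φ p)⁻¹ σ α := by
        refine Finset.sum_congr rfl fun α _ => ?_
        rw [Finset.mul_sum]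
        exact Finset.sum_congr rfl fun σ _ => by ring
    _ = _ := by simp [sum_levi_mul_inv hdet]

namespace SmoothCR

/-- The contracted integrability condition of `∇̃_α F_β = u_α F_β + u_β F_α`. -/
theorem covD_reebJac (h : SmoothCR φ ψ O F) (hφ : RicciFlat φ) (hψ : RicciFlat ψ)
    (hp : p ∈ hypersurface φ ∩ O) (hl : ∀ q ∈ hypersurface φ ∩ O, factor φ ψ F q ≠ 0)
    (β i : Fin m) :
    Complex.I * (m + 1) * covD φ ψ F β (reebJac φ F) p i
      = contract φ p (fun α σ => Zbar φ σ (Z φ α (logFactorC φ ψ F)) p) * jac φ F p β i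
        + contract φ p
            (fun α σ => Zbar φ σ (Z φ β (logFactorC φ ψ F)) p * jac φ F p α i)
        + Complex.I * (m + 1) * (Z φ β (logFactorC φ ψ F) p * reebJac φ F p i) := by
  have hu : Sm φ O (logFactorC φ ψ F) := (h.sm_logFactor hl).ofReal
  have hZu := fun α => hu.Z h.source h.isOpen α
  have hdet := hφ.det p hp.1
  have hΓ : ∀ γ α, Sm φ O (christoffel φ γ α β) := fun γ α => (hφ.sm_christoffel γ α β).mono O
  -- The Z_σ̄-derivative of the equation II(Z_α, Z_β) = 0. The terms with Z_α h_{βσ̄} cancel because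
  -- they equal the lowered Christoffel symbols of the source.
  have key : ∀ α σ,
      Complex.I * (levi φ p β σ * covD φ ψ F α (reebJac φ F) p i)
        + Complex.I * covD φ ψ F β (reebJac φ F) p i * levi φ p α σ
        + ∑ a, ∑ b, jac φ F p β b * ∑ c, Zbar ψ c (christoffel ψ i a b) (F p)
            * ((starRingEnd ℂ) (jac φ F p σ c) * jac φ F p α a)
      = jac φ F p β i * Zbar φ σ (Z φ α (logFactorC φ ψ F)) p
        + Zbar φ σ (Z φ β (logFactorC φ ψ F)) p * jac φ F p α i
        + Complex.I * reebJac φ F p i * (levi φ p β σ * Z φ α (logFactorC φ ψ F) p)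
        + Complex.I * (Z φ β (logFactorC φ ψ F) p * reebJac φ F p i) * levi φ p α σ
        + ∑ γ, jac φ F p γ i * Zbar φ σ (christoffel φ γ α β) p := by
    intro α σ
    have hB := isDer_Zbar h.source h.isOpen hp σ
    have h1 := h.Zbar_covD_jac hψ hp α β σ i
    rw [hB.congr fun q hq => h.covD_jac hq (hφ.det q hq.1)
        (hψ.det _ (h.mem_target hq)) (hl q hq) α β i,
      hB.add (((hZu α).mul (h.sm_jac β i)).add ((hZu β).mul (h.sm_jac α i)))
        (Sm.sum fun γ _ => (hΓ γ α).mul (h.sm_jac γ i)),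
      hB.add ((hZu α).mul (h.sm_jac β i)) ((hZu β).mul (h.sm_jac α i)),
      hB.mul (hZu α) (h.sm_jac β i), hB.mul (hZu β) (h.sm_jac α i),
      hB.sum fun γ _ => (hΓ γ α).mul (h.sm_jac γ i), h.Zbar_jac hp, h.Zbar_jac hp] at h1
    have e1 : ∑ γ, Zbar φ σ (fun q => christoffel φ γ α β q * jac φ F q γ i) p
        = ∑ γ, jac φ F p γ i * Zbar φ σ (christoffel φ γ α β) p
          + Complex.I * reebJac φ F p i * Z φ α (fun q => levi φ q β σ) p := by
      rw [← sum_christoffel_mul_levi hdet, Finset.mul_sum, ← Finset.sum_add_distrib]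
      refine Finset.sum_congr rfl fun γ _ => ?_
      rw [hB.mul (hΓ γ α) (h.sm_jac γ i), h.Zbar_jac hp]
      ring
    have e2 : ∑ a, ∑ b, jac φ F p β b * ∑ c, Zbar ψ c (christoffel ψ i a b) (F p)
            * ((starRingEnd ℂ) (jac φ F p σ c) * jac φ F p α a)
        = ∑ a, ∑ b, (∑ c, (starRingEnd ℂ) (jac φ F p σ c)
            * Zbar ψ c (christoffel ψ i a b) (F p)) * jac φ F p α a * jac φ F p β b := by
      refine Finset.sum_congr rfl fun a _ => Finset.sum_congr rfl fun b _ => ?_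
      rw [Finset.mul_sum, Finset.sum_mul, Finset.sum_mul]
      exact Finset.sum_congr rfl fun c _ => by ring
    rw [e1] at h1
    rw [e2]
    linear_combination -h1
  have hc : ∀ c a, contract φ p
      (fun α σ => (starRingEnd ℂ) (jac φ F p σ c) * jac φ F p α a)
      = factor φ ψ F p * (levi ψ (F p))⁻¹ c a := by
    intro c a
    rw [← h.sum_jac_inv hp hdet (hψ.det _ (h.mem_target hp)) (hl p hp), contract]
    exact Finset.sum_congr rfl fun α _ => Finset.sum_congr rfl fun σ _ => by ring
  -- After contraction the target curvature enters only as λ times its Ricci tensor; `hcurv'` is the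
  -- same for the source.
  have hcurv : ∑ a, ∑ b, jac φ F p β b * ∑ c, Zbar ψ c (christoffel ψ i a b) (F p)
      * ((factor φ ψ F p : ℂ) * (levi ψ (F p))⁻¹ c a) = 0 := by
    rw [Finset.sum_comm]
    refine Finset.sum_eq_zero fun b _ => ?_
    rw [← Finset.mul_sum]
    have : ∑ a, ∑ c, Zbar ψ c (christoffel ψ i a b) (F p)
        * ((factor φ ψ F p : ℂ) * (levi ψ (F p))⁻¹ c a)
        = factor φ ψ F p * ∑ a, ∑ c, (levi ψ (F p))⁻¹ c a
          * Zbar ψ c (christoffel ψ i a b) (F p) := by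
      simp only [Finset.mul_sum]
      exact Finset.sum_congr rfl fun i _ => Finset.sum_congr rfl fun j _ => by ring
    rw [this, hψ.ricci _ _ _ (h.mem_target hp), mul_zero, mul_zero]
  have hcurv' : ∑ γ, jac φ F p γ i
      * contract φ p (fun α σ => Zbar φ σ (christoffel φ γ α β) p) = 0 :=
    Finset.sum_eq_zero fun γ _ => by rw [contract, hφ.ricci _ _ _ hp.1, mul_zero]
  -- The factor m + 1: the trace of h_{ασ̄} gives m copies of the β-term, and h_{βσ̄} substitutes β
  -- for α once more.
  have h2 := congrArg (contract φ p) (funext fun α => funext fun σ => key α σ)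
  simp only [contract_add, contract_levi hdet, contract_mul, contract_sum,
    contract_levi_mul hdet, hc, hcurv, hcurv'] at h2
  linear_combination h2

/-- The contraction raises the index of x, and pairing with F_τ lowers it again through λh. -/
theorem contract_mul_leviPair (h : SmoothCR φ ψ O F) (hp : p ∈ hypersurface φ ∩ O)
    (hdet : IsUnit (levi φ p).det) (x : Fin m → ℂ) (τ : Fin m) :
    leviPair ψ (F p) (fun i => contract φ p (fun α σ => x σ * jac φ F p α i)) (jac φ F p τ)
      = factor φ ψ F p * x τ := by
  have e : (fun i => contract φ p (fun α σ => x σ * jac φ F p α i))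
      = fun i => ∑ α, (∑ σ, (levi φ p)⁻¹ σ α * x σ) * jac φ F p α i := by
    funext i
    refine Finset.sum_congr rfl fun α _ => ?_
    rw [Finset.sum_mul]
    exact Finset.sum_congr rfl fun σ _ => by ring
  rw [e, leviPair_sum_left]
  simp only [← h.factor_mul_levi hp]
  rw [← sum_raise_mul_levi hdet x τ, Finset.mul_sum]
  exact Finset.sum_congr rfl fun α _ => by ring

/-- `Z_β Z_τ̄ λ` in terms of the derivative of the Reeb field along `F`. -/
theorem Z_Zbar_factor (h : SmoothCR φ ψ O F) (hp : p ∈ hypersurface φ ∩ O)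
    (hdet : IsUnit (levi ψ (F p)).det) (β τ : Fin m) :
    Z φ β (Zbar φ τ (fun q => (factor φ ψ F q : ℂ))) p
      = -Complex.I * leviPair ψ (F p) (covD φ ψ F β (reebJac φ F) p) (jac φ F p τ)
        - levi φ p β τ * leviPair ψ (F p) (reebJac φ F p) (reebJac φ F p) := by
  have hA := isDer_Z h.source h.isOpen hp β
  have hs : Sm φ O (fun q => leviPair ψ (F q) (reebJac φ F q) (jac φ F q τ)) :=
    Sm.sum fun i _ => Sm.sum fun j _ => ((h.sm_comp mapsTo_univ
      (Sm.levi (O := Set.univ) h.target isOpen_univ i j)).mul (h.sm_reebJac i)).mul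
      (h.sm_jac τ j).conj
  rw [hA.congr (fun q hq => h.Zbar_factor hq τ), hA.const_mul _ hs,
    h.Z_leviPair hp hdet h.sm_reebJac (h.sm_jac τ) β]
  simp only [h.Zbar_jac hp, ← mul_assoc]
  rw [leviPair_mul_right, map_mul, conj_levi h.source hp.1, Complex.conj_I]
  linear_combination levi φ p β τ * leviPair ψ (F p) (reebJac φ F p) (reebJac φ F p)
    * Complex.I_sq

/-- The Hermitian part of the CR Ahlfors derivative of an equidimensional transversal CR map
between Ricci-flat rigid hypersurfaces vanishes. -/
theorem ahlforsHerm_eq_zero (h : SmoothCR φ ψ O F) (hφ : RicciFlat φ) (hψ : RicciFlat ψ)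
    (hp : p ∈ hypersurface φ ∩ O) (hl : ∀ q ∈ hypersurface φ ∩ O, factor φ ψ F q ≠ 0)
    (hm : m ≠ 0) (α β : Fin m) : ahlforsHerm φ ψ F p α β = 0 := by
  have hu : Sm φ O (logFactorC φ ψ F) := (h.sm_logFactor hl).ofReal
  have hdet := hφ.det p hp.1
  have hl' : (factor φ ψ F p : ℂ) ≠ 0 := by exact_mod_cast hl p hp
  set L := leviPair ψ (F p) (reebJac φ F p) (reebJac φ F p) with hL
  set C : Fin m → Fin m → ℂ := fun α σ => Zbar φ σ (Z φ α (logFactorC φ ψ F)) p with hC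
  set t := reebD φ (logFactorC φ ψ F) p with ht
  have hBC : ∀ b s, Z φ b (Zbar φ s (logFactorC φ ψ F)) p
      = C b s - Complex.I * t * levi φ p b s := fun b s => by
    have := Zbar_Z h.source h.isOpen hp hu b s
    rw [hC, ht]
    linear_combination -this
  -- Pair the contracted integrability condition with F_s and eliminate the covariant derivative of
  -- F_*T through Z_b Z_s̄ λ; then cancel λ.
  have key : ∀ b s, (m + 1) * (C b s - Complex.I * t * levi φ p b s
        + (factor φ ψ F p : ℂ)⁻¹ * L * levi φ p b s)
      + contract φ p C * levi φ p b s + C b s = 0 := by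
    intro b s
    have e0 := leviPair_mul_left (ψ := ψ) (q := F p) (Complex.I * (m + 1))
      (covD φ ψ F b (reebJac φ F) p) (jac φ F p s)
    rw [funext fun i => h.covD_reebJac hφ hψ hp hl b i, leviPair_add_left, leviPair_add_left,
      leviPair_mul_left, leviPair_mul_left, leviPair_mul_left, ← h.factor_mul_levi hp,
      h.contract_mul_leviPair hp hdet] at e0
    have e1 := h.Z_Zbar_factor hp (hψ.det _ (h.mem_target hp)) b s
    have hA := isDer_Z h.source h.isOpen hp b
    have hZb : ∀ q ∈ hypersurface φ ∩ O, Zbar φ s (fun q => (factor φ ψ F q : ℂ)) q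
        = factor φ ψ F q * Zbar φ s (logFactorC φ ψ F) q := fun q hq =>
      (h.factor_mul_der_log (isDer_Zbar h.source h.isOpen hq s) (hl q hq)).symm
    rw [hA.congr hZb, hA.mul h.sm_factor.ofReal (hu.Zbar h.source h.isOpen s),
      ← h.factor_mul_der_log hA (hl p hp), hBC] at e1
    have e2 := h.Zbar_factor hp s
    rw [hZb p hp] at e2
    have e3 : (factor φ ψ F p : ℂ) * (factor φ ψ F p : ℂ)⁻¹ = 1 := mul_inv_cancel₀ hl'
    refine mul_left_cancel₀ hl' ?_
    rw [mul_zero]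
    change contract φ p C * _ + (factor φ ψ F p : ℂ) * C b s + _ = _ at e0
    linear_combination e0 + (m + 1) * e1 - (m + 1) * Z φ b (logFactorC φ ψ F) p * e2
      + (m + 1) * L * levi φ p b s * e3
  -- The trace of the system. The right side is written `0 * 0` so that `contract_mul` evaluates its
  -- contraction to zero.
  have htr := congrArg (contract φ p) (funext fun b => funext fun s =>
    (show (m + 2 : ℂ) * C b s + ((m + 1) * ((factor φ ψ F p : ℂ)⁻¹ * L - Complex.I * t)
      + contract φ p C) * levi φ p b s = 0 * 0 by linear_combination key b s))
  simp only [contract_add, contract_levi hdet, contract_mul] at htr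
  rw [h.ahlforsHerm_eq hp hm hdet (hl p hp), hBC]
  change (1 / 2 : ℂ) * (C α β + _) + _ = 0
  have hm1 : (2 * (m + 1) : ℂ) ≠ 0 := by
    exact_mod_cast (by omega : 2 * (m + 1) ≠ 0)
  have hm2 : (m + 2 : ℂ) ≠ 0 := by exact_mod_cast (by omega : m + 2 ≠ 0)
  -- Put back into `key`, this turns the coefficient of h into (m + 1) - m/2 = (m + 2)/2. The system
  -- becomes m + 2 times the Hermitian part.
  have htr' : contract φ p C
      = -(m / 2 * ((factor φ ψ F p : ℂ)⁻¹ * L - Complex.I * t)) := by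
    refine mul_left_cancel₀ hm1 ?_
    linear_combination htr
  have hk := key α β
  rw [htr'] at hk
  refine mul_left_cancel₀ hm2 ?_
  linear_combination hk

end SmoothCR
end Equidim

/-! ### The model hypersurfaces -/

section Models

variable {m : ℕ} {φ : (Fin m → ℂ) → ℝ} {p : Amb m}

theorem tderiv_coord (p v : Amb m) (i : Fin m) : tderiv φ (fun q => q.1 i) p v = v.1 i := by
  have h : HasFDerivAt (fun z : Fin m → ℂ => z i)
      (ContinuousLinearMap.proj (R := ℝ) (φ := fun _ => ℂ) i) p.1 :=
    (ContinuousLinearMap.proj (R := ℝ) (φ := fun _ => ℂ) i).hasFDerivAt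
  rw [tderiv_comp_fst (f := fun z : Fin m → ℂ => z i) h.differentiableAt, h.fderiv]
  rfl

theorem Z_coord (α i : Fin m) : Z φ α (fun q => q.1 i) p = if i = α then 1 else 0 := by
  simp only [Z, tderiv_coord, Prod.smul_fst, Pi.smul_apply, fst_frame_apply, smul_eq_mul]
  split_ifs
  · linear_combination -(1 / 2 : ℂ) * Complex.I_sq
  · simp

theorem Zbar_coord (α i : Fin m) : Zbar φ α (fun q => q.1 i) p = 0 := by
  simp only [Zbar, tderiv_coord, Prod.smul_fst, Pi.smul_apply, fst_frame_apply, smul_eq_mul]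
  split_ifs
  · linear_combination (1 / 2 : ℂ) * Complex.I_sq
  · simp

theorem dz_coord (α i : Fin m) : dz φ α (fun q => q.1 i) p = if i = α then 1 else 0 := by
  simp only [dz, tderiv_coord, Pi.single_apply]
  split_ifs
  · linear_combination -(1 / 2 : ℂ) * Complex.I_sq
  · simp

theorem dzbar_coord (α i : Fin m) : dzbar φ α (fun q => q.1 i) p = 0 := by
  simp only [dzbar, tderiv_coord, Pi.single_apply]
  split_ifs
  · linear_combination (1 / 2 : ℂ) * Complex.I_sq
  · simp

theorem Sm.coord (hφ : ContDiff ℝ ∞ φ) (i : Fin m) :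
    Sm φ Set.univ (fun q : Amb m => q.1 i) :=
  Sm.of_contDiff hφ ((contDiff_apply ℝ ℂ i).comp contDiff_fst)

theorem Z_conj_coord (hφ : ContDiff ℝ ∞ φ) (hp : p ∈ hypersurface φ) (α i : Fin m) :
    Z φ α (fun q => (starRingEnd ℂ) (q.1 i)) p = 0 := by
  rw [Z_conj hφ isOpen_univ ⟨hp, trivial⟩ (Sm.coord hφ i), Zbar_coord, map_zero]

theorem Zbar_conj_coord (hφ : ContDiff ℝ ∞ φ) (hp : p ∈ hypersurface φ) (α i : Fin m) :
    Zbar φ α (fun q => (starRingEnd ℂ) (q.1 i)) p = if i = α then 1 else 0 := by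
  rw [Zbar_conj hφ isOpen_univ ⟨hp, trivial⟩ (Sm.coord hφ i), Z_coord]
  split_ifs <;> simp

theorem dz_conj_coord (hφ : ContDiff ℝ ∞ φ) (hp : p ∈ hypersurface φ) (α i : Fin m) :
    dz φ α (fun q => (starRingEnd ℂ) (q.1 i)) p = 0 := by
  rw [dz_conj hφ isOpen_univ ⟨hp, trivial⟩ (Sm.coord hφ i), dzbar_coord, map_zero]

/-- The point of the hypersurface over `z` with `Re w = 0`. -/
theorem lift_mem (φ : (Fin m → ℂ) → ℝ) (z : Fin m → ℂ) :
    ((z, Complex.I * (φ z : ℂ)) : Amb m) ∈ hypersurface φ := by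
  simp [hypersurface, defFun]

/-- Lifting z to a point of the hypersurface makes the Leibniz calculus of `IsDer` available for a
derivative on ℂ^m. -/
theorem wirt_eq_dz (hφ : ContDiff ℝ ∞ φ) (α : Fin m) (z : Fin m → ℂ) :
    wirt φ α z = dz φ α (fun q => (φ q.1 : ℂ)) (z, Complex.I * (φ z : ℂ)) :=
  (dz_ofReal_defining hφ α (z, Complex.I * (φ z : ℂ))).symm

theorem contDiff_quadric (n l : ℕ) : ContDiff ℝ ∞ (quadric n l) :=
  ContDiff.sum fun i _ => contDiff_const.mul ((contDiff_norm_sq ℝ).comp (contDiff_apply ℝ ℂ i))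

theorem wirt_quadric (n l : ℕ) (α : Fin n) (z : Fin n → ℂ) :
    wirt (quadric n l) α z
      = (if (α : ℕ) < l then (-1 : ℂ) else 1) * (starRingEnd ℂ) (z α) := by
  have hφ := contDiff_quadric n l
  set q : Amb n := (z, Complex.I * (quadric n l z : ℂ)) with hq
  have hqm : q ∈ hypersurface (quadric n l) ∩ Set.univ := ⟨lift_mem _ z, trivial⟩
  have hD := isDer_dz hφ isOpen_univ hqm α
  have hc := fun i => Sm.coord hφ i
  have he : (fun q : Amb n => (quadric n l q.1 : ℂ)) = fun q => ∑ i : Fin n,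
      (if (i : ℕ) < l then (-1 : ℂ) else 1) * (q.1 i * (starRingEnd ℂ) (q.1 i)) := by
    funext q
    simp only [quadric, Complex.ofReal_sum, Complex.ofReal_mul, Complex.ofReal_pow,
      Complex.mul_conj']
    refine Finset.sum_congr rfl fun i _ => ?_
    split_ifs <;> simp
  rw [wirt_eq_dz hφ, he, hD.sum fun i _ => ((hc i).mul (hc i).conj).const_mul _]
  have hi : ∀ i : Fin n, dz (quadric n l) α (fun q => (if (i : ℕ) < l then (-1 : ℂ) else 1)
      * (q.1 i * (starRingEnd ℂ) (q.1 i))) q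
      = if i = α then (if (i : ℕ) < l then (-1 : ℂ) else 1) * (starRingEnd ℂ) (z i) else 0 := by
    intro i
    rw [hD.const_mul _ ((hc i).mul (hc i).conj), hD.mul (hc i) (hc i).conj, dz_coord,
      dz_conj_coord hφ hqm.1]
    by_cases h : i = α <;> simp [h, hq]
  simp only [hi, Finset.sum_ite_eq', Finset.mem_univ, if_true]

theorem levi_quadric (n l : ℕ) {p : Amb n} (hp : p ∈ hypersurface (quadric n l)) :
    levi (quadric n l) p = Matrix.diagonal fun i : Fin n => if (i : ℕ) < l then (-1 : ℂ) else 1 := by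
  have hφ := contDiff_quadric n l
  have hB := fun β => isDer_Zbar hφ isOpen_univ ⟨hp, trivial⟩ β
  ext α β
  have he : (fun q : Amb n => wirt (quadric n l) α q.1)
      = fun q => (if (α : ℕ) < l then (-1 : ℂ) else 1) * (starRingEnd ℂ) (q.1 α) := by
    funext q; exact wirt_quadric n l α q.1
  rw [levi, Matrix.of_apply, he, (hB β).const_mul _ (Sm.coord hφ α).conj,
    Zbar_conj_coord hφ hp, Matrix.diagonal_apply]
  split_ifs <;> simp

theorem christoffel_quadric (n l : ℕ) {p : Amb n} (hp : p ∈ hypersurface (quadric n l))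
    (γ α β : Fin n) : christoffel (quadric n l) γ α β p = 0 := by
  have hA := isDer_Z (contDiff_quadric n l) isOpen_univ ⟨hp, trivial⟩ α
  refine Finset.sum_eq_zero fun σ _ => ?_
  have : Z (quadric n l) α (fun q => levi (quadric n l) q β σ) p = 0 := by
    rw [hA.congr (g := fun _ => Matrix.diagonal
      (fun i : Fin n => if (i : ℕ) < l then (-1 : ℂ) else 1) β σ)
      fun q hq => by simp only [levi_quadric n l hq.1], hA.const]
  rw [this, mul_zero]

theorem ricciFlat_quadric (n l : ℕ) : RicciFlat (quadric n l) where
  smooth := contDiff_quadric n l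
  det p hp := by
    rw [levi_quadric n l hp, Matrix.det_diagonal, isUnit_iff_ne_zero, Finset.prod_ne_zero_iff]
    intro i _
    split_ifs <;> simp
  sm_christoffel γ α β :=
    (Sm.const 0).congr fun q hq => christoffel_quadric n l hq.1 γ α β
  symm γ α β p hp := by rw [christoffel_quadric n l hp, christoffel_quadric n l hp]
  ricci β γ p hp := by
    refine Finset.sum_eq_zero fun α _ => Finset.sum_eq_zero fun σ _ => ?_
    rw [(isDer_Zbar (contDiff_quadric n l) isOpen_univ ⟨hp, trivial⟩ σ).zero_of_eqOn
      fun q hq => christoffel_quadric n l hq.1 γ α β, mul_zero]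

theorem contDiff_winkelmann (k l : ℕ) : ContDiff ℝ ∞ (winkelmann k l) := by
  -- The fourth power is rewritten as a square of ‖·‖², since the norm itself is not smooth at 0.
  have h4 : ∀ z : Fin (k + 2) → ℂ, winkelmann k l z
      = (‖z ((Fin.last k).castSucc)‖ ^ 2) ^ 2
    + ∑ j : Fin k, (if (j : ℕ) < l - 1 then (-1 : ℝ) else 1) * ‖z (j.castSucc.castSucc)‖ ^ 2
    - ((starRingEnd ℂ) (z ((Fin.last k).castSucc)) * z (Fin.last (k + 1))).im := by
    intro z
    rw [winkelmann, ← pow_mul]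
  rw [funext h4]
  have hn : ∀ i : Fin (k + 2), ContDiff ℝ ∞ fun z : Fin (k + 2) → ℂ => ‖z i‖ ^ 2 := fun i =>
    (contDiff_norm_sq ℝ).comp (contDiff_apply ℝ ℂ i)
  refine ContDiff.sub (((hn _).pow 2).add
    (ContDiff.sum fun j _ => contDiff_const.mul (hn _))) ?_
  exact Complex.imCLM.contDiff.comp ((Complex.conjCLE.contDiff.comp
    (contDiff_apply ℝ ℂ _)).mul (contDiff_apply ℝ ℂ _))

theorem wirt_winkelmann (k l : ℕ) {s ζ : Fin (k + 2)} (hs : s = (Fin.last k).castSucc)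
    (hζ : ζ = Fin.last (k + 1)) (α : Fin (k + 2)) (z : Fin (k + 2) → ℂ) :
    wirt (winkelmann k l) α z
      = (if s = α then 2 * (z s
            * ((starRingEnd ℂ) (z s)
              * (starRingEnd ℂ) (z s)))
            + -(Complex.I / 2) * (starRingEnd ℂ) (z ζ) else 0)
        + (if ζ = α then
            Complex.I / 2 * (starRingEnd ℂ) (z s) else 0)
        + ∑ j : Fin k, if j.castSucc.castSucc = α then
            (if (j : ℕ) < l - 1 then (-1 : ℂ) else 1)
              * (starRingEnd ℂ) (z j.castSucc.castSucc) else 0 := by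
  have hφ := contDiff_winkelmann k l
  set q : Amb (k + 2) := (z, Complex.I * (winkelmann k l z : ℂ)) with hq
  have hqm : q ∈ hypersurface (winkelmann k l) ∩ Set.univ := ⟨lift_mem _ z, trivial⟩
  have hD := isDer_dz hφ isOpen_univ hqm α
  have hc := fun i => Sm.coord hφ i
  have he : (fun q : Amb (k + 2) => (winkelmann k l q.1 : ℂ)) = fun q =>
      ((q.1 s * (starRingEnd ℂ) (q.1 s)) * (q.1 s * (starRingEnd ℂ) (q.1 s))
        + Complex.I / 2 * (q.1 ζ * (starRingEnd ℂ) (q.1 s) - q.1 s * (starRingEnd ℂ) (q.1 ζ)))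
      + ∑ j : Fin k, (if (j : ℕ) < l - 1 then (-1 : ℂ) else 1)
        * (q.1 j.castSucc.castSucc * (starRingEnd ℂ) (q.1 j.castSucc.castSucc)) := by
    funext q
    have him : (((starRingEnd ℂ) (q.1 s) * q.1 ζ).im : ℂ)
        = -(Complex.I / 2 * (q.1 ζ * (starRingEnd ℂ) (q.1 s)
          - q.1 s * (starRingEnd ℂ) (q.1 ζ))) := by
      apply Complex.ext <;> simp <;> ring
    simp only [winkelmann, Complex.ofReal_sub, Complex.ofReal_add, Complex.ofReal_pow,
      Complex.ofReal_sum, Complex.ofReal_mul, ← hs, ← hζ, him, Complex.mul_conj']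
    have hsum : ∑ j : Fin k, ((if (j : ℕ) < l - 1 then (-1 : ℝ) else 1 : ℝ) : ℂ)
          * (‖q.1 j.castSucc.castSucc‖ : ℂ) ^ 2
        = ∑ j : Fin k, (if (j : ℕ) < l - 1 then (-1 : ℂ) else 1)
          * (‖q.1 j.castSucc.castSucc‖ : ℂ) ^ 2 := by
      refine Finset.sum_congr rfl fun j _ => ?_
      split_ifs <;> simp
    rw [hsum]
    ring
  have hss := (hc s).mul (hc s).conj
  have h1 := (hc ζ).mul (hc s).conj
  have h2 := (hc s).mul (hc ζ).conj
  have hj := fun j : Fin k => (((hc j.castSucc.castSucc).mul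
    (hc j.castSucc.castSucc).conj).const_mul (if (j : ℕ) < l - 1 then (-1 : ℂ) else 1))
  rw [wirt_eq_dz hφ, he, hD.add ((hss.mul hss).add ((h1.sub h2).const_mul _))
    (Sm.sum fun j _ => hj j), hD.sum fun j _ => hj j,
    hD.add (hss.mul hss) ((h1.sub h2).const_mul _), hD.const_mul _ (h1.sub h2), hD.sub h1 h2,
    hD.mul hss hss, hD.mul (hc s) (hc s).conj, hD.mul (hc ζ) (hc s).conj,
    hD.mul (hc s) (hc ζ).conj]
  simp only [dz_coord, dz_conj_coord hφ hqm.1]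
  congr 1
  · by_cases ha : s = α <;> by_cases hb : ζ = α <;> simp [ha, hb, hq] <;> ring
  · refine Finset.sum_congr rfl fun j _ => ?_
    rw [hD.const_mul _ ((hc j.castSucc.castSucc).mul (hc j.castSucc.castSucc).conj),
      hD.mul (hc j.castSucc.castSucc) (hc j.castSucc.castSucc).conj, dz_coord,
      dz_conj_coord hφ hqm.1]
    by_cases h : j.castSucc.castSucc = α <;> simp [h, hq]

theorem levi_winkelmann (k l : ℕ) {s ζ : Fin (k + 2)} (hs : s = (Fin.last k).castSucc)
    (hζ : ζ = Fin.last (k + 1)) {p : Amb (k + 2)} (hp : p ∈ hypersurface (winkelmann k l))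
    (α β : Fin (k + 2)) :
    levi (winkelmann k l) p α β
      = (if s = α then
            (if s = β then 4 * (p.1 s
              * (starRingEnd ℂ) (p.1 s)) else 0)
            + (if ζ = β then -(Complex.I / 2) else 0) else 0)
        + (if ζ = α then
            (if s = β then Complex.I / 2 else 0) else 0)
        + ∑ j : Fin k, if j.castSucc.castSucc = α then
            (if j.castSucc.castSucc = β then
              (if (j : ℕ) < l - 1 then (-1 : ℂ) else 1) else 0) else 0 := by
  have hφ := contDiff_winkelmann k l
  have hB := isDer_Zbar hφ isOpen_univ ⟨hp, trivial⟩ β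
  have hc := fun i => Sm.coord hφ i
  have hconj := fun i => Zbar_conj_coord hφ hp β i
  have hite : ∀ (P : Prop) [Decidable P] (f : Amb (k + 2) → ℂ),
      Zbar (winkelmann k l) β (fun q => if P then f q else 0) p
        = if P then Zbar (winkelmann k l) β f p else 0 := by
    intro P _ f
    split_ifs
    · rfl
    · exact hB.const 0
  have hsite : ∀ (P : Prop) [Decidable P] {f : Amb (k + 2) → ℂ},
      Sm (winkelmann k l) Set.univ f →
        Sm (winkelmann k l) Set.univ (fun q => if P then f q else 0) := by
    intro P _ f hf
    split_ifs
    · exact hf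
    · exact Sm.const 0
  have h1 := ((hc s).mul ((hc s).conj.mul (hc s).conj)).const_mul 2
  have h2 := (hc ζ).conj.const_mul (-(Complex.I / 2))
  have h3 := (hc s).conj.const_mul (Complex.I / 2)
  have hj := fun j : Fin k => hsite (j.castSucc.castSucc = α)
    ((hc j.castSucc.castSucc).conj.const_mul (if (j : ℕ) < l - 1 then (-1 : ℂ) else 1))
  rw [levi, Matrix.of_apply, funext fun q : Amb (k + 2) => wirt_winkelmann k l hs hζ α q.1,
    hB.add ((hsite _ (h1.add h2)).add (hsite _ h3)) (Sm.sum fun j _ => hj j),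
    hB.add (hsite _ (h1.add h2)) (hsite _ h3), hB.sum fun j _ => hj j]
  simp only [hite]
  rw [hB.add h1 h2, hB.const_mul _ ((hc s).mul ((hc s).conj.mul (hc s).conj)),
    hB.mul (hc s) ((hc s).conj.mul (hc s).conj), hB.mul (hc s).conj (hc s).conj,
    hB.const_mul _ (hc ζ).conj, hB.const_mul _ (hc s).conj]
  simp only [hconj, Zbar_coord]
  congr 1
  · congr 1
    · congr 1
      by_cases hb : s = β <;> by_cases hd : ζ = β <;> simp only [hb, hd, if_true, if_false] <;> ring
    · congr 1
      by_cases hb : s = β <;> simp [hb]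
  · refine Finset.sum_congr rfl fun j _ => ?_
    rw [hB.const_mul _ (hc j.castSucc.castSucc).conj, hconj]
    by_cases hb : j.castSucc.castSucc = β <;> simp [hb]

end Models

/-! ### Levi matrix, connection and Ricci curvature of the Winkelmann hypersurface -/

section Winkelmann

variable {k l : ℕ} {p : Amb (k + 2)} {s ζ : Fin (k + 2)}

theorem levi_winkelmann_last (hs : s = (Fin.last k).castSucc) (hζ : ζ = Fin.last (k + 1))
    (hp : p ∈ hypersurface (winkelmann k l)) (β : Fin (k + 2)) :
    levi (winkelmann k l) p ζ β = if s = β then Complex.I / 2 else 0 := by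
  have h1 : s ≠ ζ := by rw [hs, hζ]; exact (Fin.castSucc_lt_last _).ne
  have h2 : ∀ j : Fin k, j.castSucc.castSucc ≠ ζ := fun j => by
    rw [hζ]; exact (Fin.castSucc_lt_last _).ne
  rw [levi_winkelmann k l hs hζ hp]
  simp [h1, h2]

theorem levi_winkelmann_middle (hs : s = (Fin.last k).castSucc) (hζ : ζ = Fin.last (k + 1))
    (hp : p ∈ hypersurface (winkelmann k l)) (β : Fin (k + 2)) :
    levi (winkelmann k l) p s β
      = (if s = β then 4 * (p.1 s * (starRingEnd ℂ) (p.1 s)) else 0)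
        + (if ζ = β then -(Complex.I / 2) else 0) := by
  have h1 : ζ ≠ s := by rw [hs, hζ]; exact (Fin.castSucc_lt_last _).ne'
  have h2 : ∀ j : Fin k, j.castSucc.castSucc ≠ s := fun j => by
    rw [hs]; exact fun h => (Fin.castSucc_lt_last j).ne (Fin.castSucc_injective _ h)
  rw [levi_winkelmann k l hs hζ hp]
  simp [h1, h2]

theorem levi_winkelmann_castSucc (hp : p ∈ hypersurface (winkelmann k l)) (j : Fin k)
    (β : Fin (k + 2)) :
    levi (winkelmann k l) p j.castSucc.castSucc β
      = if j.castSucc.castSucc = β then (if (j : ℕ) < l - 1 then (-1 : ℂ) else 1) else 0 := by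
  have h1 : (Fin.last k).castSucc ≠ j.castSucc.castSucc :=
    fun h => (Fin.castSucc_lt_last j).ne' (Fin.castSucc_injective _ h)
  have h2 : Fin.last (k + 1) ≠ j.castSucc.castSucc := (Fin.castSucc_lt_last _).ne'
  rw [levi_winkelmann k l rfl rfl hp, if_neg h1, if_neg h2, Finset.sum_eq_single j]
  · simp
  · intro b _ hb
    rw [if_neg]
    exact fun h => hb (Fin.castSucc_injective _ (Fin.castSucc_injective _ h))
  · simp

/-- A kernel vector is eliminated row by row: row ζ kills its s-entry, row s then kills its ζ-entry,
and the remaining rows are diagonal with entries ±1. -/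
theorem isUnit_det_levi_winkelmann (hp : p ∈ hypersurface (winkelmann k l)) :
    IsUnit (levi (winkelmann k l) p).det := by
  rw [isUnit_iff_ne_zero]
  intro h0
  obtain ⟨v, hv, hz⟩ := Matrix.exists_mulVec_eq_zero_iff.2 h0
  have hrow : ∀ α, ∑ β, levi (winkelmann k l) p α β * v β = 0 := fun α => congrFun hz α
  have hs : v (Fin.last k).castSucc = 0 := by
    have := hrow (Fin.last (k + 1))
    simp only [levi_winkelmann_last rfl rfl hp, ite_mul, zero_mul, Finset.sum_ite_eq,
      Finset.mem_univ, if_true] at this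
    simpa using this
  have hζ : v (Fin.last (k + 1)) = 0 := by
    have := hrow (Fin.last k).castSucc
    simp only [levi_winkelmann_middle rfl rfl hp, add_mul, ite_mul, zero_mul,
      Finset.sum_add_distrib, Finset.sum_ite_eq, Finset.mem_univ, if_true, hs, mul_zero,
      zero_add] at this
    simpa using this
  have hj : ∀ j : Fin k, v j.castSucc.castSucc = 0 := by
    intro j
    have := hrow j.castSucc.castSucc
    simp only [levi_winkelmann_castSucc hp, ite_mul, zero_mul, Finset.sum_ite_eq,
      Finset.mem_univ, if_true] at this
    split_ifs at this <;> simpa using this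
  apply hv
  funext i
  refine Fin.lastCases hζ (fun i => ?_) i
  exact Fin.lastCases hs (fun j => hj j) i

/-- Read off from row ζ of h h⁻¹ = 1, where h has a single entry. Row s of the inverse is enough,
because the only non-constant entry of h sits at (s, s). -/
theorem inv_levi_winkelmann (hs : s = (Fin.last k).castSucc) (hζ : ζ = Fin.last (k + 1))
    (hp : p ∈ hypersurface (winkelmann k l)) (γ : Fin (k + 2)) :
    (levi (winkelmann k l) p)⁻¹ s γ = if ζ = γ then -2 * Complex.I else 0 := by
  have h1 := sum_levi_mul_inv (isUnit_det_levi_winkelmann hp) ζ γ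
  simp only [levi_winkelmann_last hs hζ hp, ite_mul, zero_mul, Finset.sum_ite_eq,
    Finset.mem_univ, if_true] at h1
  have h2 : (levi (winkelmann k l) p)⁻¹ s γ
      = -2 * Complex.I * (Complex.I / 2 * (levi (winkelmann k l) p)⁻¹ s γ) := by
    linear_combination (levi (winkelmann k l) p)⁻¹ s γ * Complex.I_sq
  rw [h2, h1]
  split_ifs <;> simp

theorem Z_levi_winkelmann (hs : s = (Fin.last k).castSucc)
    (hp : p ∈ hypersurface (winkelmann k l)) (α β σ : Fin (k + 2)) :
    Z (winkelmann k l) α (fun q => levi (winkelmann k l) q β σ) p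
      = if s = α ∧ s = β ∧ s = σ then 4 * (starRingEnd ℂ) (p.1 s) else 0 := by
  have hφ := contDiff_winkelmann k l
  have hA := isDer_Z hφ isOpen_univ ⟨hp, trivial⟩ α
  have hc := Sm.coord hφ s
  -- Each entry is 4|z_s|² at (s, s), or zero elsewhere, plus a constant; the constant is written as
  -- the difference at p to avoid naming it.
  have he : Set.EqOn (fun q => levi (winkelmann k l) q β σ)
      (fun q => (if s = β ∧ s = σ then 4 else 0) * (q.1 s * (starRingEnd ℂ) (q.1 s))
        + ((levi (winkelmann k l) p β σ)
          - (if s = β ∧ s = σ then 4 else 0) * (p.1 s * (starRingEnd ℂ) (p.1 s))))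
      (hypersurface (winkelmann k l) ∩ Set.univ) := by
    intro q hq
    simp only
    rw [levi_winkelmann k l hs rfl hq.1, levi_winkelmann k l hs rfl hp]
    split_ifs <;> first | ring1 | (exfalso; tauto)
  rw [hA.congr he, hA.add ((hc.mul hc.conj).const_mul _) (Sm.const _), hA.const,
    hA.const_mul _ (hc.mul hc.conj), hA.mul hc hc.conj, Z_coord, Z_conj_coord hφ hp]
  split_ifs <;> first | (exfalso; tauto) | simp

theorem christoffel_winkelmann (hs : s = (Fin.last k).castSucc) (hζ : ζ = Fin.last (k + 1))
    (hp : p ∈ hypersurface (winkelmann k l)) (γ α β : Fin (k + 2)) :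
    christoffel (winkelmann k l) γ α β p
      = (if ζ = γ ∧ s = α ∧ s = β then -8 * Complex.I else 0) * (starRingEnd ℂ) (p.1 s) := by
  simp only [christoffel, Z_levi_winkelmann hs hp]
  rw [Finset.sum_eq_single s]
  · rw [inv_levi_winkelmann hs hζ hp]
    split_ifs <;> first | ring1 | (exfalso; tauto)
  · intro b _ hb
    simp [Ne.symm hb]
  · simp

/-- The only curvature is Z_s̄ Γ^ζ_{ss} = -8i. The Ricci trace multiplies it by the (s, s) entry of
the inverse Levi matrix, which is zero since that row is supported at ζ ≠ s. -/
theorem ricciFlat_winkelmann (k l : ℕ) : RicciFlat (winkelmann k l) where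
  smooth := contDiff_winkelmann k l
  det p hp := isUnit_det_levi_winkelmann hp
  sm_christoffel γ α β :=
    ((Sm.coord (contDiff_winkelmann k l) _).conj.const_mul _).congr fun q hq =>
      christoffel_winkelmann rfl rfl hq.1 γ α β
  symm γ α β p hp := by
    rw [christoffel_winkelmann rfl rfl hp, christoffel_winkelmann rfl rfl hp]
    congr 2
    rw [and_comm (a := (Fin.last k).castSucc = α)]
  ricci β γ p hp := by
    have hφ := contDiff_winkelmann k l
    set s : Fin (k + 2) := (Fin.last k).castSucc with hs
    set ζ : Fin (k + 2) := Fin.last (k + 1) with hζ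
    have hne : ζ ≠ s := by rw [hs, hζ]; exact (Fin.castSucc_lt_last _).ne'
    refine Finset.sum_eq_zero fun α _ => Finset.sum_eq_zero fun σ _ => ?_
    have hB := isDer_Zbar hφ isOpen_univ ⟨hp, trivial⟩ σ
    rw [hB.congr fun q hq => christoffel_winkelmann hs hζ hq.1 γ α β,
      hB.const_mul _ (Sm.coord hφ s).conj, Zbar_conj_coord hφ hp]
    by_cases h1 : s = σ
    · rw [← h1, inv_levi_winkelmann hs hζ hp]
      by_cases h2 : s = α
      · rw [← h2, if_neg hne, zero_mul]
      · simp [h2]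
    · simp [h1]

end Winkelmann

/-! ### Automorphisms -/

section Automorphisms

variable {m k : ℕ} {φ : (Fin m → ℂ) → ℝ} {χ : (Fin k → ℂ) → ℝ} {O O' : Set (Amb m)}
  {γ γi : Amb m → Amb m} {F F' : Amb m → Amb k} {p : Amb m}

/-- `tderiv` of the identity is the differential of `retract φ`, which fixes tangent vectors but not
vertical ones. -/
theorem tderiv_id (hφ : ContDiff ℝ ∞ φ) {v : Amb m} (hv : v ∈ tangent φ p) :
    tderiv φ (fun q => q) p v = v := by
  have hd : DifferentiableAt ℝ (retract φ) p := (contDiff_retract hφ).differentiable (by simp) p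
  have h0 : tderiv φ (fun q => q) p v = fderiv ℝ (retract φ) p v := rfl
  have hL : ∀ (L : Amb m →L[ℝ] ℂ), fderiv ℝ (fun q => L (retract φ q)) p v
      = L (fderiv ℝ (retract φ) p v) := fun L =>
    congrArg (fun A => A v) (L.hasFDerivAt.comp p hd.hasFDerivAt).fderiv
  have hfst : (fderiv ℝ (retract φ) p v).1 = v.1 :=
    congrArg (fun A => A v) (((ContinuousLinearMap.fst ℝ (Fin m → ℂ) ℂ).hasFDerivAt.comp p
      hd.hasFDerivAt).fderiv.symm.trans (ContinuousLinearMap.fst ℝ (Fin m → ℂ) ℂ).fderiv)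
  have hre : (fderiv ℝ (retract φ) p v).2.re = v.2.re := by
    let L : Amb m →L[ℝ] ℝ := Complex.reCLM.comp (ContinuousLinearMap.snd ℝ (Fin m → ℂ) ℂ)
    have h1 := (L.hasFDerivAt.comp p hd.hasFDerivAt).fderiv
    have h2 : L ∘ retract φ = L := by
      funext q; simp [L, retract]
    rw [h2, L.fderiv] at h1
    exact (congrArg (fun A => A v) h1).symm
  have him : (fderiv ℝ (retract φ) p v).2.im = v.2.im := by
    let L : Amb m →L[ℝ] ℝ := Complex.imCLM.comp (ContinuousLinearMap.snd ℝ (Fin m → ℂ) ℂ)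
    have h1 := (L.hasFDerivAt.comp p hd.hasFDerivAt).fderiv
    have h2 : L ∘ retract φ = φ ∘ Prod.fst := by
      funext q; simp [L, retract]
    have hφd : DifferentiableAt ℝ φ p.1 := hφ.differentiable (by simp) p.1
    have h3 := (hφd.hasFDerivAt.comp p (hasFDerivAt_fst (𝕜 := ℝ) (p := p))).fderiv
    rw [h2, h3] at h1
    have h4 := congrArg (fun A => A v) h1
    have h5 : fderiv ℝ φ p.1 v.1 = v.2.im := by
      rw [(mem_tangent_iff hφ).1 hv, fderiv_eq_wirt]
    exact h4.symm.trans h5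
  rw [h0]
  exact Prod.ext hfst (Complex.ext hre him)

theorem factor_id (hφ : ContDiff ℝ ∞ φ) (p : Amb m) : factor φ φ (fun q => q) p = 1 := by
  rw [factor, tderiv_id hφ (reeb_mem_tangent hφ p), theta_reeb hφ]

theorem IsCRAut.symm (h : IsCRAut φ O O' γ γi) : IsCRAut φ O' O γi γ where
  crMap := h.crMap_symm
  crMap_symm := h.crMap
  mapsTo := h.mapsTo_symm
  mapsTo_symm := h.mapsTo
  left_inv := h.right_inv
  right_inv := h.left_inv

theorem IsCRAut.smoothCR (h : IsCRAut φ O O' γ γi) (hφ : ContDiff ℝ ∞ φ) (hO : IsOpen O) :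
    SmoothCR φ φ O γ := ⟨hφ, hφ, hO, h.crMap⟩

/-- Multiplicativity applied to γ⁻¹ ∘ γ = id gives a product of two factors equal to 1. -/
theorem IsCRAut.factor_ne_zero (h : IsCRAut φ O O' γ γi) (hφ : ContDiff ℝ ∞ φ) (hO : IsOpen O)
    (hO' : IsOpen O') (hp : p ∈ hypersurface φ ∩ O) : factor φ φ γ p ≠ 0 := by
  have h1 := (h.symm.smoothCR hφ hO').factor_comp (h.smoothCR hφ hO)
    (fun q hq => (h.mapsTo hq).2) hp
  rw [factor_congr hφ hO (F' := fun q => q) (fun q hq => h.left_inv hq) hp, factor_id hφ] at h1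
  intro h0
  rw [h0, zero_mul] at h1
  exact one_ne_zero h1

theorem IsCRAut.tderiv_tderiv (h : IsCRAut φ O O' γ γi) (hφ : ContDiff ℝ ∞ φ) (hO : IsOpen O)
    (hO' : IsOpen O') (hp : p ∈ hypersurface φ ∩ O) {v : Amb m} (hv : v ∈ tangent φ p) :
    tderiv φ γi (γ p) (tderiv φ γ p v) = v := by
  rw [← (h.smoothCR hφ hO).tderiv_comp hO' (fun q hq => (h.mapsTo hq).2)
    (h.symm.smoothCR hφ hO').sm hp,
    tderiv_congr hφ hO (g := fun q => q) (fun q hq => h.left_inv hq) hp, tderiv_id hφ hv]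

/-- The differential of a CR map on a contact space. -/
def SmoothCR.contactMap (h : SmoothCR φ χ O F) (hp : p ∈ hypersurface φ ∩ O) :
    contact φ p →ₗ[ℂ] contact χ (F p) where
  toFun X := ⟨tderiv φ F p X, h.tderiv_mem_contact hp X.2⟩
  map_add' X Y := Subtype.ext (tderiv_add F p X Y)
  map_smul' c X := by
    refine Subtype.ext ?_
    have e : tderiv φ F p (c • (X : Amb m)) = c • tderiv φ F p X := by
      rw [complex_smul_eq, tderiv_add, tderiv_smul, tderiv_smul, h.map.cr p hp X X.2,
        ← complex_smul_eq]
    exact e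

/-- The differential of a CR automorphism on a contact space. -/
def IsCRAut.contactEquiv (h : IsCRAut φ O O' γ γi) (hφ : ContDiff ℝ ∞ φ) (hO : IsOpen O)
    (hO' : IsOpen O') (hp : p ∈ hypersurface φ ∩ O) :
    contact φ p ≃ₗ[ℂ] contact φ (γ p) :=
  LinearEquiv.ofBijective ((h.smoothCR hφ hO).contactMap hp) <| by
    have hq := h.mapsTo hp
    have e1 : γi (γ p) = p := h.left_inv hp
    constructor
    · intro X Y hXY
      have h1 := congrArg (tderiv φ γi (γ p)) (congrArg Subtype.val hXY)
      refine Subtype.ext ?_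
      exact (h.tderiv_tderiv hφ hO hO' hp X.2.1).symm.trans
        (h1.trans (h.tderiv_tderiv hφ hO hO' hp Y.2.1))
    · intro Y
      have hc := (h.symm.smoothCR hφ hO').tderiv_mem_contact hq Y.2
      have h2 := h.symm.tderiv_tderiv hφ hO' hO hq Y.2.1
      rw [e1] at hc h2
      exact ⟨⟨_, hc⟩, Subtype.ext h2⟩

theorem SmoothCR.tderiv_contact_fst (h : SmoothCR φ χ O F) (hp : p ∈ hypersurface φ ∩ O)
    {v : Amb m} (hv : v ∈ contact φ p) (i : Fin k) :
    (tderiv φ F p v).1 i = ∑ a, v.1 a * jac φ F p a i := by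
  rw [← h.tderiv_fst hp, tderiv_tangent h.source _ hv.1, theta_contact h.source hv]
  simp only [h.Zbar_fst hp, Complex.ofReal_zero, zero_mul, zero_add, mul_zero, add_zero, jac]

/-- If λ = 0 at p, then F_*T is contact; together with the images of contact vectors this puts
F_*(T_pM) into the contact space, against transversality. -/
theorem SmoothCR.factor_ne_zero (h : SmoothCR φ χ O F) (ht : IsTransversal φ χ O F)
    (hp : p ∈ hypersurface φ ∩ O) : factor φ χ F p ≠ 0 := by
  obtain ⟨v, hv, hn⟩ := ht p hp
  intro h0
  apply hn
  have hT : tderiv φ F p (reeb m) ∈ contact χ (F p) :=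
    mem_contact_of_theta h.target (h.tderiv_mem_tangent hp _) h0
  have hc : ∑ a, v.1 a • frame φ a p ∈ contact φ p :=
    Submodule.sum_mem _ fun a _ => Submodule.smul_mem _ _ (frame_mem_contact h.source a _)
  rw [tangent_eq_sum h.source hv, tderiv_add, tderiv_smul, ← Complex.coe_smul]
  exact Submodule.add_mem _ (Submodule.smul_mem _ _ hT) (h.tderiv_mem_contact hp hc)

/-- H' and Φ ∘ H ∘ γ⁻¹ agree only on M, not in the ambient space; the tensor depends on the values
on M alone. -/
theorem SmoothCR.ahlforsHerm_congr (h : SmoothCR φ χ O F)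
    (he : Set.EqOn F' F (hypersurface φ ∩ O)) (hp : p ∈ hypersurface φ ∩ O) (hm : m ≠ 0)
    (hdet : IsUnit (levi φ p).det) (hl : factor φ χ F p ≠ 0) (α β : Fin m) :
    ahlforsHerm φ χ F' p α β = ahlforsHerm φ χ F p α β := by
  have h' := h.congr he
  have hf : ∀ q ∈ hypersurface φ ∩ O, factor φ χ F' q = factor φ χ F q := fun q hq =>
    factor_congr h.source h.isOpen he hq
  have hu : Set.EqOn (logFactorC φ χ F') (logFactorC φ χ F) (hypersurface φ ∩ O) :=
    fun q hq => by rw [logFactorC, logFactorC, logFactor, logFactor, hf q hq]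
  have hA := fun q hq => isDer_Z (p := q) h.source h.isOpen hq α
  have hB := fun q hq => isDer_Zbar (p := q) h.source h.isOpen hq β
  have hτ : reebJac φ F' p = reebJac φ F p := funext fun i =>
    (isDer_reebD h.source h.isOpen hp).congr fun q hq => by simp only [he hq]
  rw [h'.ahlforsHerm_eq hp hm hdet (by rwa [hf p hp]), h.ahlforsHerm_eq hp hm hdet hl,
    (hB p hp).congr fun q hq => (hA q hq).congr hu,
    (hA p hp).congr fun q hq => (hB q hq).congr hu, hτ, hf p hp, he hp]

theorem sum_pullback {m k : ℕ} (A : Fin k → Fin k → ℂ) (J : Fin m → Fin k → ℂ)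
    (X Y : Fin m → ℂ) :
    ∑ α, ∑ β, (∑ a, ∑ b, J α a * (starRingEnd ℂ) (J β b) * A a b) * X α
        * (starRingEnd ℂ) (Y β)
      = ∑ a, ∑ b, A a b * (∑ α, X α * J α a) * (starRingEnd ℂ) (∑ β, Y β * J β b) := by
  simp only [map_sum, map_mul, Finset.sum_mul, Finset.mul_sum]
  calc _ = ∑ α, ∑ a, ∑ β, ∑ b, J α a * (starRingEnd ℂ) (J β b) * A a b * X α
        * (starRingEnd ℂ) (Y β) := Finset.sum_congr rfl fun α _ => Finset.sum_comm
    _ = ∑ a, ∑ α, ∑ β, ∑ b, J α a * (starRingEnd ℂ) (J β b) * A a b * X α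
        * (starRingEnd ℂ) (Y β) := Finset.sum_comm
    _ = ∑ a, ∑ α, ∑ b, ∑ β, J α a * (starRingEnd ℂ) (J β b) * A a b * X α
        * (starRingEnd ℂ) (Y β) :=
      Finset.sum_congr rfl fun a _ => Finset.sum_congr rfl fun α _ => Finset.sum_comm
    _ = ∑ a, ∑ b, ∑ α, ∑ β, J α a * (starRingEnd ℂ) (J β b) * A a b * X α
        * (starRingEnd ℂ) (Y β) := Finset.sum_congr rfl fun a _ => Finset.sum_comm
    _ = ∑ a, ∑ b, ∑ β, ∑ α, J α a * (starRingEnd ℂ) (J β b) * A a b * X α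
        * (starRingEnd ℂ) (Y β) :=
      Finset.sum_congr rfl fun a _ => Finset.sum_congr rfl fun b _ => Finset.sum_comm
    _ = _ := by
      refine Finset.sum_congr rfl fun a _ => Finset.sum_congr rfl fun b _ => ?_
      exact Finset.sum_congr rfl fun β _ => Finset.sum_congr rfl fun α _ => by ring

end Automorphisms

/-! ### Invariance of the CR Ahlfors derivative -/

section Invariance

variable {m k : ℕ} {φ : (Fin m → ℂ) → ℝ} {χ : (Fin k → ℂ) → ℝ} {O O' : Set (Amb m)}
  {V V' : Set (Amb k)} {H H' : Amb m → Amb k} {γ γi : Amb m → Amb m} {Φ Φi : Amb k → Amb k}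

/-- Two transversal CR maps between Ricci-flat hypersurfaces that are equivalent under CR
automorphisms of the source and the target. -/
structure Equivalent (φ : (Fin m → ℂ) → ℝ) (χ : (Fin k → ℂ) → ℝ) (O O' : Set (Amb m))
    (V V' : Set (Amb k)) (H H' : Amb m → Amb k) (γ γi : Amb m → Amb m) (Φ Φi : Amb k → Amb k) :
    Prop where
  source : RicciFlat φ
  target : RicciFlat χ
  dim_source : m ≠ 0
  dim_target : k ≠ 0
  isOpen : IsOpen O
  isOpen' : IsOpen O'
  isOpen_target : IsOpen V
  isOpen_target' : IsOpen V'
  map : IsCRMap φ χ O H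
  transversal : IsTransversal φ χ O H
  autSource : IsCRAut φ O O' γ γi
  autTarget : IsCRAut χ V V' Φ Φi
  mapsTo : Set.MapsTo H (hypersurface φ ∩ O) V
  eqOn : Set.EqOn H' (Φ ∘ H ∘ γi) (hypersurface φ ∩ O')

namespace Equivalent

theorem smoothCR (e : Equivalent φ χ O O' V V' H H' γ γi Φ Φi) : SmoothCR φ χ O H :=
  ⟨e.source.smooth, e.target.smooth, e.isOpen, e.map⟩

theorem smoothCR_source (e : Equivalent φ χ O O' V V' H H' γ γi Φ Φi) : SmoothCR φ φ O γ :=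
  e.autSource.smoothCR e.source.smooth e.isOpen

theorem smoothCR_source_symm (e : Equivalent φ χ O O' V V' H H' γ γi Φ Φi) :
    SmoothCR φ φ O' γi := e.autSource.symm.smoothCR e.source.smooth e.isOpen'

theorem smoothCR_target (e : Equivalent φ χ O O' V V' H H' γ γi Φ Φi) : SmoothCR χ χ V Φ :=
  e.autTarget.smoothCR e.target.smooth e.isOpen_target

theorem mapsTo_symm (e : Equivalent φ χ O O' V V' H H' γ γi Φ Φi) :
    Set.MapsTo γi (hypersurface φ ∩ O') O := fun _ hq => (e.autSource.mapsTo_symm hq).2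

theorem mapsTo_comp (e : Equivalent φ χ O O' V V' H H' γ γi Φ Φi) :
    Set.MapsTo (fun q => H (γi q)) (hypersurface φ ∩ O') V :=
  fun _ hq => e.mapsTo (e.autSource.mapsTo_symm hq)

theorem smoothCR' (e : Equivalent φ χ O O' V V' H H' γ γi Φ Φi) : SmoothCR φ χ O' H' :=
  (e.smoothCR_target.comp (e.smoothCR.comp e.smoothCR_source_symm e.mapsTo_symm)
    e.mapsTo_comp).congr e.eqOn

theorem factor_ne_zero (e : Equivalent φ χ O O' V V' H H' γ γi Φ Φi) :
    ∀ q ∈ hypersurface φ ∩ O, factor φ χ H q ≠ 0 :=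
  fun _ hq => e.smoothCR.factor_ne_zero e.transversal hq

theorem factor_source_ne_zero (e : Equivalent φ χ O O' V V' H H' γ γi Φ Φi) :
    ∀ q ∈ hypersurface φ ∩ O, factor φ φ γ q ≠ 0 :=
  fun _ hq => e.autSource.factor_ne_zero e.source.smooth e.isOpen e.isOpen' hq

theorem factor_target_ne_zero (e : Equivalent φ χ O O' V V' H H' γ γi Φ Φi) :
    ∀ q ∈ hypersurface χ ∩ V, factor χ χ Φ q ≠ 0 :=
  fun _ hq => e.autTarget.factor_ne_zero e.target.smooth e.isOpen_target e.isOpen_target' hq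

/-- Transversality of H' is inherited: its factor is the product of those of γ⁻¹, H and Φ. -/
theorem factor'_ne_zero (e : Equivalent φ χ O O' V V' H H' γ γi Φ Φi) :
    ∀ q ∈ hypersurface φ ∩ O', factor φ χ H' q ≠ 0 := by
  intro q hq
  have hq' := e.autSource.mapsTo_symm hq
  have h1 : factor φ χ H' q = _ := factor_congr e.source.smooth e.isOpen' e.eqOn hq
  have h2 := e.smoothCR_target.factor_comp (e.smoothCR.comp e.smoothCR_source_symm e.mapsTo_symm)
    e.mapsTo_comp hq
  have h3 := e.smoothCR.factor_comp e.smoothCR_source_symm e.mapsTo_symm hq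
  rw [h1]
  change factor φ χ (fun q => Φ (H (γi q))) q ≠ 0
  rw [h2, h3]
  exact mul_ne_zero (mul_ne_zero
    (e.autSource.symm.factor_ne_zero e.source.smooth e.isOpen' e.isOpen hq)
    (e.factor_ne_zero _ hq')) (e.factor_target_ne_zero _ ⟨e.map.mapsTo hq', e.mapsTo hq'⟩)

/-- The Hermitian part of `A(H)` is the pull-back of that of `A(H')` under `γ`. -/
theorem ahlforsHerm_eq (e : Equivalent φ χ O O' V V' H H' γ γi Φ Φi) {p : Amb m}
    (hp : p ∈ hypersurface φ ∩ O) (α β : Fin m) :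
    ahlforsHerm φ χ H p α β
      = ∑ a, ∑ b, jac φ γ p α a * (starRingEnd ℂ) (jac φ γ p β b)
          * ahlforsHerm φ χ H' (γ p) a b := by
  have hq := e.autSource.mapsTo hp
  have hγ : Set.MapsTo γ (hypersurface φ ∩ O) O' := fun _ hq => (e.autSource.mapsTo hq).2
  have hHp : H p ∈ hypersurface χ ∩ V := ⟨e.map.mapsTo hp, e.mapsTo hp⟩
  have hdet := e.source.det p hp.1
  -- One map, two factorisations: `h1` expands A(Φ ∘ H) and `h2` expands A(H' ∘ γ). The
  -- contributions of Φ and γ vanish.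
  have h1 := e.smoothCR_target.ahlforsHerm_comp e.smoothCR e.mapsTo hp e.dim_source e.dim_target
    hdet (e.target.det _ hHp.1) e.factor_ne_zero e.factor_target_ne_zero α β
  have h2 := e.smoothCR'.ahlforsHerm_comp e.smoothCR_source hγ hp e.dim_source e.dim_source
    hdet (e.source.det _ hq.1) e.factor_source_ne_zero e.factor'_ne_zero α β
  simp only [e.smoothCR_target.ahlforsHerm_eq_zero e.target e.target hHp e.factor_target_ne_zero
    e.dim_target, mul_zero, Finset.sum_const_zero, add_zero] at h1
  rw [e.smoothCR_source.ahlforsHerm_eq_zero e.source e.source hp e.factor_source_ne_zero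
    e.dim_source, zero_add] at h2
  rw [← h1, ← h2]
  refine ((e.smoothCR_target.comp e.smoothCR e.mapsTo).ahlforsHerm_congr (fun q hq => ?_) hp
    e.dim_source hdet ?_ α β).symm
  · simp only [e.eqOn (e.autSource.mapsTo hq), Function.comp_apply, e.autSource.left_inv hq]
  · rw [e.smoothCR_target.factor_comp e.smoothCR e.mapsTo hp]
    exact mul_ne_zero (e.factor_ne_zero p hp) (e.factor_target_ne_zero _ hHp)

/-- The two Hermitian matrices are congruent through the invertible Jacobian of γ. -/
theorem rank_ahlforsHerm (e : Equivalent φ χ O O' V V' H H' γ γi Φ Φi) {p : Amb m}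
    (hp : p ∈ hypersurface φ ∩ O) :
    (ahlforsHerm φ χ H p).rank = (ahlforsHerm φ χ H' (γ p)).rank := by
  have hJ := e.smoothCR_source.isUnit_jacMat hp (e.source.det p hp.1)
    (e.factor_source_ne_zero p hp)
  have hM : ahlforsHerm φ χ H p
      = jacMat φ γ p * ahlforsHerm φ χ H' (γ p) * (jacMat φ γ p).conjTranspose := by
    ext α β
    rw [e.ahlforsHerm_eq hp, Matrix.mul_apply, Finset.sum_comm]
    refine Finset.sum_congr rfl fun b _ => ?_
    rw [Matrix.mul_apply, Finset.sum_mul]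
    refine Finset.sum_congr rfl fun a _ => ?_
    simp only [jacMat, Matrix.of_apply, Matrix.conjTranspose_apply, RCLike.star_def]
    ring
  have hJ' : IsUnit (jacMat φ γ p).conjTranspose.det := by
    rw [Matrix.det_conjTranspose]
    exact hJ.star
  rw [hM, Matrix.rank_mul_eq_left_of_isUnit_det _ _ hJ',
    Matrix.rank_mul_eq_right_of_isUnit_det _ _ hJ]

theorem ahlfors_source (e : Equivalent φ χ O O' V V' H H' γ γi Φ Φi) {p : Amb m}
    (hp : p ∈ hypersurface φ ∩ O) (X Y : Amb m) :
    ahlfors φ χ H p X Y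
      = 2 * (∑ α, ∑ β, ahlforsHerm φ χ H p α β * X.1 α * (starRingEnd ℂ) (Y.1 β)).re := by
  simp only [ahlfors, e.smoothCR.ahlforsPure_eq_zero hp e.dim_source (e.source.det p hp.1)
    (e.target.det _ (e.map.mapsTo hp)) e.factor_ne_zero, zero_mul, zero_add]

theorem ahlfors_target (e : Equivalent φ χ O O' V V' H H' γ γi Φ Φi) {p : Amb m}
    (hp : p ∈ hypersurface φ ∩ O') (X Y : Amb m) :
    ahlfors φ χ H' p X Y
      = 2 * (∑ α, ∑ β, ahlforsHerm φ χ H' p α β * X.1 α * (starRingEnd ℂ) (Y.1 β)).re := by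
  simp only [ahlfors, e.smoothCR'.ahlforsPure_eq_zero hp e.dim_source (e.source.det p hp.1)
    (e.target.det _ (e.smoothCR'.mem_target hp)) e.factor'_ne_zero, zero_mul, zero_add]

/-- Take L = e^{-u/2} dγ. Pulling a sesquilinear form back by L scales its dγ pull-back by e^{-u}:
for the Levi form this cancels λ_γ = e^u, for the Ahlfors tensor it is the stated e^u. The
(2,0)-parts are zero on both sides. -/
theorem ahlfors_eq (e : Equivalent φ χ O O' V V' H H' γ γi Φ Φi) {u : ℝ} {p : Amb m}
    (hp : p ∈ hypersurface φ ∩ O)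
    (hu : theta φ (γ p) (tderiv φ γ p (reeb m)) = Real.exp u) :
    ∃ L : contact φ p ≃ₗ[ℂ] contact φ (γ p),
      (∀ X : contact φ p, tderiv φ γ p X = Real.exp (u / 2) • (L X : Amb m)) ∧
      (∀ X Y : contact φ p, leviForm φ (γ p) (L X) (L Y) = leviForm φ p X Y) ∧
      (∀ X Y : contact φ p,
        ahlfors φ χ H p X Y = Real.exp u * ahlfors φ χ H' (γ p) (L X) (L Y)) := by
  have hc : (Real.exp (-(u / 2)) : ℂ) ≠ 0 := by
    exact_mod_cast (Real.exp_pos _).ne'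
  have hγ := e.smoothCR_source
  let D := e.autSource.contactEquiv e.source.smooth e.isOpen e.isOpen' hp
  have hL : ∀ X : contact φ p,
      (((D.trans (LinearEquiv.smulOfNeZero ℂ (contact φ (γ p)) _ hc)) X : Amb m))
        = (Real.exp (-(u / 2)) : ℂ) • tderiv φ γ p X := fun X => rfl
  have hcoord : ∀ (X : contact φ p) (a : Fin m),
      ((D.trans (LinearEquiv.smulOfNeZero ℂ (contact φ (γ p)) _ hc)) X : Amb m).1 a
        = (Real.exp (-(u / 2)) : ℂ) * ∑ α, (X : Amb m).1 α * jac φ γ p α a := by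
    intro X a
    rw [hL, Prod.smul_fst, Pi.smul_apply, smul_eq_mul, hγ.tderiv_contact_fst hp X.2]
  have hfac : (factor φ φ γ p : ℂ) = (Real.exp u : ℂ) := congrArg _ hu
  have hee : (Real.exp (-(u / 2)) : ℂ) * (Real.exp (-(u / 2)) : ℂ) * (Real.exp u : ℂ) = 1 := by
    rw [← Complex.ofReal_mul, ← Complex.ofReal_mul, ← Real.exp_add, ← Real.exp_add]
    ring_nf
    simp
  have hsum : ∀ (A : Fin m → Fin m → ℂ) (X Y : contact φ p),
      (Real.exp u : ℂ) * ∑ a, ∑ b, A a b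
        * ((D.trans (LinearEquiv.smulOfNeZero ℂ (contact φ (γ p)) _ hc)) X : Amb m).1 a
        * (starRingEnd ℂ)
          (((D.trans (LinearEquiv.smulOfNeZero ℂ (contact φ (γ p)) _ hc)) Y : Amb m).1 b)
      = ∑ α, ∑ β, (∑ a, ∑ b, jac φ γ p α a * (starRingEnd ℂ) (jac φ γ p β b) * A a b)
          * (X : Amb m).1 α * (starRingEnd ℂ) ((Y : Amb m).1 β) := by
    intro A X Y
    rw [sum_pullback, Finset.mul_sum]
    refine Finset.sum_congr rfl fun a _ => ?_
    rw [Finset.mul_sum]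
    refine Finset.sum_congr rfl fun b _ => ?_
    rw [hcoord, hcoord, map_mul, Complex.conj_ofReal]
    linear_combination A a b * (∑ α, (X : Amb m).1 α * jac φ γ p α a)
      * (starRingEnd ℂ) (∑ β, (Y : Amb m).1 β * jac φ γ p β b) * hee
  refine ⟨D.trans (LinearEquiv.smulOfNeZero ℂ (contact φ (γ p)) _ hc), fun X => ?_,
    fun X Y => ?_, fun X Y => ?_⟩
  · rw [hL, Complex.coe_smul, smul_smul, ← Real.exp_add]
    simp
  · have h0 : (Real.exp u : ℂ) ≠ 0 := by exact_mod_cast (Real.exp_pos _).ne'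
    refine mul_left_cancel₀ h0 ?_
    have h1 := hsum (levi φ (γ p)) X Y
    rw [leviForm, h1, leviForm, Finset.mul_sum]
    refine Finset.sum_congr rfl fun α _ => ?_
    rw [Finset.mul_sum]
    refine Finset.sum_congr rfl fun β _ => ?_
    have h2 := hγ.factor_mul_levi hp α β
    rw [hfac] at h2
    rw [← mul_assoc, ← mul_assoc, h2, leviPair]
    congr 2
    exact Finset.sum_congr rfl fun a _ => Finset.sum_congr rfl fun b _ => by ring
  · rw [e.ahlfors_source hp, e.ahlfors_target (e.autSource.mapsTo hp)]
    simp only [e.ahlforsHerm_eq hp]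
    rw [← hsum (ahlforsHerm φ χ H' (γ p)) X Y, Complex.re_ofReal_mul]
    ring

end Equivalent

end Invariance

end CRGeom

end

theorem proposition4p5 (n l k l' : ℕ) (hn : 1 ≤ n) (hl : 2 * l ≤ n)
    (hl1 : 1 ≤ l') (hl2 : l' ≤ k + 1)
    -- the two maps, defined on relatively open subsets of the hyperquadric
    (O O' : Set (CRGeom.Amb n)) (hO : IsOpen O) (hO' : IsOpen O')
    (H H' : CRGeom.Amb n → CRGeom.Amb (k + 2))
    (hH : CRGeom.IsCRMap (CRGeom.quadric n l) (CRGeom.winkelmann k l') O H)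
    (hHt : CRGeom.IsTransversal (CRGeom.quadric n l) (CRGeom.winkelmann k l') O H)
    -- the CR automorphism `γ` of the hyperquadric
    (γ γi : CRGeom.Amb n → CRGeom.Amb n)
    (hγ : CRGeom.IsCRAut (CRGeom.quadric n l) O O' γ γi)
    -- the CR automorphism `Φ` of the Winkelmann hypersurface
    (V V' : Set (CRGeom.Amb (k + 2))) (hV : IsOpen V) (hV' : IsOpen V')
    (Φ Φi : CRGeom.Amb (k + 2) → CRGeom.Amb (k + 2))
    (hΦ : CRGeom.IsCRAut (CRGeom.winkelmann k l') V V' Φ Φi)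
    (hHV : Set.MapsTo H (CRGeom.hypersurface (CRGeom.quadric n l) ∩ O) V)
    -- `H' = Φ ∘ H ∘ γ⁻¹`
    (hH' : Set.EqOn H' (Φ ∘ H ∘ γi) (CRGeom.hypersurface (CRGeom.quadric n l) ∩ O')) :
    -- `A(H) = e^u A(H')`: the differential of `γ` on the contact spaces is `e^{u/2} L` with `L`
    -- an isometry of the Levi forms, and `L` carries `A(H)` to `e^u A(H')`
    (∀ u : CRGeom.Amb n → ℝ,
      (∀ p ∈ CRGeom.hypersurface (CRGeom.quadric n l) ∩ O,
        ∀ v ∈ CRGeom.tangent (CRGeom.quadric n l) p,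
          CRGeom.theta (CRGeom.quadric n l) (γ p) (CRGeom.tderiv (CRGeom.quadric n l) γ p v)
            = Real.exp (u p) * CRGeom.theta (CRGeom.quadric n l) p v) →
      ∀ p ∈ CRGeom.hypersurface (CRGeom.quadric n l) ∩ O,
        ∃ L : CRGeom.contact (CRGeom.quadric n l) p ≃ₗ[ℂ]
            CRGeom.contact (CRGeom.quadric n l) (γ p),
          (∀ X : CRGeom.contact (CRGeom.quadric n l) p,
            CRGeom.tderiv (CRGeom.quadric n l) γ p X
              = Real.exp (u p / 2) • (L X : CRGeom.Amb n)) ∧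
          (∀ X Y : CRGeom.contact (CRGeom.quadric n l) p,
            CRGeom.leviForm (CRGeom.quadric n l) (γ p) (L X) (L Y)
              = CRGeom.leviForm (CRGeom.quadric n l) p X Y) ∧
          (∀ X Y : CRGeom.contact (CRGeom.quadric n l) p,
            CRGeom.ahlfors (CRGeom.quadric n l) (CRGeom.winkelmann k l') H p X Y
              = Real.exp (u p)
                * CRGeom.ahlfors (CRGeom.quadric n l) (CRGeom.winkelmann k l') H' (γ p)
                    (L X) (L Y))) ∧
    -- the rank of the Hermitian part is an invariant of the equivalence class
    (∀ p ∈ CRGeom.hypersurface (CRGeom.quadric n l) ∩ O,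
      (CRGeom.ahlforsHerm (CRGeom.quadric n l) (CRGeom.winkelmann k l') H p).rank
        = (CRGeom.ahlforsHerm (CRGeom.quadric n l) (CRGeom.winkelmann k l') H' (γ p)).rank) := by

  have e : CRGeom.Equivalent (CRGeom.quadric n l) (CRGeom.winkelmann k l') O O' V V' H H' γ γi
      Φ Φi :=
    ⟨CRGeom.ricciFlat_quadric n l, CRGeom.ricciFlat_winkelmann k l', by omega, by omega, hO, hO',
      hV, hV', hH, hHt, hγ, hΦ, hHV, hH'⟩
  refine ⟨fun u hu p hp => e.ahlfors_eq hp ?_, fun p hp => e.rank_ahlforsHerm hp⟩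
  have hs := CRGeom.contDiff_quadric n l
  -- Evaluating γ^*θ = e^u θ on the Reeb field, where θ = 1, gives λ_γ(p) = e^{u(p)}.
  rw [hu p hp _ (CRGeom.reeb_mem_tangent hs p), CRGeom.theta_reeb hs, mul_one]
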